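/- Let $W$ be the affine Weyl group of type $\tilde G_2$, i.e. the Coxeter group with generators $S=\{r,s,t\}$ and relations $r^2=s^2=t^2=(rs)^3=(rt)^2=(st)^6=e$, with length function $\ell$ and Bruhat order $\le$. Let $W_0=\langle s,t\rangle$ be the finite Weyl group of type $G_2$, where $s=s_\alpha$, $t=s_\beta$ for simple roots $\alpha$ (short) and $\beta$ (long), let $R^-$ be the set of negative roots, and let $w_0=ststst$ be the longest element of $W_0$. The fundamental weights $x_\alpha=2\alpha+\beta$ and $x_\beta=3\alpha+2\beta$, regarded as translations, are the elements $x_\alpha=ststsr$ and $x_\beta=(tstsr)^2$ of $W$; they generate the weight lattice $\Lambda\subset W$ (whose zero is the identity of $W$), and the dominant weights are $\Lambda^+=\{z\in\Lambda\mid \ell(zw_0)=\ell(z)+\ell(w_0)\}$. For $w\in W_0$ put $d_w=w\prod_{\gamma\in\{\alpha,\beta\},\,w(\gamma)\in R^-}x_\gamma$. Let $\mathcal H$ be the Hecke algebra of $(W,S)$ over $\mathcal A=\mathbb Z[q^{1/2},q^{-1/2}]$: it is generated by elements $T_w$ $(w\in W)$ with $T_e=1$, $(T_x-q)(T_x+1)=0$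 for $x\in S$, and $T_wT_u=T_{wu}$ if $\ell(wu)=\ell(w)+\ell(u)$. Its Kazhdan–Lusztig basis is the $\mathcal A$-basis $(C_w)_{w\in W}$ such that each $C_w$ is fixed by the bar involution ($q^{1/2}\mapsto q^{-1/2}$, $T_w\mapsto T_{w^{-1}}^{-1}$) and $C_w=q^{-\ell(w)/2}\sum_{u\le w}P_{u,w}T_u$ with $P_{w,w}=1$ and $P_{u,w}\in\mathbb Z[q]$ of degree at most $\frac12(\ell(w)-\ell(u)-1)$ for $u<w$. Write $C_xC_y=\sum_z h_{x,y,z}C_z$, let $$a(z)=\min\{i\in\mathbb N\mid q^{-i/2}h_{x,y,z}\in\mathbb Z[q^{-1/2}]\text{ for all }x,y\in W\},$$ and let $\delta_{x,y,z}$ be the coefficient of $q^{(a(z)-1)/2}$ in $h_{x,y,z}$. Then the Kazhdan–Lusztig basis exists and is unique, the minimum defining $a(z)$ is over a non-empty set for every $z\in W$ (so all the $\delta_{x,y,z}$ are well defined), and for all $u,u'\in W_0$ and $z_1\in\Lambda^+$: if $\delta_{w_0d_u^{-1},\,d_{u'}w_0,\,z_1w_0}\neq 0$, then $$\delta_{w_0d_u^{-1},\,d_{u'}w_0,\,z_1w_0}=1\quad\text{and}\quad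 z_1\in\{0,x_\alpha,x_\beta\}.$$ -/

import Mathlib

open scoped LaurentPolynomial

/-! ## The Hecke algebra and the Kazhdan–Lusztig basis of a Coxeter system

`ℤ[T;T⁻¹]` is the ring `𝒜 = ℤ[q^{1/2}, q^{-1/2}]`: `LaurentPolynomial.T n` stands for `q^{n/2}`. -/

namespace CoxeterSystem

/-- The Bruhat order: `u ≤ w` iff `w` is obtained from `u` by successively multiplying by
reflections, the length going up at each step. -/
def BruhatLE {B W : Type*} [Group W] {M : CoxeterMatrix B} (cs : CoxeterSystem M W) : W → W → Prop :=
  Relation.ReflTransGen fun u w => ∃ t, cs.IsReflection t ∧ w = u * t ∧ cs.length u < cs.length w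

/-- The defining relations of the Hecke algebra on generators `T_w`, `w ∈ W`. -/
inductive HeckeRel {B W : Type*} [Group W] {M : CoxeterMatrix B} (cs : CoxeterSystem M W) :
    FreeAlgebra ℤ[T;T⁻¹] W → FreeAlgebra ℤ[T;T⁻¹] W → Prop
  | one : HeckeRel cs (FreeAlgebra.ι _ 1) 1
  | quadratic (i : B) :
      HeckeRel cs
        ((FreeAlgebra.ι _ (cs.simple i) - algebraMap ℤ[T;T⁻¹] _ (LaurentPolynomial.T 2)) *
          (FreeAlgebra.ι _ (cs.simple i) + 1)) 0
  | mul (w u : W) (h : cs.length (w * u) = cs.length w + cs.length u) :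
      HeckeRel cs (FreeAlgebra.ι _ w * FreeAlgebra.ι _ u) (FreeAlgebra.ι _ (w * u))

/-- The Hecke algebra of `(W, S)` over `ℤ[q^{1/2}, q^{-1/2}]`. -/
def HeckeAlgebra {B W : Type*} [Group W] {M : CoxeterMatrix B} (cs : CoxeterSystem M W) : Type _ :=
  RingQuot (HeckeRel cs)

noncomputable instance {B W : Type*} [Group W] {M : CoxeterMatrix B} (cs : CoxeterSystem M W) :
    Ring (HeckeAlgebra cs) :=
  inferInstanceAs (Ring (RingQuot (HeckeRel cs)))

noncomputable instance {B W : Type*} [Group W] {M : CoxeterMatrix B} (cs : CoxeterSystem M W) :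
    Algebra ℤ[T;T⁻¹] (HeckeAlgebra cs) :=
  inferInstanceAs (Algebra ℤ[T;T⁻¹] (RingQuot (HeckeRel cs)))

section

variable {B W : Type*} [Group W] {M : CoxeterMatrix B} (cs : CoxeterSystem M W)

/-- The standard element `T_w`. -/
noncomputable def heckeT (w : W) : HeckeAlgebra cs :=
  RingQuot.mkAlgHom ℤ[T;T⁻¹] (HeckeRel cs) (FreeAlgebra.ι _ w)

theorem heckeT_one : heckeT cs 1 = 1 :=
  (RingQuot.mkAlgHom_rel ℤ[T;T⁻¹] (HeckeRel.one (cs := cs))).trans (map_one _)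

theorem heckeT_mul (w u : W) (h : cs.length (w * u) = cs.length w + cs.length u) :
    heckeT cs w * heckeT cs u = heckeT cs (w * u) :=
  (map_mul (RingQuot.mkAlgHom ℤ[T;T⁻¹] (HeckeRel cs)) _ _).symm.trans
    (RingQuot.mkAlgHom_rel ℤ[T;T⁻¹] (HeckeRel.mul w u h))

theorem heckeT_quadratic (i : B) :
    (heckeT cs (cs.simple i) - algebraMap ℤ[T;T⁻¹] _ (LaurentPolynomial.T 2)) *
      (heckeT cs (cs.simple i) + 1) = 0 := by
  have h := RingQuot.mkAlgHom_rel ℤ[T;T⁻¹] (HeckeRel.quadratic (cs := cs) i)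
  rw [map_mul, map_sub, map_add, map_one, map_zero, AlgHom.commutes] at h
  exact h

/-- The explicit inverse of `T_s` for a simple reflection `s`. -/
theorem heckeT_simple_mul (i : B) :
    heckeT cs (cs.simple i) * (algebraMap ℤ[T;T⁻¹] _ (LaurentPolynomial.T (-2)) *
      (heckeT cs (cs.simple i) + 1 - algebraMap ℤ[T;T⁻¹] _ (LaurentPolynomial.T 2))) = 1 ∧
    (algebraMap ℤ[T;T⁻¹] _ (LaurentPolynomial.T (-2)) *
      (heckeT cs (cs.simple i) + 1 - algebraMap ℤ[T;T⁻¹] _ (LaurentPolynomial.T 2))) *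
        heckeT cs (cs.simple i) = 1 := by
  have h := heckeT_quadratic cs i
  have hq : algebraMap ℤ[T;T⁻¹] (HeckeAlgebra cs) (LaurentPolynomial.T (-2)) *
      algebraMap ℤ[T;T⁻¹] _ (LaurentPolynomial.T 2) = 1 := by
    rw [← map_mul, ← LaurentPolynomial.T_add]; simp
  have c1 := Algebra.commutes (LaurentPolynomial.T 2 : ℤ[T;T⁻¹]) (heckeT cs (cs.simple i))
  have c2 := Algebra.commutes (LaurentPolynomial.T (-2) : ℤ[T;T⁻¹]) (heckeT cs (cs.simple i))
  generalize heckeT cs (cs.simple i) = t at *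
  generalize algebraMap ℤ[T;T⁻¹] (HeckeAlgebra cs) (LaurentPolynomial.T 2) = q at *
  generalize algebraMap ℤ[T;T⁻¹] (HeckeAlgebra cs) (LaurentPolynomial.T (-2)) = p at *
  have e : t * (t + 1 - q) = q := by
    have : t * (t + 1 - q) - q = (t - q) * (t + 1) := by
      rw [mul_sub, mul_add, sub_mul, mul_add, mul_add, ← c1]; noncomm_ring
    rw [h] at this
    exact sub_eq_zero.mp this
  have e' : (t + 1 - q) * t = q := by
    rw [sub_mul, add_mul, c1, one_mul]
    rw [mul_sub, mul_add, mul_one] at e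
    exact e
  refine ⟨?_, ?_⟩
  · rw [← mul_assoc, ← c2, mul_assoc, e, hq]
  · rw [mul_assoc, e', hq]

theorem isUnit_heckeT (w : W) : IsUnit (heckeT cs w) := by
  induction hn : cs.length w generalizing w with
  | zero => rw [cs.length_eq_zero_iff.mp hn, heckeT_one]; exact isUnit_one
  | succ n ih =>
    have hw : w ≠ 1 := by rintro rfl; simp at hn
    obtain ⟨i, hi⟩ := cs.exists_leftDescent_of_ne_one hw
    rw [cs.isLeftDescent_iff] at hi
    have h2 : heckeT cs w = heckeT cs (cs.simple i) * heckeT cs (cs.simple i * w) := by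
      rw [heckeT_mul]
      · rw [cs.simple_mul_simple_cancel_left]
      · rw [cs.simple_mul_simple_cancel_left, cs.length_simple]; omega
    rw [h2]
    exact (isUnit_iff_exists.mpr ⟨_, heckeT_simple_mul cs i⟩).mul (ih _ (by omega))

/-- The Hecke algebra as a ring, with `q^{1/2}` acting as multiplication by `q^{-1/2}`. -/
def HeckeBar : Type _ := HeckeAlgebra cs

noncomputable instance : Ring (HeckeBar cs) := inferInstanceAs (Ring (HeckeAlgebra cs))

/-- The identity map, as an isomorphism of rings. -/
noncomputable def toHeckeBar : HeckeAlgebra cs ≃+* HeckeBar cs := RingEquiv.refl (HeckeAlgebra cs)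

noncomputable instance : Algebra ℤ[T;T⁻¹] (HeckeBar cs) :=
  RingHom.toAlgebra' ((algebraMap ℤ[T;T⁻¹] (HeckeAlgebra cs)).comp
    (LaurentPolynomial.invert (R := ℤ)).toRingEquiv.toRingHom)
    fun c x => Algebra.commutes (A := HeckeAlgebra cs) (LaurentPolynomial.invert c) x

theorem algebraMap_heckeBar (c : ℤ[T;T⁻¹]) :
    algebraMap ℤ[T;T⁻¹] (HeckeBar cs) c =
      toHeckeBar cs (algebraMap ℤ[T;T⁻¹] (HeckeAlgebra cs) (LaurentPolynomial.invert c)) := rfl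

/-- The images of the generators under the bar involution: `T_w ↦ (T_{w⁻¹})⁻¹`. -/
noncomputable def heckeTBar (w : W) : HeckeBar cs :=
  toHeckeBar cs (Ring.inverse (heckeT cs w⁻¹))

theorem heckeTBar_rel ⦃x y : FreeAlgebra ℤ[T;T⁻¹] W⦄ (h : HeckeRel cs x y) :
    FreeAlgebra.lift ℤ[T;T⁻¹] (heckeTBar cs) x = FreeAlgebra.lift ℤ[T;T⁻¹] (heckeTBar cs) y := by
  induction h with
  | one =>
    rw [FreeAlgebra.lift_ι_apply, map_one, heckeTBar, inv_one, heckeT_one, Ring.inverse_one,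
      map_one]
  | quadratic i =>
    rw [map_mul, map_sub, map_add, map_one, map_zero, AlgHom.commutes, FreeAlgebra.lift_ι_apply,
      algebraMap_heckeBar, LaurentPolynomial.invert_T, heckeTBar, cs.inv_simple,
      ← map_one (toHeckeBar cs), ← map_sub, ← map_add, ← map_mul, ← map_zero (toHeckeBar cs)]
    congr 1
    obtain ⟨h1, h2⟩ := heckeT_simple_mul cs i
    have hq : algebraMap ℤ[T;T⁻¹] (HeckeAlgebra cs) (LaurentPolynomial.T (-2)) *
        algebraMap ℤ[T;T⁻¹] _ (LaurentPolynomial.T 2) = 1 := by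
      rw [← map_mul, ← LaurentPolynomial.T_add]; simp
    have h := heckeT_quadratic cs i
    have hinv : Ring.inverse (heckeT cs (cs.simple i)) =
        algebraMap ℤ[T;T⁻¹] _ (LaurentPolynomial.T (-2)) *
          (heckeT cs (cs.simple i) + 1 - algebraMap ℤ[T;T⁻¹] _ (LaurentPolynomial.T 2)) :=
      Ring.inverse_unit (⟨_, _, h1, h2⟩ : (HeckeAlgebra cs)ˣ)
    have c2 := Algebra.commutes (LaurentPolynomial.T (-2) : ℤ[T;T⁻¹]) (heckeT cs (cs.simple i))
    have hc := Algebra.commutes (LaurentPolynomial.T (-2) : ℤ[T;T⁻¹])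
      (algebraMap ℤ[T;T⁻¹] (HeckeAlgebra cs) (LaurentPolynomial.T 2))
    rw [hinv]
    generalize heckeT cs (cs.simple i) = t at *
    generalize algebraMap ℤ[T;T⁻¹] (HeckeAlgebra cs) (LaurentPolynomial.T 2) = q at *
    generalize algebraMap ℤ[T;T⁻¹] (HeckeAlgebra cs) (LaurentPolynomial.T (-2)) = p at *
    have e1 : p * (t + 1 - q) - p = p * (t - q) := by noncomm_ring
    have e2 : p * (t + 1 - q) + 1 = p * (t + 1) := by
      rw [mul_sub, hq, mul_add, mul_one]; abel
    rw [e1, e2, mul_assoc, ← mul_assoc (t - q)]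
    have e3 : (t - q) * p = p * (t - q) := by
      have c3 : q * p = 1 := by
        rw [← hq]; exact hc.symm
      rw [sub_mul, mul_sub, c2, hq, c3]
    rw [e3, mul_assoc, h, mul_zero, mul_zero]
  | mul w u hl =>
    rw [map_mul, FreeAlgebra.lift_ι_apply, FreeAlgebra.lift_ι_apply, FreeAlgebra.lift_ι_apply,
      heckeTBar, heckeTBar, heckeTBar, mul_inv_rev, ← heckeT_mul,
      ← map_mul]
    · obtain ⟨a, ha⟩ := isUnit_heckeT cs w⁻¹
      obtain ⟨b, hb⟩ := isUnit_heckeT cs u⁻¹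
      rw [← ha, ← hb, ← Units.val_mul, Ring.inverse_unit, Ring.inverse_unit, Ring.inverse_unit, mul_inv_rev, Units.val_mul]
    · rw [← mul_inv_rev, cs.length_inv, cs.length_inv, cs.length_inv, hl, add_comm]

/-- The bar involution: the ring endomorphism with `q^{1/2} ↦ q^{-1/2}`, `T_w ↦ (T_{w⁻¹})⁻¹`. -/
noncomputable def heckeBar : HeckeAlgebra cs →+* HeckeAlgebra cs :=
  (toHeckeBar cs).symm.toRingHom.comp (RingQuot.liftAlgHom ℤ[T;T⁻¹] ⟨FreeAlgebra.lift ℤ[T;T⁻¹] (heckeTBar cs),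
    heckeTBar_rel cs⟩ : RingQuot (HeckeRel cs) →ₐ[ℤ[T;T⁻¹]] HeckeBar cs).toRingHom

theorem heckeBar_heckeT (w : W) : heckeBar cs (heckeT cs w) = Ring.inverse (heckeT cs w⁻¹) :=
  (RingQuot.liftAlgHom_mkAlgHom_apply ℤ[T;T⁻¹] (FreeAlgebra.lift ℤ[T;T⁻¹] (heckeTBar cs))
    (heckeTBar_rel cs) _).trans (FreeAlgebra.lift_ι_apply _ _)

theorem heckeBar_algebraMap (c : ℤ[T;T⁻¹]) :
    heckeBar cs (algebraMap ℤ[T;T⁻¹] _ c) = algebraMap ℤ[T;T⁻¹] _ (LaurentPolynomial.invert c) :=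
  AlgHom.commutes (RingQuot.liftAlgHom ℤ[T;T⁻¹] ⟨FreeAlgebra.lift ℤ[T;T⁻¹] (heckeTBar cs),
    heckeTBar_rel cs⟩ : RingQuot (HeckeRel cs) →ₐ[ℤ[T;T⁻¹]] HeckeBar cs) c

/-- `C` is the Kazhdan–Lusztig basis: each `C_w` is bar-invariant and equals
`q^{-ℓ(w)/2} ∑_{u ≤ w} P_{u,w}(q) T_u` with `P_{w,w} = 1` and `P_{u,w} ∈ ℤ[q]` of degree at most
`(ℓ(w) - ℓ(u) - 1) / 2` for `u < w`. The family `P` below is `u ↦ P_{u,w}`, with `P_{u,w} = 0`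
unless `u ≤ w`. -/
def IsKLBasis (C : Module.Basis W ℤ[T;T⁻¹] (HeckeAlgebra cs)) : Prop :=
  ∀ w, heckeBar cs (C w) = C w ∧
    ∃ P : W →₀ Polynomial ℤ,
      (∀ u ∈ P.support, cs.BruhatLE u w) ∧
      P w = 1 ∧
      (∀ u ∈ P.support, u ≠ w → 2 * (P u).natDegree + 1 + cs.length u ≤ cs.length w) ∧
      C w = (LaurentPolynomial.T (-(cs.length w : ℤ)) : ℤ[T;T⁻¹]) •
        P.sum fun u p => Polynomial.aeval (LaurentPolynomial.T 2 : ℤ[T;T⁻¹]) p • heckeT cs u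

variable {cs}

/-- The structure constant `h_{x,y,z}`: the coefficient of `C_z` in `C_x C_y`. -/
noncomputable def klStructureConst (C : Module.Basis W ℤ[T;T⁻¹] (HeckeAlgebra cs)) (x y z : W) :
    ℤ[T;T⁻¹] :=
  C.repr (C x * C y) z

/-- The set of `i ∈ ℕ` such that `q^{-i/2} h_{x,y,z} ∈ ℤ[q^{-1/2}]` for all `x, y`. -/
def aBounds (C : Module.Basis W ℤ[T;T⁻¹] (HeckeAlgebra cs)) (z : W) : Set ℕ :=
  {i | ∀ x y, ∀ n : ℤ, 0 < n →
    (LaurentPolynomial.T (-(i : ℤ)) * klStructureConst C x y z).coeff n = 0}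

/-- Lusztig's function `a(z)`, the least element of `aBounds C z`. -/
noncomputable def aFunction (C : Module.Basis W ℤ[T;T⁻¹] (HeckeAlgebra cs)) (z : W) : ℕ :=
  sInf (aBounds C z)

/-- `δ_{x,y,z}`: the coefficient of `q^{(a(z)-1)/2}` in `h_{x,y,z}`. -/
noncomputable def klDelta (C : Module.Basis W ℤ[T;T⁻¹] (HeckeAlgebra cs)) (x y z : W) : ℤ :=
  (klStructureConst C x y z).coeff ((aFunction C z : ℤ) - 1)

end

end CoxeterSystem

/-! ## The affine Weyl group of type `G̃₂` -/

namespace AffineG2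

/-- The Coxeter matrix of type `G̃₂`, with `r, s, t` numbered `0, 1, 2`:
`(rs)³ = (rt)² = (st)⁶ = e`. -/
def coxeterMatrix : CoxeterMatrix (Fin 3) where
  M := !![1, 3, 2;
          3, 1, 6;
          2, 6, 1]
  off_diagonal := by
    intro i j
    fin_cases i <;> fin_cases j <;> simp

/-- The affine Weyl group `W` of type `G̃₂`. -/
abbrev W : Type := coxeterMatrix.Group

/-- `W` with its set `S = {r, s, t}` of simple reflections. -/
def cs : CoxeterSystem coxeterMatrix W := coxeterMatrix.toCoxeterSystem

def r : W := cs.simple 0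
def s : W := cs.simple 1
def t : W := cs.simple 2

/-- The finite Weyl group `W₀` of type `G₂`, generated by `s = s_α` and `t = s_β`. -/
def W₀ : Subgroup W := Subgroup.closure {s, t}

/-- The longest element of `W₀`. -/
def w₀ : W := s * t * s * t * s * t

/-- The translation by the fundamental weight `x_α = 2α + β`. -/
def xα : W := s * t * s * t * s * r

/-- The translation by the fundamental weight `x_β = 3α + 2β`. -/
def xβ : W := (t * s * t * s * r) ^ 2

/-- The weight lattice `Λ` (equal to the root lattice), written multiplicatively inside `W`; its
zero element is `1 : W`. -/
def weightLattice : Subgroup W := Subgroup.closure {xα, xβ}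

/-- The dominant weights `Λ⁺`. -/
def dominantWeights : Set W :=
  {z | z ∈ weightLattice ∧ cs.length (z * w₀) = cs.length z + cs.length w₀}

/-- The linear action of the simple reflections on `ℤα ⊕ ℤβ` (`α` short, `β` long): `s` and `t` act
by `s_α : α ↦ -α, β ↦ 3α + β` and `s_β : α ↦ α + β, β ↦ -β`, and `r` acts by the linear part of the
affine reflection, which is the reflection in the highest short root `2α + β`. -/
def simpleAction : Fin 3 → Matrix (Fin 2) (Fin 2) ℤ :=
  ![!![-1, 0;
       -1, 1],
    !![-1, 3;
       0, 1],
    !![1, 0;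
       1, -1]]

theorem simpleAction_isLiftable : coxeterMatrix.IsLiftable simpleAction := by
  unfold CoxeterMatrix.IsLiftable
  decide

/-- The linear action of `W` on the root lattice, through `W → W₀`. -/
def rootAction : W →* Matrix (Fin 2) (Fin 2) ℤ := cs.lift ⟨simpleAction, simpleAction_isLiftable⟩

/-- The simple root `α`, in coordinates with respect to `α, β`. -/
def α : Fin 2 → ℤ := ![1, 0]

/-- The simple root `β`, in coordinates with respect to `α, β`. -/
def β : Fin 2 → ℤ := ![0, 1]

/-- The negative roots `R⁻` of `G₂`. -/
def negRoots : Set (Fin 2 → ℤ) :=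
  {-α, -β, -(α + β), -(2 • α + β), -(3 • α + β), -(3 • α + 2 • β)}

open Classical in
/-- `d_w = w ∏_{γ ∈ Δ, w(γ) ∈ R⁻} x_γ`. -/
noncomputable def d (w : W) : W :=
  w * ((if (rootAction w).mulVec α ∈ negRoots then xα else 1) *
    (if (rootAction w).mulVec β ∈ negRoots then xβ else 1))

end AffineG2

/-! ## Affine roots of `G̃₂` -/

namespace AffineG2

/-! Write v = q^{1/2} and ξ = v − v⁻¹, and normalise T_w to T̃_w = v^{-ℓ(w)} T_w (`heckeTn`).

Existence and uniqueness of the basis. W acts faithfully on affine functionals, and following the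
sign of an affine root along a word yields the strong exchange property (`strongExchange`). Exchange
makes the left and right multiplication operators on the free module over W commute, so the T_w are
linearly independent. A bar-invariant element whose coordinates contain only negative powers of v is
zero (`eq_zero_of_heckeBar_eq`); this is uniqueness. Existence is the usual recursion C_{ws} C_s − Σ
μ C_u (`exists_isKLElement`).

Degree bound. The structure constants of the T̃_w are polynomials in ξ with natural coefficients, so
left multiplication by T̃_g cannot lower degrees. Hence x may be replaced by an element gx lying
deep inside a Weyl chamber. There the descents met along a reduced word of y depend on linear parts
only, and each factor ξ lowers a count of coroots that never exceeds 6 (`degLE_repr_heckeTn_mul`).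
So all h_{x,y,z} have degree at most 6 in v and a ≤ 6. Moreover a(w w₀) = 6 when w is minimal in w
W₀, because C_{w w₀} C_{w₀} is a multiple of C_{w w₀} by a scalar with leading term v⁶
(`aFunction_mul_w₀`). The δ in question is therefore a coefficient of v⁵.

Reading it off. By triangularity the coefficient of v⁶ at a given element is the same in the
Kazhdan–Lusztig basis and in the basis T̃. The coefficient of v⁵ at w is the same too, unless T̃_w
occurs in some other C_z that carries a v⁶ (`IsKLBasis.coeff_repr_sub_one`). Here only z = w₀ can
carry one, and C_{w₀} is supported on W₀.

Finite computation. In the left ideal of C_{w₀} the elements T̃_{m_p} C_{w₀}, with m_p minimal in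
the coset attached to a lattice point p, are permuted by the T_i up to explicit corrections. A
program builds bar-invariant h_u with h_u C_{w₀} = C_{d_u w₀}, which uniqueness certifies
(`checkKL_table`). The anti-involution ♭ : T_w ↦ T_{w⁻¹} then gives C_{w₀ d_u⁻¹} C_{d_{u'} w₀} =
C_{w₀} h_u^♭ h_{u'} C_{w₀}. For all 144 pairs this is evaluated up to terms of degree at most 4
(`checkTop_table`): v⁶ occurs only at w₀, and at dominant weights v⁵ occurs only at 0, x_α, x_β,
with coefficient 0 or 1. -/

/-- The action of the simple reflections on affine functionals `a A + b B + k`, where `A` and `B`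
are the coordinates with respect to the fundamental weights, written as triples `(a, b, k)`. -/
def simpleEnd : Fin 3 → Module.End ℤ (ℤ × ℤ × ℤ)
  | 0 =>
    { toFun := fun f => (-f.1, f.2.1 - 3 * f.1, f.2.2 + f.1)
      map_add' := fun f g => by ext <;> simp <;> ring
      map_smul' := fun c f => by ext <;> simp <;> ring }
  | 1 =>
    { toFun := fun f => (f.2.1 - f.1, f.2.1, f.2.2)
      map_add' := fun f g => by ext <;> simp <;> ring
      map_smul' := fun c f => by ext <;> simp <;> ring }
  | 2 =>
    { toFun := fun f => (f.1, 3 * f.1 - f.2.1, f.2.2)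
      map_add' := fun f g => by ext <;> simp <;> ring
      map_smul' := fun c f => by ext <;> simp <;> ring }

theorem simpleEnd_zero (f : ℤ × ℤ × ℤ) :
    simpleEnd 0 f = (-f.1, f.2.1 - 3 * f.1, f.2.2 + f.1) := rfl

theorem simpleEnd_one (f : ℤ × ℤ × ℤ) : simpleEnd 1 f = (f.2.1 - f.1, f.2.1, f.2.2) := rfl

theorem simpleEnd_two (f : ℤ × ℤ × ℤ) : simpleEnd 2 f = (f.1, 3 * f.1 - f.2.1, f.2.2) := rfl

theorem simpleEnd_isLiftable : coxeterMatrix.IsLiftable simpleEnd := by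
  have key : ∀ i j : Fin 3, ∀ f : ℤ × ℤ × ℤ,
      ((simpleEnd i * simpleEnd j) ^ (coxeterMatrix.M i j)) f = f := by
    intro i j f
    fin_cases i <;> fin_cases j <;>
    · simp [coxeterMatrix, pow_succ, simpleEnd_zero, simpleEnd_one, simpleEnd_two]
      try (ext <;> simp <;> ring)
  intro i j
  exact LinearMap.ext (key i j)

/-- The action of `W` on affine functionals. -/
def act : W →* Module.End ℤ (ℤ × ℤ × ℤ) := cs.lift ⟨simpleEnd, simpleEnd_isLiftable⟩

theorem act_simple (i : Fin 3) : act (cs.simple i) = simpleEnd i :=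
  cs.lift_apply_simple simpleEnd_isLiftable i

theorem act_mul_apply (u w : W) (f : ℤ × ℤ × ℤ) : act (u * w) f = act u (act w f) := by
  rw [map_mul]; rfl

theorem act_inv_apply (w : W) (f : ℤ × ℤ × ℤ) : act w⁻¹ (act w f) = f := by
  rw [← act_mul_apply, inv_mul_cancel, map_one]; rfl

theorem act_apply_inv (w : W) (f : ℤ × ℤ × ℤ) : act w (act w⁻¹ f) = f := by
  rw [← act_mul_apply, mul_inv_cancel, map_one]; rfl

theorem act_wordProd (ω : List (Fin 3)) (f : ℤ × ℤ × ℤ) :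
    act (cs.wordProd ω) f = ω.foldr (fun i g => simpleEnd i g) f := by
  induction ω with
  | nil => simp
  | cons i ω ih => rw [cs.wordProd_cons, act_mul_apply, ih, act_simple, List.foldr_cons]

/-! ### Relations -/

theorem r_eq : r = cs.simple 0 := rfl
theorem s_eq : s = cs.simple 1 := rfl
theorem t_eq : t = cs.simple 2 := rfl

theorem s_mul_s : s * s = 1 := cs.simple_mul_simple_self 1
theorem t_mul_t : t * t = 1 := cs.simple_mul_simple_self 2
theorem r_mul_r_mul (w : W) : r * (r * w) = w := cs.simple_mul_simple_cancel_left 0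
theorem s_mul_s_mul (w : W) : s * (s * w) = w := cs.simple_mul_simple_cancel_left 1
theorem t_mul_t_mul (w : W) : t * (t * w) = w := cs.simple_mul_simple_cancel_left 2
theorem r_inv : r⁻¹ = r := cs.inv_simple 0
theorem s_inv : s⁻¹ = s := cs.inv_simple 1
theorem t_inv : t⁻¹ = t := cs.inv_simple 2

theorem t_mul_r : t * r = r * t := by
  have h : (r * t) ^ 2 = 1 := cs.simple_mul_simple_pow 0 2
  have h2 : (r * t) * (r * t) = 1 := by rw [← pow_two, h]
  rw [mul_eq_one_iff_eq_inv.mp h2, mul_inv_rev, r_inv, t_inv]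

theorem t_mul_r_mul (w : W) : t * (r * w) = r * (t * w) := by
  rw [← mul_assoc, t_mul_r, mul_assoc]

theorem braid_rs : r * (s * r) = s * (r * s) := by
  have h : (r * s) ^ 3 = 1 := cs.simple_mul_simple_pow 0 1
  have h2 : (r * (s * r)) * (s * (r * s)) = 1 := by
    rw [← h]; simp only [pow_succ, pow_zero, one_mul, mul_assoc]
  rw [mul_eq_one_iff_eq_inv.mp h2]
  simp only [mul_inv_rev, r_inv, s_inv, mul_assoc]

theorem braid_rs_mul (w : W) : r * (s * (r * w)) = s * (r * (s * w)) := by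
  have := congrArg (· * w) braid_rs
  simpa only [mul_assoc] using this

theorem braid_st : s * (t * (s * (t * (s * t)))) = t * (s * (t * (s * (t * s)))) := by
  have h : (s * t) ^ 6 = 1 := cs.simple_mul_simple_pow 1 2
  have h2 : (s * (t * (s * (t * (s * t))))) * (s * (t * (s * (t * (s * t))))) = 1 := by
    rw [← h]; simp only [pow_succ, pow_zero, one_mul, mul_assoc]
  rw [mul_eq_one_iff_eq_inv.mp h2]
  simp only [mul_inv_rev, t_inv, s_inv, mul_assoc]

theorem braid_st_mul (w : W) :
    s * (t * (s * (t * (s * (t * w))))) = t * (s * (t * (s * (t * (s * w))))) := by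
  have := congrArg (· * w) braid_st
  simpa only [mul_assoc] using this

/-! ### Translations -/

theorem t_conj_xα : t * xα * t = xα := by
  simp only [xα, mul_assoc]
  rw [← t_mul_r, ← braid_st_mul, t_mul_t_mul]

theorem xβ_eq : xβ = s * xα * s * xα := by
  simp only [xα, xβ, mul_assoc, pow_two, s_mul_s_mul]

theorem s_conj_xβ : s * xβ * s = xβ := by
  have h : s * xβ = xβ * s := by
    simp only [xβ, pow_two, mul_assoc]
    simp only [← t_mul_r_mul, braid_st_mul, ← braid_rs_mul, ← braid_rs]
  rw [h, mul_assoc, s_mul_s, mul_one]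

theorem s_conj_xα : s * xα * s = xα⁻¹ * xβ := by
  rw [eq_inv_mul_iff_mul_eq]
  have h := s_conj_xβ
  rw [xβ_eq] at h ⊢
  simp only [mul_assoc, s_mul_s_mul] at h ⊢
  exact h

/-- Substituting s xα s = xα⁻¹ xβ into xβ = (s xα s) xα gives xβ = xα⁻¹ xβ xα. -/
theorem commute_xα_xβ : Commute xα xβ := by
  have h1 : s * xα * s * xα = xβ := xβ_eq.symm
  rw [s_conj_xα] at h1
  have : xβ * xα = xα * xβ := by rw [mul_assoc, inv_mul_eq_iff_eq_mul] at h1; exact h1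
  exact this.symm

/-- Write xβ = xα y with y = s xα s. Conjugation by t fixes xα, and it sends y to xα y⁻¹ by the
braid relations. -/
theorem t_conj_xβ : t * xβ * t = xα ^ 3 * xβ⁻¹ := by
  have hy : t * (s * xα * s) * t * (s * xα * s) = xα := by
    simp only [xα, mul_assoc, s_mul_s_mul]
    simp only [← t_mul_r_mul, t_mul_t_mul, ← braid_rs_mul, ← braid_rs, r_mul_r_mul]
  have hc : xβ = xα * (s * xα * s) := by rw [s_conj_xα, mul_inv_cancel_left]
  have h1 : t * xβ * t = xα * (t * (s * xα * s) * t) := by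
    have h2 : t * (xα * (s * xα * s)) * t = t * xα * t * (t * (s * xα * s) * t) := by
      simp only [mul_assoc, t_mul_t_mul]
    rw [hc, h2, t_conj_xα]
  rw [h1, eq_mul_inv_of_mul_eq hy, s_conj_xα, mul_inv_rev, inv_inv,
    commute_xα_xβ.symm.inv_left.eq]
  simp only [pow_succ, pow_zero, one_mul, mul_assoc]

/-- Reduced words for the twelve elements of `W₀`. -/
def w₀Words : List (List (Fin 3)) :=
  [[], [1], [1, 2], [1, 2, 1], [1, 2, 1, 2], [1, 2, 1, 2, 1], [1, 2, 1, 2, 1, 2],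
    [2], [2, 1], [2, 1, 2], [2, 1, 2, 1], [2, 1, 2, 1, 2]]

theorem exists_w₀Words {u : W} (hu : u ∈ W₀) : ∃ ω ∈ w₀Words, u = cs.wordProd ω := by
  have key : ∀ i ∈ ({1, 2} : Set (Fin 3)), ∀ ω ∈ w₀Words,
      ∃ ω' ∈ w₀Words, cs.simple i * cs.wordProd ω = cs.wordProd ω' := by
    have b := braid_st
    have c1 := s_mul_s
    have c2 := s_mul_s_mul
    have c3 := t_mul_t
    have c4 := t_mul_t_mul
    simp only [s_eq, t_eq] at b c1 c2 c3 c4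
    have b' := b.symm
    have d2 := congrArg (cs.simple 2 * ·) b
    simp only [c4] at d2
    intro i hi ω hω
    have hi' : i = 1 ∨ i = 2 := by simpa using hi
    simp only [w₀Words, List.mem_cons, List.not_mem_nil, or_false] at hω ⊢
    rcases hi' with rfl | rfl <;>
    rcases hω with rfl | rfl | rfl | rfl | rfl | rfl | rfl | rfl | rfl | rfl | rfl | rfl <;>
    simp only [cs.wordProd_cons, cs.wordProd_nil, mul_one, exists_eq_or_imp, exists_eq_left,
      c1, c2, c3, c4, b', d2, true_or, or_true]
  have inv : ∀ i ∈ ({1, 2} : Set (Fin 3)), ∀ ω ∈ w₀Words,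
      ∃ ω' ∈ w₀Words, (cs.simple i)⁻¹ * cs.wordProd ω = cs.wordProd ω' := by
    simpa only [cs.inv_simple] using key
  induction hu using Subgroup.closure_induction_left with
  | one => exact ⟨[], by simp [w₀Words], by simp⟩
  | mul_left x hx y hy ih =>
    obtain ⟨ω, hω, rfl⟩ := ih
    rcases hx with rfl | rfl
    · exact key 1 (by simp) ω hω
    · exact key 2 (by simp) ω hω
  | inv_mul_cancel x hx y hy ih =>
    obtain ⟨ω, hω, rfl⟩ := ih
    rcases hx with rfl | rfl
    · exact inv 1 (by simp) ω hω
    · exact inv 2 (by simp) ω hω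

theorem s_mem_W₀ : s ∈ W₀ := Subgroup.subset_closure (by simp)

theorem t_mem_W₀ : t ∈ W₀ := Subgroup.subset_closure (by simp)

/-- Every element of `W` is a translation times an element of `W₀`. -/
theorem exists_eq_translation_mul (w : W) :
    ∃ (a b : ℤ) (u : W), u ∈ W₀ ∧ w = xα ^ a * xβ ^ b * u := by
  have conj : ∀ (g x : W) (n : ℤ), g * g = 1 → g * x ^ n = (g * x * g) ^ n * g := by
    intro g x n hg
    have := map_zpow (MulAut.conj g) x n
    simp only [MulAut.conj_apply] at this
    have hi : g⁻¹ = g := (eq_inv_of_mul_eq_one_left hg).symm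
    rw [hi] at this
    rw [← this, mul_assoc, mul_assoc, hg, mul_one]
  let N : W → Prop := fun w => ∃ (a b : ℤ) (u : W), u ∈ W₀ ∧ w = xα ^ a * xβ ^ b * u
  have hs : ∀ w, N w → N (s * w) := by
    rintro _ ⟨a, b, u, hu, rfl⟩
    refine ⟨-a, a + b, s * u, W₀.mul_mem s_mem_W₀ hu, ?_⟩
    have h1 : s * xα ^ a = xα ^ (-a) * xβ ^ a * s := by
      rw [conj s xα a s_mul_s, s_conj_xα, commute_xα_xβ.inv_left.mul_zpow, inv_zpow, zpow_neg]
    have h2 : s * xβ ^ b = xβ ^ b * s := by rw [conj s xβ b s_mul_s, s_conj_xβ]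
    rw [zpow_add, ← mul_assoc, ← mul_assoc, h1, mul_assoc _ s, h2]
    simp only [mul_assoc]
  have ht : ∀ w, N w → N (t * w) := by
    rintro _ ⟨a, b, u, hu, rfl⟩
    refine ⟨a + 3 * b, -b, t * u, W₀.mul_mem t_mem_W₀ hu, ?_⟩
    have h1 : t * xα ^ a = xα ^ a * t := by rw [conj t xα a t_mul_t, t_conj_xα]
    have h2 : t * xβ ^ b = xα ^ (3 * b) * xβ ^ (-b) * t := by
      rw [conj t xβ b t_mul_t, t_conj_xβ, ((commute_xα_xβ.pow_left 3).inv_right).mul_zpow,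
        inv_zpow, zpow_neg, zpow_mul]
      rfl
    rw [zpow_add, ← mul_assoc, ← mul_assoc, h1, mul_assoc _ t, h2]
    simp only [mul_assoc]
  have hx : ∀ w, N w → N (xα * w) := by
    rintro _ ⟨a, b, u, hu, rfl⟩
    exact ⟨1 + a, b, u, hu, by rw [zpow_add, zpow_one]; simp only [mul_assoc]⟩
  have hr : ∀ w, N w → N (r * w) := by
    intro w hw
    -- Solves xα = s t s t s r for r, so that stability under s, t and xα suffices.
    have : r * w = s * (t * (s * (t * (s * (xα * w))))) := by
      simp only [xα, mul_assoc, s_mul_s_mul, t_mul_t_mul]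
    rw [this]
    exact hs _ (ht _ (hs _ (ht _ (hs _ (hx _ hw)))))
  change N w
  induction w using cs.simple_induction_left with
  | one => exact ⟨0, 0, 1, W₀.one_mem, by simp⟩
  | mul_simple_left w i ih =>
    fin_cases i
    · exact hr _ ih
    · exact hs _ ih
    · exact ht _ ih

/-- `w` acts as the translation by `-ν` (in coordinates). -/
def IsTrans (w : W) (ν : ℤ × ℤ) : Prop :=
  ∀ f, act w f = (f.1, f.2.1, f.2.2 + (ν.1 * f.1 + ν.2 * f.2.1))

theorem IsTrans.mul {w w' : W} {ν ν' : ℤ × ℤ} (h : IsTrans w ν) (h' : IsTrans w' ν') :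
    IsTrans (w * w') (ν + ν') := by
  intro f
  rw [act_mul_apply, h', h]
  ext <;> simp
  ring

theorem IsTrans.one : IsTrans 1 0 := by
  intro f
  simp

theorem IsTrans.inv {w : W} {ν : ℤ × ℤ} (h : IsTrans w ν) : IsTrans w⁻¹ (-ν) := by
  intro f
  have := h (f.1, f.2.1, f.2.2 + ((-ν).1 * f.1 + (-ν).2 * f.2.1))
  rw [← act_inv_apply w (f.1, f.2.1, f.2.2 + ((-ν).1 * f.1 + (-ν).2 * f.2.1)), this]
  congr 1
  ext
  · rfl
  · rfl
  · simp only [Prod.fst_neg, Prod.snd_neg]; ring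

theorem IsTrans.zpow {w : W} {ν : ℤ × ℤ} (h : IsTrans w ν) (n : ℤ) : IsTrans (w ^ n) (n • ν) := by
  induction n using Int.induction_on with
  | zero => simpa using IsTrans.one
  | succ n ih => rw [zpow_add_one, add_smul, one_smul]; exact ih.mul h
  | pred n ih => rw [zpow_sub_one, sub_smul, one_smul, sub_eq_add_neg]; exact ih.mul h.inv

theorem isTrans_xα : IsTrans xα (1, 0) := by
  intro f
  have : xα = cs.wordProd [1, 2, 1, 2, 1, 0] := by
    simp [xα, cs.wordProd_cons, r_eq, s_eq, t_eq, mul_assoc]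
  rw [this, act_wordProd]
  simp [simpleEnd_zero, simpleEnd_one, simpleEnd_two]
  constructor <;> ring

theorem isTrans_xβ : IsTrans xβ (0, 1) := by
  intro f
  have : xβ = cs.wordProd [2, 1, 2, 1, 0, 2, 1, 2, 1, 0] := by
    simp [xβ, cs.wordProd_cons, r_eq, s_eq, t_eq, mul_assoc, pow_two]
  rw [this, act_wordProd]
  simp [simpleEnd_zero, simpleEnd_one, simpleEnd_two]
  refine ⟨?_, ?_, ?_⟩ <;> ring

theorem isTrans_zpow_mul_zpow (a b : ℤ) : IsTrans (xα ^ a * xβ ^ b) (a, b) := by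
  have := (isTrans_xα.zpow a).mul (isTrans_xβ.zpow b)
  simpa using this

/-- The translation part changes only constants, so the part in W₀ must fix both coordinate
functionals, which only the empty word does. The constants then force both exponents to vanish. -/
theorem eq_one_of_act_eq_one {w : W} (h : act w = 1) : w = 1 := by
  obtain ⟨a, b, u, hu, rfl⟩ := exists_eq_translation_mul w
  obtain ⟨ω, hω, rfl⟩ := exists_w₀Words hu
  have h1 := LinearMap.congr_fun h (1, 0, 0)
  have h2 := LinearMap.congr_fun h (0, 1, 0)
  rw [act_mul_apply, isTrans_zpow_mul_zpow, act_wordProd] at h1 h2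
  simp only [w₀Words, List.mem_cons, List.not_mem_nil, or_false] at hω
  rcases hω with rfl | rfl | rfl | rfl | rfl | rfl | rfl | rfl | rfl | rfl | rfl | rfl <;>
    simp [simpleEnd_one, simpleEnd_two, Prod.ext_iff] at h1 h2
  subst h1 h2
  simp

theorem act_injective : Function.Injective act :=
  (injective_iff_map_eq_one act).mpr fun _ => eq_one_of_act_eq_one

/-! ### Roots -/

/-- The twelve coroots of `G₂`, the linear parts of the affine roots. -/
def coroots : Finset (ℤ × ℤ) :=
  {(1, 0), (0, 1), (1, 1), (1, 2), (1, 3), (2, 3),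
    (-1, 0), (0, -1), (-1, -1), (-1, -2), (-1, -3), (-2, -3)}

/-- The simple affine roots. -/
def simpleRoot : Fin 3 → ℤ × ℤ × ℤ
  | 0 => (-2, -3, 1)
  | 1 => (1, 0, 0)
  | 2 => (0, 1, 0)

/-- The affine functional `f` is an affine root. -/
def IsRoot (f : ℤ × ℤ × ℤ) : Prop := (f.1, f.2.1) ∈ coroots

/-- The height of an affine functional. An affine root is positive iff its height is positive. -/
def height : ℤ × ℤ × ℤ →ₗ[ℤ] ℤ where
  toFun f := f.1 + f.2.1 + 6 * f.2.2
  map_add' f g := by simp; ring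
  map_smul' c f := by simp; ring

theorem height_apply (f : ℤ × ℤ × ℤ) : height f = f.1 + f.2.1 + 6 * f.2.2 := rfl

theorem isRoot_iff (a b k : ℤ) : IsRoot (a, b, k) ↔
    (a = 1 ∧ b = 0) ∨ (a = 0 ∧ b = 1) ∨ (a = 1 ∧ b = 1) ∨ (a = 1 ∧ b = 2) ∨ (a = 1 ∧ b = 3) ∨
    (a = 2 ∧ b = 3) ∨ (a = -1 ∧ b = 0) ∨ (a = 0 ∧ b = -1) ∨ (a = -1 ∧ b = -1) ∨
    (a = -1 ∧ b = -2) ∨ (a = -1 ∧ b = -3) ∨ (a = -2 ∧ b = -3) := by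
  simp [IsRoot, coroots]

theorem isRoot_simpleRoot (i : Fin 3) : IsRoot (simpleRoot i) := by
  fin_cases i <;> simp [IsRoot, simpleRoot, coroots]

/-- The linear part of a root has nonzero height of absolute value at most 5. With the factor 6, the
constant decides the sign unless it vanishes, and then the linear part does. -/
theorem IsRoot.height_ne_zero {f : ℤ × ℤ × ℤ} (hf : IsRoot f) : height f ≠ 0 := by
  obtain ⟨a, b, k⟩ := f
  rw [isRoot_iff] at hf
  rw [height_apply]
  dsimp only
  omega

theorem IsRoot.simpleEnd {f : ℤ × ℤ × ℤ} (hf : IsRoot f) (i : Fin 3) :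
    IsRoot (simpleEnd i f) := by
  fin_cases i
  · exact (by decide : ∀ p ∈ coroots, (-p.1, p.2 - 3 * p.1) ∈ coroots) _ hf
  · exact (by decide : ∀ p ∈ coroots, (p.2 - p.1, p.2) ∈ coroots) _ hf
  · exact (by decide : ∀ p ∈ coroots, (p.1, 3 * p.1 - p.2) ∈ coroots) _ hf

theorem IsRoot.act {f : ℤ × ℤ × ℤ} (hf : IsRoot f) (w : W) : IsRoot (act w f) := by
  induction w using cs.simple_induction_left with
  | one => simpa using hf
  | mul_simple_left w i ih =>
    rw [act_mul_apply, act_simple]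
    exact ih.simpleEnd i

theorem simpleEnd_simpleRoot (i : Fin 3) : simpleEnd i (simpleRoot i) = -simpleRoot i := by
  fin_cases i <;> simp [simpleEnd_zero, simpleEnd_one, simpleEnd_two, simpleRoot]

theorem act_mul_simple_simpleRoot (w : W) (i : Fin 3) :
    act (w * cs.simple i) (simpleRoot i) = -act w (simpleRoot i) := by
  rw [act_mul_apply, act_simple, simpleEnd_simpleRoot, map_neg]

/-- The engine of the exchange property: along a word, a root can change sign only where it has
become the simple root of the current letter. -/
theorem eq_simpleRoot {f : ℤ × ℤ × ℤ} (hf : IsRoot f) (hp : 0 < height f) {i : Fin 3}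
    (hn : height (simpleEnd i f) < 0) : f = simpleRoot i := by
  obtain ⟨a, b, k⟩ := f
  rw [isRoot_iff] at hf
  fin_cases i
  · change -a + (b - 3 * a) + 6 * (k + a) < 0 at hn
    change 0 < a + b + 6 * k at hp
    change (a, b, k) = (-2, -3, 1)
    simp only [Prod.mk.injEq]
    omega
  · change b - a + b + 6 * k < 0 at hn
    change 0 < a + b + 6 * k at hp
    change (a, b, k) = (1, 0, 0)
    simp only [Prod.mk.injEq]
    omega
  · change a + (3 * a - b) + 6 * k < 0 at hn
    change 0 < a + b + 6 * k at hp
    change (a, b, k) = (0, 1, 0)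
    simp only [Prod.mk.injEq]
    omega

/-- The invariant symmetric form on linear parts. -/
def form (f g : ℤ × ℤ × ℤ) : ℤ :=
  f.1 * (6 * g.1 - 3 * g.2.1) + f.2.1 * (2 * g.2.1 - 3 * g.1)

theorem form_act (w : W) (f g : ℤ × ℤ × ℤ) : form (act w f) (act w g) = form f g := by
  induction w using cs.simple_induction_left with
  | one => simp
  | mul_simple_left w i ih =>
    rw [← ih, act_mul_apply, act_mul_apply, act_simple]
    fin_cases i <;>
    simp only [Fin.zero_eta, Fin.mk_one, Fin.reduceFinMk, simpleEnd_zero, simpleEnd_one,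
      simpleEnd_two, form] <;>
    ring

theorem form_smul_simpleEnd (i : Fin 3) (g : ℤ × ℤ × ℤ) :
    form (simpleRoot i) (simpleRoot i) • simpleEnd i g =
      form (simpleRoot i) (simpleRoot i) • g - (2 * form g (simpleRoot i)) • simpleRoot i := by
  obtain ⟨a, b, k⟩ := g
  fin_cases i <;>
  refine Prod.ext ?_ (Prod.ext ?_ ?_) <;>
  simp [simpleEnd_zero, simpleEnd_one, simpleEnd_two, form, simpleRoot] <;> ring

theorem form_simpleRoot_ne_zero (i : Fin 3) : form (simpleRoot i) (simpleRoot i) ≠ 0 := by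
  fin_cases i <;> simp [form, simpleRoot]

/-- The form is invariant and the reflection formula determines a reflection from its root. The
formula is used with denominators cleared, and the nonzero factor is cancelled at the end. -/
theorem conj_simple_eq {w : W} {i j : Fin 3} (h : act w (simpleRoot i) = simpleRoot j) :
    w * cs.simple i * w⁻¹ = cs.simple j := by
  apply act_injective
  refine LinearMap.ext fun g => ?_
  have hq : form (simpleRoot i) (simpleRoot i) = form (simpleRoot j) (simpleRoot j) := by
    rw [← h, form_act]
  have h1 := congrArg (act w) (form_smul_simpleEnd i (act w⁻¹ g))
  rw [map_sub, map_smul, map_smul, map_smul, act_apply_inv, h, ← form_act w (act w⁻¹ g),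
    act_apply_inv, h] at h1
  have h2 := form_smul_simpleEnd j g
  rw [hq] at h1
  rw [act_simple]
  apply smul_right_injective _ (form_simpleRoot_ne_zero j)
  dsimp only
  rw [h2, ← h1, act_mul_apply, act_mul_apply, act_simple]

/-! ### The exchange property -/

/-- Apply the letters from right to left to the positive root u α_i. At the letter where it turns
negative it is simple, so the conjugated reflection equals that letter conjugated by the part of the
word to its right, and multiplying by it deletes the letter. -/
theorem exists_eraseIdx_of_height_neg {i : Fin 3} {u : W}
    (hp : 0 < height (act u (simpleRoot i))) (ω : List (Fin 3))
    (hn : height (act (cs.wordProd ω * u) (simpleRoot i)) < 0) :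
    ∃ j < ω.length, cs.wordProd ω * (u * cs.simple i * u⁻¹) = cs.wordProd (ω.eraseIdx j) := by
  induction ω with
  | nil => rw [cs.wordProd_nil, one_mul] at hn; omega
  | cons i' ω ih =>
    by_cases h : height (act (cs.wordProd ω * u) (simpleRoot i)) < 0
    · obtain ⟨j, hj, hj'⟩ := ih h
      exact ⟨j + 1, by simpa using hj, by
        rw [List.eraseIdx_cons_succ, cs.wordProd_cons, cs.wordProd_cons, mul_assoc, hj']⟩
    · have hr : IsRoot (act (cs.wordProd ω * u) (simpleRoot i)) := (isRoot_simpleRoot i).act _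
      have h0 := hr.height_ne_zero
      rw [cs.wordProd_cons, mul_assoc, act_mul_apply, act_simple] at hn
      have := conj_simple_eq (eq_simpleRoot hr (by omega) hn)
      refine ⟨0, by simp, ?_⟩
      rw [List.eraseIdx_cons_zero, cs.wordProd_cons, ← this]
      simp only [mul_inv_rev, mul_assoc, inv_mul_cancel_left]
      rw [← mul_assoc (cs.simple i) (cs.simple i), cs.simple_mul_simple_self]
      simp

theorem length_mul_conj_lt {i : Fin 3} {u w : W} (hp : 0 < height (act u (simpleRoot i)))
    (hn : height (act (w * u) (simpleRoot i)) < 0) :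
    cs.length (w * (u * cs.simple i * u⁻¹)) < cs.length w := by
  obtain ⟨ω, hω, rfl⟩ := cs.exists_isReduced w
  obtain ⟨j, hj, h⟩ := exists_eraseIdx_of_height_neg hp ω hn
  rw [h, hω.eq]
  refine (cs.length_wordProd_le _).trans_lt ?_
  rw [List.length_eraseIdx_of_lt hj]
  omega

/-- The converse follows by applying the direct implication to w times the reflection, for which the
sign is opposite. -/
theorem length_mul_conj_lt_iff {i : Fin 3} {u w : W} (hp : 0 < height (act u (simpleRoot i))) :
    cs.length (w * (u * cs.simple i * u⁻¹)) < cs.length w ↔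
      height (act (w * u) (simpleRoot i)) < 0 := by
  refine ⟨fun h => ?_, length_mul_conj_lt hp⟩
  by_contra hc
  have h0 := ((isRoot_simpleRoot i).act (w * u)).height_ne_zero
  have h1 : height (act (w * (u * cs.simple i * u⁻¹) * u) (simpleRoot i)) < 0 := by
    rw [show w * (u * cs.simple i * u⁻¹) * u = w * u * cs.simple i by group,
      act_mul_simple_simpleRoot, map_neg]
    omega
  have h2 := length_mul_conj_lt hp h1
  rw [show w * (u * cs.simple i * u⁻¹) * (u * cs.simple i * u⁻¹) =
    w * u * (cs.simple i * cs.simple i) * u⁻¹ by group, cs.simple_mul_simple_self] at h2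
  simp only [mul_one, mul_inv_cancel_right] at h2
  omega

theorem isRightDescent_iff (w : W) (i : Fin 3) :
    cs.IsRightDescent w i ↔ height (act w (simpleRoot i)) < 0 := by
  have hp : 0 < height (act 1 (simpleRoot i)) := by
    fin_cases i <;> simp [height_apply, simpleRoot]
  simpa [CoxeterSystem.IsRightDescent] using length_mul_conj_lt_iff (w := w) hp

theorem not_isRightDescent_iff (w : W) (i : Fin 3) :
    ¬ cs.IsRightDescent w i ↔ 0 < height (act w (simpleRoot i)) := by
  rw [isRightDescent_iff]
  have := ((isRoot_simpleRoot i).act w).height_ne_zero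
  omega

end AffineG2

namespace CoxeterSystem

/-- The strong exchange property of a Coxeter system. -/
def StrongExchange {B W : Type*} [Group W] {M : CoxeterMatrix B} (cs : CoxeterSystem M W) : Prop :=
  ∀ (ω : List B) (t : W), cs.IsReflection t →
    cs.length (cs.wordProd ω * t) < cs.length (cs.wordProd ω) →
    ∃ j < ω.length, cs.wordProd ω * t = cs.wordProd (ω.eraseIdx j)

end CoxeterSystem

namespace AffineG2

theorem strongExchange : cs.StrongExchange := by
  intro ω t ht hlt
  have key : ∃ (u : W) (i : Fin 3), t = u * cs.simple i * u⁻¹ ∧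
      0 < height (act u (simpleRoot i)) := by
    obtain ⟨u, i, rfl⟩ := ht
    by_cases h : 0 < height (act u (simpleRoot i))
    · exact ⟨u, i, rfl, h⟩
    -- Replacing u by u s_i keeps the reflection and changes the sign of its root.
    · refine ⟨u * cs.simple i, i, ?_, ?_⟩
      · rw [mul_inv_rev, cs.inv_simple, cs.simple_mul_simple_cancel_right, mul_assoc]
      · have h0 := ((isRoot_simpleRoot i).act u).height_ne_zero
        rw [act_mul_simple_simpleRoot, map_neg]
        omega
  obtain ⟨u, i, rfl, hp⟩ := key
  exact exists_eraseIdx_of_height_neg hp ω ((length_mul_conj_lt_iff hp).mp hlt)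

end AffineG2

/-! ## The standard basis of the Hecke algebra -/

namespace CoxeterSystem

open LaurentPolynomial

section

variable {B W : Type*} [Group W] {M : CoxeterMatrix B} {cs : CoxeterSystem M W}

/-- Exchange for s_i w and s_j deletes a letter. Deleting the first letter is the claim; deleting
one inside w would make w s_j shorter than w. -/
theorem simple_mul_eq_mul_simple_of_lt (hE : cs.StrongExchange) {w : W} {i j : B}
    (h1 : cs.length (cs.simple i * w) = cs.length w + 1)
    (h2 : cs.length (w * cs.simple j) = cs.length w + 1)
    (h3 : cs.length (cs.simple i * w * cs.simple j) = cs.length w) :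
    cs.simple i * w = w * cs.simple j := by
  obtain ⟨ω, hω, rfl⟩ := cs.exists_isReduced w
  obtain ⟨k, hk, h⟩ := hE (i :: ω) (cs.simple j) (cs.isReflection_simple j) (by
    rw [cs.wordProd_cons]; omega)
  rw [cs.wordProd_cons] at h
  cases k with
  | zero =>
    rw [List.eraseIdx_cons_zero] at h
    nth_rw 2 [← h]
    rw [cs.simple_mul_simple_cancel_right]
  | succ k =>
    rw [List.eraseIdx_cons_succ, cs.wordProd_cons, mul_assoc, mul_right_inj] at h
    have h4 := cs.length_wordProd_le (ω.eraseIdx k)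
    rw [List.length_cons] at hk
    rw [← h, List.length_eraseIdx_of_lt (by omega), h2, hω.eq] at h4
    omega

theorem simple_mul_eq_mul_simple (hE : cs.StrongExchange) {w : W} {i j : B}
    (h1 : cs.length (cs.simple i * w) = cs.length (w * cs.simple j))
    (h2 : cs.length (cs.simple i * w * cs.simple j) = cs.length w) :
    cs.simple i * w = w * cs.simple j := by
  rcases cs.length_simple_mul w i with h | h
  · exact simple_mul_eq_mul_simple_of_lt hE h (by omega) h2
  · have := simple_mul_eq_mul_simple_of_lt hE (w := cs.simple i * w) (i := i) (j := j)
      (by rw [cs.simple_mul_simple_cancel_left]; omega) (by omega)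
      (by rw [cs.simple_mul_simple_cancel_left]; omega)
    rw [cs.simple_mul_simple_cancel_left] at this
    nth_rw 2 [this]
    rw [cs.simple_mul_simple_cancel_right]

/-- Every multiplication changes the length by exactly one. The only pattern of lengths in which a
descent status changes is the one that forces s_i w = w s_j. -/
theorem isLeftDescent_mul_simple_iff (hE : cs.StrongExchange) {w : W} {i j : B}
    (h : cs.simple i * w ≠ w * cs.simple j) :
    (cs.IsLeftDescent (w * cs.simple j) i ↔ cs.IsLeftDescent w i) ∧
    (cs.IsRightDescent (cs.simple i * w) j ↔ cs.IsRightDescent w j) := by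
  have key : ¬ (cs.length (cs.simple i * w) = cs.length (w * cs.simple j) ∧
      cs.length (cs.simple i * w * cs.simple j) = cs.length w) :=
    fun h' => h (simple_mul_eq_mul_simple hE h'.1 h'.2)
  simp only [IsLeftDescent, IsRightDescent, ← mul_assoc]
  have a1 := cs.length_simple_mul w i
  have a2 := cs.length_mul_simple w j
  have a3 := cs.length_simple_mul (w * cs.simple j) i
  have a4 := cs.length_mul_simple (cs.simple i * w) j
  rw [← mul_assoc] at a3
  omega

variable (cs)

open Classical in
/-- Left multiplication by `T_i` on the free module on `W`. -/
noncomputable def leftOp (i : B) : Module.End ℤ[T;T⁻¹] (W →₀ ℤ[T;T⁻¹]) :=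
  Finsupp.linearCombination ℤ[T;T⁻¹] fun w =>
    if cs.IsLeftDescent w i then
      Finsupp.single (cs.simple i * w) (T 2) + Finsupp.single w (T 2 - 1)
    else Finsupp.single (cs.simple i * w) 1

open Classical in
/-- Right multiplication by `T_i` on the free module on `W`. -/
noncomputable def rightOp (i : B) : Module.End ℤ[T;T⁻¹] (W →₀ ℤ[T;T⁻¹]) :=
  Finsupp.linearCombination ℤ[T;T⁻¹] fun w =>
    if cs.IsRightDescent w i then
      Finsupp.single (w * cs.simple i) (T 2) + Finsupp.single w (T 2 - 1)
    else Finsupp.single (w * cs.simple i) 1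

variable {cs}

theorem leftOp_single {i : B} {w : W} (h : ¬ cs.IsLeftDescent w i) (c : ℤ[T;T⁻¹]) :
    leftOp cs i (Finsupp.single w c) = Finsupp.single (cs.simple i * w) c := by
  rw [leftOp, Finsupp.linearCombination_single, if_neg h, Finsupp.smul_single, smul_eq_mul, mul_one]

theorem leftOp_single' {i : B} {w : W} (h : cs.IsLeftDescent w i) (c : ℤ[T;T⁻¹]) :
    leftOp cs i (Finsupp.single w c) =
      Finsupp.single (cs.simple i * w) (c * T 2) + Finsupp.single w (c * (T 2 - 1)) := by
  rw [leftOp, Finsupp.linearCombination_single, if_pos h, smul_add, Finsupp.smul_single,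
    Finsupp.smul_single, smul_eq_mul, smul_eq_mul]

theorem rightOp_single {i : B} {w : W} (h : ¬ cs.IsRightDescent w i) (c : ℤ[T;T⁻¹]) :
    rightOp cs i (Finsupp.single w c) = Finsupp.single (w * cs.simple i) c := by
  rw [rightOp, Finsupp.linearCombination_single, if_neg h, Finsupp.smul_single, smul_eq_mul,
    mul_one]

theorem rightOp_single' {i : B} {w : W} (h : cs.IsRightDescent w i) (c : ℤ[T;T⁻¹]) :
    rightOp cs i (Finsupp.single w c) =
      Finsupp.single (w * cs.simple i) (c * T 2) + Finsupp.single w (c * (T 2 - 1)) := by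
  rw [rightOp, Finsupp.linearCombination_single, if_pos h, smul_add, Finsupp.smul_single,
    Finsupp.smul_single, smul_eq_mul, smul_eq_mul]

/-- If s_i w = w s_j, both operators act on the span of w and w s_j in the same way; otherwise the
left and right descents do not influence each other. This commutation reduces every Hecke relation
between left operators to a check on a single vector. -/
theorem leftOp_rightOp_comm (hE : cs.StrongExchange) (i j : B) :
    leftOp cs i * rightOp cs j = rightOp cs j * leftOp cs i := by
  refine Finsupp.lhom_ext fun w c => ?_
  simp only [Module.End.mul_apply]
  by_cases h : cs.simple i * w = w * cs.simple j
  · have e1 : w * cs.simple j * cs.simple j = w := cs.simple_mul_simple_cancel_right j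
    have e2 : cs.simple i * (w * cs.simple j) = w := by
      rw [← h, cs.simple_mul_simple_cancel_left]
    by_cases hl : cs.IsLeftDescent w i
    · have hr : cs.IsRightDescent w j := by rw [IsRightDescent, ← h]; exact hl
      rw [rightOp_single' hr, leftOp_single' hl]
      simp only [map_add]
      rw [leftOp_single' hl, rightOp_single' hr, h, leftOp_single, rightOp_single, e1, e2]
      · rw [IsRightDescent, e1, ← h]; simp only [IsLeftDescent] at hl; omega
      · rw [IsLeftDescent, e2, ← h]; simp only [IsLeftDescent] at hl; omega
    · have hr : ¬ cs.IsRightDescent w j := by rw [IsRightDescent, ← h]; exact hl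
      have hl' := cs.length_simple_mul w i
      rw [rightOp_single hr, leftOp_single hl, leftOp_single', h, rightOp_single', e1, e2]
      · rw [IsRightDescent, e1, ← h]; simp only [IsLeftDescent] at hl; omega
      · rw [IsLeftDescent, e2, ← h]; simp only [IsLeftDescent] at hl; omega
  · obtain ⟨d1, d2⟩ := isLeftDescent_mul_simple_iff hE h
    by_cases hl : cs.IsLeftDescent w i <;> by_cases hr : cs.IsRightDescent w j
    · rw [rightOp_single' hr, leftOp_single' hl, map_add, map_add, leftOp_single' (d1.mpr hl),
        leftOp_single' hl, rightOp_single' (d2.mpr hr), rightOp_single' hr]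
      simp only [mul_assoc, mul_comm (T 2 - 1 : ℤ[T;T⁻¹])]
      abel
    · rw [rightOp_single hr, leftOp_single' hl, map_add, leftOp_single' (d1.mpr hl),
        rightOp_single (fun h => hr (d2.mp h)), rightOp_single hr]
      simp only [mul_assoc]
    · rw [rightOp_single' hr, leftOp_single hl, map_add, leftOp_single (fun h => hl (d1.mp h)),
        rightOp_single' (d2.mpr hr), leftOp_single hl]
      simp only [mul_assoc]
    · rw [rightOp_single hr, leftOp_single hl, leftOp_single (fun h => hl (d1.mp h)),
        rightOp_single (fun h => hr (d2.mp h)), mul_assoc]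

/-- The right operators reach every basis vector from the one at the identity, so an operator
commuting with them is determined by its value there. In particular `leftOpOf` does not depend on
the reduced word chosen. -/
theorem end_ext_of_commute {P Q : Module.End ℤ[T;T⁻¹] (W →₀ ℤ[T;T⁻¹])}
    (hP : ∀ j, P * rightOp cs j = rightOp cs j * P) (hQ : ∀ j, Q * rightOp cs j = rightOp cs j * Q)
    (h : P (Finsupp.single 1 1) = Q (Finsupp.single 1 1)) : P = Q := by
  have key : ∀ w, P (Finsupp.single w 1) = Q (Finsupp.single w 1) := by
    intro w
    induction hn : cs.length w generalizing w with
    | zero => rwa [cs.length_eq_zero_iff.mp hn]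
    | succ n ih =>
      have hw : w ≠ 1 := by rintro rfl; simp at hn
      obtain ⟨i, hi⟩ := cs.exists_rightDescent_of_ne_one hw
      have hi' := hi
      rw [cs.isRightDescent_iff] at hi
      rw [cs.isRightDescent_iff_not_isRightDescent_mul] at hi'
      have e := rightOp_single hi' 1
      rw [cs.simple_mul_simple_cancel_right] at e
      rw [← e, ← Module.End.mul_apply, ← Module.End.mul_apply, hP, hQ, Module.End.mul_apply,
        Module.End.mul_apply, ih _ (by omega)]
  refine Finsupp.lhom_ext fun w c => ?_
  rw [← mul_one c, ← smul_eq_mul, ← Finsupp.smul_single, map_smul, map_smul, key]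

theorem prod_leftOp_single (ω : List B) (w : W)
    (h : cs.length (cs.wordProd ω * w) = ω.length + cs.length w) :
    (ω.map (leftOp cs)).prod (Finsupp.single w 1) = Finsupp.single (cs.wordProd ω * w) 1 := by
  induction ω with
  | nil => simp
  | cons i ω ih =>
    rw [cs.wordProd_cons, mul_assoc, List.length_cons] at h
    have h1 := cs.length_simple_mul (cs.wordProd ω * w) i
    have h2 := cs.length_mul_le (cs.wordProd ω) w
    have h3 := cs.length_wordProd_le ω
    rw [List.map_cons, List.prod_cons, Module.End.mul_apply, ih (by omega), leftOp_single,
      cs.wordProd_cons, mul_assoc]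
    rw [IsLeftDescent]
    omega

theorem prod_leftOp_comm (hE : cs.StrongExchange) (ω : List B) (j : B) :
    (ω.map (leftOp cs)).prod * rightOp cs j = rightOp cs j * (ω.map (leftOp cs)).prod := by
  induction ω with
  | nil => simp
  | cons i ω ih =>
    rw [List.map_cons, List.prod_cons, mul_assoc, ih, ← mul_assoc, leftOp_rightOp_comm hE, mul_assoc]

variable (cs) in
/-- Left multiplication by `T_w` on the free module on `W`. -/
noncomputable def leftOpOf (w : W) : Module.End ℤ[T;T⁻¹] (W →₀ ℤ[T;T⁻¹]) :=
  ((cs.exists_isReduced w).choose.map (leftOp cs)).prod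

theorem leftOpOf_single (w u : W) (h : cs.length (w * u) = cs.length w + cs.length u) :
    leftOpOf cs w (Finsupp.single u 1) = Finsupp.single (w * u) 1 := by
  obtain ⟨h1, h2⟩ := (cs.exists_isReduced w).choose_spec
  rw [leftOpOf, prod_leftOp_single, ← h2]
  rw [← h2, h, ← h1.eq, ← h2]

theorem leftOpOf_simple (hE : cs.StrongExchange) (i : B) :
    leftOpOf cs (cs.simple i) = leftOp cs i := by
  refine end_ext_of_commute (prod_leftOp_comm hE _) (leftOp_rightOp_comm hE i) ?_
  rw [leftOpOf_single _ _ (by simp), leftOp_single (cs.not_isLeftDescent_one i)]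

/-- The regular representation of the Hecke algebra on the free module on `W`. -/
noncomputable def regularRep (hE : cs.StrongExchange) :
    HeckeAlgebra cs →ₐ[ℤ[T;T⁻¹]] Module.End ℤ[T;T⁻¹] (W →₀ ℤ[T;T⁻¹]) :=
  RingQuot.liftAlgHom ℤ[T;T⁻¹] ⟨FreeAlgebra.lift ℤ[T;T⁻¹] (leftOpOf cs), by
    intro x y h
    induction h with
    | one =>
      rw [FreeAlgebra.lift_ι_apply, map_one]
      refine end_ext_of_commute (prod_leftOp_comm hE _) (fun j => by rw [one_mul, mul_one]) ?_
      rw [leftOpOf_single _ _ (by simp)]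
      simp
    | quadratic i =>
      rw [map_mul, map_sub, map_add, map_one, map_zero, FreeAlgebra.lift_ι_apply,
        AlgHom.commutes, leftOpOf_simple hE]
      classical
      refine Finsupp.lhom_ext fun w c => ?_
      rw [Module.End.mul_apply, LinearMap.add_apply, LinearMap.sub_apply, LinearMap.zero_apply,
        Module.End.one_apply, Module.algebraMap_end_apply]
      by_cases h : cs.IsLeftDescent w i
      · have h' := cs.isLeftDescent_iff_not_isLeftDescent_mul.mp h
        simp only [leftOp_single' h, map_add, leftOp_single h', Finsupp.smul_single,
          cs.simple_mul_simple_cancel_left, smul_eq_mul, smul_add]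
        ext1 u
        simp only [Finsupp.add_apply, Finsupp.sub_apply, Finsupp.single_apply, Finsupp.zero_apply]
        split_ifs <;> ring
      · have h' : cs.IsLeftDescent (cs.simple i * w) i := by
          rw [cs.isLeftDescent_iff_not_isLeftDescent_mul, cs.simple_mul_simple_cancel_left]
          exact h
        simp only [leftOp_single h, map_add, leftOp_single' h', Finsupp.smul_single,
          cs.simple_mul_simple_cancel_left, smul_eq_mul, smul_add]
        ext1 u
        simp only [Finsupp.add_apply, Finsupp.sub_apply, Finsupp.single_apply, Finsupp.zero_apply]
        split_ifs <;> ring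
    | mul w u h =>
      rw [map_mul, FreeAlgebra.lift_ι_apply, FreeAlgebra.lift_ι_apply, FreeAlgebra.lift_ι_apply]
      refine end_ext_of_commute (fun j => ?_) (prod_leftOp_comm hE _) ?_
      · rw [mul_assoc, leftOpOf, leftOpOf, prod_leftOp_comm hE, ← mul_assoc, prod_leftOp_comm hE,
          mul_assoc]
      · rw [Module.End.mul_apply, leftOpOf_single u 1 (by simp), mul_one, leftOpOf_single _ _ h,
          leftOpOf_single _ _ (by simp), mul_one]⟩

theorem regularRep_heckeT (hE : cs.StrongExchange) (w : W) :
    regularRep hE (heckeT cs w) (Finsupp.single 1 1) = Finsupp.single w 1 := by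
  have : regularRep hE (heckeT cs w) = leftOpOf cs w :=
    (RingQuot.liftAlgHom_mkAlgHom_apply ℤ[T;T⁻¹] _ _ _).trans (FreeAlgebra.lift_ι_apply _ _)
  rw [this, leftOpOf_single _ _ (by simp), mul_one]

theorem linearIndependent_heckeT (hE : cs.StrongExchange) :
    LinearIndependent ℤ[T;T⁻¹] (heckeT cs) := by
  let ev : HeckeAlgebra cs →ₗ[ℤ[T;T⁻¹]] (W →₀ ℤ[T;T⁻¹]) :=
    (LinearMap.applyₗ (Finsupp.single 1 1)).comp (regularRep hE).toLinearMap
  refine LinearIndependent.of_comp ev ?_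
  have : ev ∘ heckeT cs = fun w => Finsupp.single w 1 := funext (regularRep_heckeT hE)
  rw [this]
  exact Finsupp.basisSingleOne.linearIndependent

theorem heckeT_simple_sq (i : B) : heckeT cs (cs.simple i) * heckeT cs (cs.simple i) =
    (T 2 - 1 : ℤ[T;T⁻¹]) • heckeT cs (cs.simple i) + (T 2 : ℤ[T;T⁻¹]) • 1 := by
  have h := heckeT_quadratic cs i
  rw [sub_mul, mul_add, mul_one, ← Algebra.smul_def, smul_add] at h
  rw [sub_smul, one_smul, ← sub_eq_zero, ← h]
  abel

theorem heckeT_simple_mul_of_not (i : B) {w : W} (h : ¬ cs.IsLeftDescent w i) :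
    heckeT cs (cs.simple i) * heckeT cs w = heckeT cs (cs.simple i * w) := by
  rw [heckeT_mul]
  rw [cs.not_isLeftDescent_iff] at h
  rw [h, cs.length_simple, add_comm]

theorem heckeT_simple_mul_of_isLeftDescent (i : B) {w : W} (h : cs.IsLeftDescent w i) :
    heckeT cs (cs.simple i) * heckeT cs w =
      (T 2 : ℤ[T;T⁻¹]) • heckeT cs (cs.simple i * w) + (T 2 - 1 : ℤ[T;T⁻¹]) • heckeT cs w := by
  have h' := heckeT_simple_mul_of_not i (cs.isLeftDescent_iff_not_isLeftDescent_mul.mp h)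
  rw [cs.simple_mul_simple_cancel_left] at h'
  rw [← h', ← mul_assoc, heckeT_simple_sq, add_mul, smul_mul_assoc, smul_mul_assoc, one_mul, add_comm]

theorem heckeT_mul_simple_of_not (i : B) {w : W} (h : ¬ cs.IsRightDescent w i) :
    heckeT cs w * heckeT cs (cs.simple i) = heckeT cs (w * cs.simple i) := by
  rw [heckeT_mul]
  rw [cs.not_isRightDescent_iff] at h
  rw [h, cs.length_simple]

theorem heckeT_mul_simple_of_isRightDescent (i : B) {w : W} (h : cs.IsRightDescent w i) :
    heckeT cs w * heckeT cs (cs.simple i) =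
      (T 2 : ℤ[T;T⁻¹]) • heckeT cs (w * cs.simple i) + (T 2 - 1 : ℤ[T;T⁻¹]) • heckeT cs w := by
  have h' := heckeT_mul_simple_of_not i (cs.isRightDescent_iff_not_isRightDescent_mul.mp h)
  rw [cs.simple_mul_simple_cancel_right] at h'
  rw [← h', mul_assoc, heckeT_simple_sq, mul_add, mul_smul_comm, mul_smul_comm, mul_one, add_comm]

theorem heckeT_wordProd_of_isReduced {ω : List B} (h : cs.IsReduced ω) :
    heckeT cs (cs.wordProd ω) = (ω.map fun i => heckeT cs (cs.simple i)).prod := by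
  induction ω with
  | nil => simp [heckeT_one]
  | cons i ω ih =>
    have h1 : cs.IsReduced ω := by simpa using h.drop 1
    rw [List.map_cons, List.prod_cons, ← ih h1, heckeT_simple_mul_of_not, cs.wordProd_cons]
    have h2 := h.eq
    rw [cs.wordProd_cons, List.length_cons, ← h1.eq] at h2
    rw [IsLeftDescent]
    omega

/-- The span is stable under left multiplication by each T_i, hence by each T_w through a reduced
word. It is therefore a subalgebra, and it contains the generators. -/
theorem span_heckeT : Submodule.span ℤ[T;T⁻¹] (Set.range (heckeT cs)) = ⊤ := by
  set S := Submodule.span ℤ[T;T⁻¹] (Set.range (heckeT cs)) with hS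
  have mem : ∀ w, heckeT cs w ∈ S := fun w => Submodule.subset_span ⟨w, rfl⟩
  have h1 : ∀ i, ∀ x ∈ S, heckeT cs (cs.simple i) * x ∈ S := by
    intro i x hx
    induction hx using Submodule.span_induction with
    | mem x hx =>
      obtain ⟨w, rfl⟩ := hx
      by_cases h : cs.IsLeftDescent w i
      · rw [heckeT_simple_mul_of_isLeftDescent i h]
        exact S.add_mem (S.smul_mem _ (mem _)) (S.smul_mem _ (mem _))
      · rw [heckeT_simple_mul_of_not i h]
        exact mem _
    | zero => rw [mul_zero]; exact S.zero_mem
    | add x y _ _ hx hy => rw [mul_add]; exact S.add_mem hx hy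
    | smul c x _ hx => rw [mul_smul_comm]; exact S.smul_mem _ hx
  have h2 : ∀ w, ∀ x ∈ S, heckeT cs w * x ∈ S := by
    intro w x hx
    obtain ⟨ω, hω, rfl⟩ := cs.exists_isReduced w
    rw [heckeT_wordProd_of_isReduced hω]
    clear hω
    induction ω with
    | nil => simpa using hx
    | cons i ω ih =>
      rw [List.map_cons, List.prod_cons, mul_assoc]
      exact h1 i _ ih
  have h3 : ∀ x ∈ S, ∀ y ∈ S, x * y ∈ S := by
    intro x hx y hy
    induction hx using Submodule.span_induction with
    | mem x hx => obtain ⟨w, rfl⟩ := hx; exact h2 w y hy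
    | zero => rw [zero_mul]; exact S.zero_mem
    | add x z _ _ hx hz => rw [add_mul]; exact S.add_mem hx hz
    | smul c x _ hx => rw [smul_mul_assoc]; exact S.smul_mem _ hx
  have h4 : (1 : HeckeAlgebra cs) ∈ S := by rw [← heckeT_one]; exact mem 1
  rw [eq_top_iff]
  rintro x -
  obtain ⟨y, rfl⟩ := RingQuot.mkAlgHom_surjective ℤ[T;T⁻¹] (HeckeRel cs) x
  induction y using FreeAlgebra.induction with
  | grade0 c =>
    rw [AlgHom.commutes, Algebra.algebraMap_eq_smul_one]
    exact S.smul_mem c h4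
  | grade1 w => exact mem w
  | mul a b ha hb => rw [map_mul]; exact h3 _ ha _ hb
  | add a b ha hb => rw [map_add]; exact S.add_mem ha hb

/-- The standard basis `(T_w)` of the Hecke algebra. -/
noncomputable def heckeBasis (hE : cs.StrongExchange) :
    Module.Basis W ℤ[T;T⁻¹] (HeckeAlgebra cs) :=
  Module.Basis.mk (linearIndependent_heckeT hE) span_heckeT.ge

theorem heckeBasis_apply (hE : cs.StrongExchange) (w : W) : heckeBasis hE w = heckeT cs w :=
  Module.Basis.mk_apply _ _ w

end

end CoxeterSystem

/-! ## Degrees of Laurent polynomials -/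

namespace LaurentPolynomial

/-- All terms of `a` have degree at most `n`. -/
def DegLE (n : ℤ) (a : ℤ[T;T⁻¹]) : Prop := ∀ m, n < m → a.coeff m = 0

theorem DegLE.mono {m n : ℤ} {a : ℤ[T;T⁻¹]} (h : DegLE m a) (hmn : m ≤ n) : DegLE n a :=
  fun k hk => h k (by omega)

theorem degLE_zero (n : ℤ) : DegLE n 0 := fun _ _ => rfl

theorem DegLE.add {n : ℤ} {a b : ℤ[T;T⁻¹]} (ha : DegLE n a) (hb : DegLE n b) : DegLE n (a + b) :=
  fun m hm => by rw [AddMonoidAlgebra.coeff_add, Finsupp.add_apply, ha m hm, hb m hm, add_zero]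

theorem DegLE.neg {n : ℤ} {a : ℤ[T;T⁻¹]} (ha : DegLE n a) : DegLE n (-a) :=
  fun m hm => by rw [AddMonoidAlgebra.coeff_neg, Finsupp.neg_apply, ha m hm, neg_zero]

theorem DegLE.sub {n : ℤ} {a b : ℤ[T;T⁻¹]} (ha : DegLE n a) (hb : DegLE n b) : DegLE n (a - b) := by
  rw [sub_eq_add_neg]; exact ha.add hb.neg

theorem DegLE.sum {ι : Type*} {n : ℤ} {s : Finset ι} {f : ι → ℤ[T;T⁻¹]}
    (h : ∀ i ∈ s, DegLE n (f i)) : DegLE n (∑ i ∈ s, f i) := by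
  classical
  induction s using Finset.induction_on with
  | empty => exact degLE_zero n
  | insert i s hi ih =>
    rw [Finset.sum_insert hi]
    exact (h i (by simp)).add (ih fun j hj => h j (by simp [hj]))

theorem DegLE.mul {m n : ℤ} {a b : ℤ[T;T⁻¹]} (ha : DegLE m a) (hb : DegLE n b) :
    DegLE (m + n) (a * b) := by
  intro k hk
  rw [AddMonoidAlgebra.coeff_mul]
  refine Finset.sum_eq_zero fun i hi => Finset.sum_eq_zero fun j hj => ?_
  refine if_neg fun hij => ?_
  have h1 : i ≤ m := by
    by_contra h
    exact (Finsupp.mem_support_iff.mp hi) (ha i (by omega))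
  have h2 : j ≤ n := by
    by_contra h
    exact (Finsupp.mem_support_iff.mp hj) (hb j (by omega))
  omega

theorem degLE_T (n : ℤ) : DegLE n (T n) := fun m hm => by rw [T_apply, if_neg (by omega)]

theorem degLE_one : DegLE 0 1 := by rw [← T_zero]; exact degLE_T 0

theorem coeff_T_mul (n m : ℤ) (a : ℤ[T;T⁻¹]) : (T n * a).coeff m = a.coeff (m - n) := by
  have := AddMonoidAlgebra.coeff_single_mul_eq_mul_coeff (x := a) (r := (1 : ℤ)) (m := n) (m₁ := m)
    (m - n) (fun d _ => by omega)
  rwa [one_mul] at this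

theorem degLE_T_mul_iff {n m : ℤ} {a : ℤ[T;T⁻¹]} : DegLE n (T m * a) ↔ DegLE (n - m) a := by
  refine ⟨fun h k hk => ?_, fun h k hk => ?_⟩
  · have := h (k + m) (by omega)
    rwa [coeff_T_mul, add_sub_cancel_right] at this
  · rw [coeff_T_mul]; exact h _ (by omega)

theorem coeff_C_mul (c m : ℤ) (a : ℤ[T;T⁻¹]) : (C c * a).coeff m = c * a.coeff m := by
  rw [← smul_eq_C_mul, AddMonoidAlgebra.coeff_smul_apply, smul_eq_mul]

theorem DegLE.C_mul {n : ℤ} {a : ℤ[T;T⁻¹]} (ha : DegLE n a) (c : ℤ) : DegLE n (C c * a) :=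
  fun m hm => by rw [coeff_C_mul, ha m hm, mul_zero]

theorem coeff_aeval_T_two (p : Polynomial ℤ) (m : ℤ) :
    (Polynomial.aeval (T 2 : ℤ[T;T⁻¹]) p).coeff m =
      ∑ k ∈ p.support, if m = 2 * (k : ℤ) then p.coeff k else 0 := by
  rw [Polynomial.aeval_eq_sum_range' (n := p.natDegree + 1) (by omega),
    AddMonoidAlgebra.coeff_sum, Finsupp.finsetSum_apply]
  have h1 : ∀ k : ℕ, (p.coeff k • (T 2 : ℤ[T;T⁻¹]) ^ k).coeff m =
      if m = 2 * (k : ℤ) then p.coeff k else 0 := by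
    intro k
    rw [T_pow, AddMonoidAlgebra.coeff_smul_apply, T_apply, smul_eq_mul]
    by_cases h : m = 2 * (k : ℤ)
    · rw [if_pos h, if_pos (by omega), mul_one]
    · rw [if_neg h, if_neg (by omega), mul_zero]
  simp only [h1]
  symm
  refine Finset.sum_subset (fun k hk => ?_) (fun k _ hk => ?_)
  · rw [Finset.mem_range]
    exact Nat.lt_succ_of_le (Polynomial.le_natDegree_of_mem_supp k hk)
  · rw [Polynomial.notMem_support_iff.mp hk, ite_self]

theorem coeff_aeval_T_two_mul (p : Polynomial ℤ) (k : ℕ) :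
    (Polynomial.aeval (T 2 : ℤ[T;T⁻¹]) p).coeff (2 * (k : ℤ)) = p.coeff k := by
  rw [coeff_aeval_T_two]
  by_cases hk : k ∈ p.support
  · rw [Finset.sum_eq_single_of_mem k hk, if_pos rfl]
    intro j _ hj
    rw [if_neg (by omega)]
  · rw [Polynomial.notMem_support_iff.mp hk]
    refine Finset.sum_eq_zero fun j hj => if_neg ?_
    rintro h
    have : k = j := by omega
    exact hk (this ▸ hj)

theorem exists_of_coeff_aeval_T_two_ne_zero {p : Polynomial ℤ} {m : ℤ}
    (h : (Polynomial.aeval (T 2 : ℤ[T;T⁻¹]) p).coeff m ≠ 0) : ∃ k : ℕ, m = 2 * (k : ℤ) := by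
  rw [coeff_aeval_T_two] at h
  obtain ⟨k, _, hk⟩ := Finset.exists_ne_zero_of_sum_ne_zero h
  exact ⟨k, by by_contra hc; exact hk (if_neg hc)⟩

end LaurentPolynomial

/-! ## The Kazhdan–Lusztig basis -/

namespace CoxeterSystem

open LaurentPolynomial

section

variable {B W : Type*} [Group W] {M : CoxeterMatrix B} {cs : CoxeterSystem M W}

/-! ### The Bruhat order -/

theorem BruhatLE.refl (w : W) : cs.BruhatLE w w := Relation.ReflTransGen.refl

theorem BruhatLE.trans {u v w : W} (h : cs.BruhatLE u v) (h' : cs.BruhatLE v w) :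
    cs.BruhatLE u w := Relation.ReflTransGen.trans h h'

theorem BruhatLE.eq_or_length_lt {u w : W} (h : cs.BruhatLE u w) :
    u = w ∨ cs.length u < cs.length w := by
  induction h with
  | refl => exact Or.inl rfl
  | tail _ h ih =>
    obtain ⟨t, _, _, h⟩ := h
    rcases ih with rfl | ih
    · exact Or.inr h
    · exact Or.inr (ih.trans h)

theorem bruhatLE_mul_simple {w : W} {i : B} (h : ¬ cs.IsRightDescent w i) :
    cs.BruhatLE w (w * cs.simple i) := by
  rw [cs.not_isRightDescent_iff] at h
  exact Relation.ReflTransGen.single ⟨_, cs.isReflection_simple i, rfl, by omega⟩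

/-- The lifting property. An elementary step from u to ut survives multiplication by s unless ut =
us, and in that case us ≤ w < ws directly. -/
theorem BruhatLE.mul_simple (hE : cs.StrongExchange) {u w : W} {i : B} (h : cs.BruhatLE u w)
    (hw : ¬ cs.IsRightDescent w i) : cs.BruhatLE (u * cs.simple i) (w * cs.simple i) := by
  induction h using Relation.ReflTransGen.head_induction_on with
  | refl => exact BruhatLE.refl _
  | head huv hvw ih =>
    rename_i u v
    obtain ⟨t, ht, rfl, hlt⟩ := huv
    by_cases hs : u * t = u * cs.simple i
    · rw [← hs]
      exact BruhatLE.trans hvw (bruhatLE_mul_simple hw)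
    · refine BruhatLE.trans (Relation.ReflTransGen.single
        ⟨cs.simple i * t * (cs.simple i)⁻¹, ht.conj _, ?_, ?_⟩) ih
      · simp only [cs.inv_simple, mul_assoc, cs.simple_mul_simple_cancel_left]
      -- Otherwise uts is shorter than us and has the length of u. Take a reduced word of uts
      -- followed by s, which spells ut, and delete the letter that turns it into u. Inside the word
      -- this makes us too short; at the end it gives u = uts, that is us = ut.
      by_contra hc
      have a1 := cs.length_mul_simple u i
      have a2 := cs.length_mul_simple (u * t) i
      have a3 : cs.length (u * t * cs.simple i) ≠ cs.length (u * cs.simple i) := by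
        have := (ht.conj (cs.simple i)).length_mul_left_ne (u * cs.simple i)
        simpa only [cs.inv_simple, mul_assoc, cs.simple_mul_simple_cancel_left] using this
      obtain ⟨ω, hω, hω'⟩ := cs.exists_isReduced (u * t * cs.simple i)
      have hv : u * t = cs.wordProd (ω.concat i) := by
        rw [cs.wordProd_concat, ← hω', cs.simple_mul_simple_cancel_right]
      have hu : u = cs.wordProd (ω.concat i) * t := by rw [← hv, mul_assoc, ht.mul_self, mul_one]
      obtain ⟨j, hj, hj'⟩ := hE (ω.concat i) t ht (by rw [← hu, ← hv]; exact hlt)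
      rw [← hu, List.concat_eq_append] at hj'
      rw [List.length_concat] at hj
      have hlen := hω.eq
      rw [← hω'] at hlen
      by_cases hjl : j < ω.length
      · rw [List.eraseIdx_append_of_lt_length hjl, cs.wordProd_append, cs.wordProd_singleton] at hj'
        have h1 := cs.length_wordProd_le (ω.eraseIdx j)
        rw [List.length_eraseIdx_of_lt hjl] at h1
        have h2 : u * cs.simple i = cs.wordProd (ω.eraseIdx j) := by
          rw [hj', cs.simple_mul_simple_cancel_right]
        rw [← h2] at h1
        omega
      · have : j = ω.length := by omega
        subst this
        rw [List.eraseIdx_append_of_length_le le_rfl] at hj'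
        simp only [Nat.sub_self, List.eraseIdx_cons_zero, List.append_nil] at hj'
        apply hs
        nth_rw 2 [hj']
        rw [← hω', cs.simple_mul_simple_cancel_right]

/-! ### The normalized standard basis -/

variable (cs) in
/-- The normalized standard element `q^{-ℓ(w)/2} T_w`. -/
noncomputable def heckeTn (w : W) : HeckeAlgebra cs :=
  (T (-(cs.length w : ℤ)) : ℤ[T;T⁻¹]) • heckeT cs w

/-- The basis of normalized standard elements. -/
noncomputable def heckeBasisN (hE : cs.StrongExchange) :
    Module.Basis W ℤ[T;T⁻¹] (HeckeAlgebra cs) :=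
  (heckeBasis hE).isUnitSMul fun w => isUnit_T (-(cs.length w : ℤ))

theorem heckeBasisN_apply (hE : cs.StrongExchange) (w : W) :
    heckeBasisN hE w = heckeTn cs w := by
  rw [heckeBasisN, Module.Basis.isUnitSMul_apply, heckeBasis_apply, heckeTn]

theorem heckeT_eq_smul_heckeTn (w : W) :
    heckeT cs w = (T (cs.length w : ℤ) : ℤ[T;T⁻¹]) • heckeTn cs w := by
  rw [heckeTn, smul_smul, ← T_add, add_neg_cancel, T_zero, one_smul]

theorem repr_heckeTn (hE : cs.StrongExchange) (w u : W) [Decidable (w = u)] :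
    (heckeBasisN hE).repr (heckeTn cs w) u = if w = u then 1 else 0 := by
  classical
  rw [← heckeBasisN_apply hE, Module.Basis.repr_self, Finsupp.single_apply]

theorem isUnit_heckeTn (w : W) : IsUnit (heckeTn cs w) := by
  rw [heckeTn, Algebra.smul_def]
  exact ((isUnit_T (-(cs.length w : ℤ))).map _).mul (isUnit_heckeT cs w)

theorem heckeTn_one : heckeTn cs 1 = 1 := by
  rw [heckeTn, heckeT_one, cs.length_one, Nat.cast_zero, neg_zero, T_zero, one_smul]

theorem heckeTn_mul {w u : W} (h : cs.length (w * u) = cs.length w + cs.length u) :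
    heckeTn cs w * heckeTn cs u = heckeTn cs (w * u) := by
  rw [heckeTn, heckeTn, heckeTn, smul_mul_smul_comm, heckeT_mul cs w u h, ← T_add, h]
  push_cast
  rw [neg_add]

theorem heckeTn_mul_simple_of_not {w : W} {i : B} (h : ¬ cs.IsRightDescent w i) :
    heckeTn cs w * heckeTn cs (cs.simple i) = heckeTn cs (w * cs.simple i) := by
  rw [cs.not_isRightDescent_iff] at h
  exact heckeTn_mul (by rw [h, cs.length_simple])

theorem heckeTn_simple_mul_of_not {w : W} {i : B} (h : ¬ cs.IsLeftDescent w i) :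
    heckeTn cs (cs.simple i) * heckeTn cs w = heckeTn cs (cs.simple i * w) := by
  rw [cs.not_isLeftDescent_iff] at h
  exact heckeTn_mul (by rw [h, cs.length_simple, add_comm])

theorem heckeTn_simple_sq (i : B) : heckeTn cs (cs.simple i) * heckeTn cs (cs.simple i) =
    (T 1 - T (-1) : ℤ[T;T⁻¹]) • heckeTn cs (cs.simple i) + 1 := by
  rw [heckeTn, cs.length_simple, smul_mul_smul_comm, heckeT_simple_sq, smul_add, smul_smul, smul_smul,
    smul_smul, ← T_add, ← T_add, sub_mul, mul_sub, ← T_add, ← T_add, ← T_add, mul_one]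
  norm_num

theorem heckeTn_mul_simple_of_isRightDescent {w : W} {i : B} (h : cs.IsRightDescent w i) :
    heckeTn cs w * heckeTn cs (cs.simple i) =
      heckeTn cs (w * cs.simple i) + (T 1 - T (-1) : ℤ[T;T⁻¹]) • heckeTn cs w := by
  have h' := heckeTn_mul_simple_of_not (cs.isRightDescent_iff_not_isRightDescent_mul.mp h)
  rw [cs.simple_mul_simple_cancel_right] at h'
  rw [← h', mul_assoc, heckeTn_simple_sq, mul_add, mul_smul_comm, mul_one, add_comm]

theorem heckeTn_simple_mul_of_isLeftDescent {w : W} {i : B} (h : cs.IsLeftDescent w i) :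
    heckeTn cs (cs.simple i) * heckeTn cs w =
      heckeTn cs (cs.simple i * w) + (T 1 - T (-1) : ℤ[T;T⁻¹]) • heckeTn cs w := by
  have h' := heckeTn_simple_mul_of_not (cs.isLeftDescent_iff_not_isLeftDescent_mul.mp h)
  rw [cs.simple_mul_simple_cancel_left] at h'
  rw [← h', ← mul_assoc, heckeTn_simple_sq, add_mul, smul_mul_assoc, one_mul, add_comm]

variable (cs) in
/-- The Kazhdan–Lusztig element `C_i = q^{-1/2} (T_i + 1)` of a simple reflection. -/
noncomputable def klSimple (i : B) : HeckeAlgebra cs :=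
  heckeTn cs (cs.simple i) + (T (-1) : ℤ[T;T⁻¹]) • 1

theorem heckeTn_mul_klSimple_of_not {w : W} {i : B} (h : ¬ cs.IsRightDescent w i) :
    heckeTn cs w * klSimple cs i =
      heckeTn cs (w * cs.simple i) + (T (-1) : ℤ[T;T⁻¹]) • heckeTn cs w := by
  rw [klSimple, mul_add, heckeTn_mul_simple_of_not h, mul_smul_comm, mul_one]

theorem heckeTn_mul_klSimple_of_isRightDescent {w : W} {i : B} (h : cs.IsRightDescent w i) :
    heckeTn cs w * klSimple cs i =
      heckeTn cs (w * cs.simple i) + (T 1 : ℤ[T;T⁻¹]) • heckeTn cs w := by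
  rw [klSimple, mul_add, heckeTn_mul_simple_of_isRightDescent h, mul_smul_comm, mul_one, add_assoc,
    ← add_smul, sub_add_cancel]

theorem klSimple_mul_heckeTn_simple (i : B) :
    klSimple cs i * heckeTn cs (cs.simple i) = (T 1 : ℤ[T;T⁻¹]) • klSimple cs i := by
  rw [klSimple, add_mul, heckeTn_simple_sq, smul_mul_assoc, one_mul, smul_add, smul_smul, ← T_add,
    sub_smul]
  simp only [add_neg_cancel, T_zero, one_smul]
  abel

open Classical in
theorem repr_mul_klSimple (hE : cs.StrongExchange) (x : HeckeAlgebra cs) (i : B) (u : W) :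
    (heckeBasisN hE).repr (x * klSimple cs i) u =
      (heckeBasisN hE).repr x (u * cs.simple i) +
        (if cs.IsRightDescent u i then T 1 else T (-1)) * (heckeBasisN hE).repr x u := by
  have key : ((heckeBasisN hE).coord u).comp (LinearMap.mulRight ℤ[T;T⁻¹] (klSimple cs i)) =
      (heckeBasisN hE).coord (u * cs.simple i) +
        (if cs.IsRightDescent u i then T 1 else T (-1) : ℤ[T;T⁻¹]) • (heckeBasisN hE).coord u := by
    refine (heckeBasisN hE).ext fun w => ?_
    have e : w * cs.simple i = u ↔ w = u * cs.simple i := by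
      constructor
      · rintro rfl; rw [cs.simple_mul_simple_cancel_right]
      · rintro rfl; rw [cs.simple_mul_simple_cancel_right]
    simp only [LinearMap.comp_apply, LinearMap.mulRight_apply, LinearMap.add_apply,
      LinearMap.smul_apply, Module.Basis.coord_apply, heckeBasisN_apply]
    by_cases h : cs.IsRightDescent w i
    · rw [heckeTn_mul_klSimple_of_isRightDescent h]
      simp only [map_add, map_smul, Finsupp.add_apply, Finsupp.smul_apply, repr_heckeTn, e,
        smul_eq_mul]
      by_cases hw : w = u
      · subst hw; rw [if_pos h]
      · rw [if_neg hw, mul_zero, mul_zero]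
    · rw [heckeTn_mul_klSimple_of_not h]
      simp only [map_add, map_smul, Finsupp.add_apply, Finsupp.smul_apply, repr_heckeTn, e,
        smul_eq_mul]
      by_cases hw : w = u
      · subst hw; rw [if_neg h]
      · rw [if_neg hw, mul_zero, mul_zero]
  exact LinearMap.congr_fun key x

/-! ### The bar involution -/

theorem heckeBar_smul (c : ℤ[T;T⁻¹]) (x : HeckeAlgebra cs) :
    heckeBar cs (c • x) = invert c • heckeBar cs x := by
  rw [Algebra.smul_def, map_mul, heckeBar_algebraMap, ← Algebra.smul_def]

theorem heckeBar_heckeTn_simple (i : B) :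
    heckeBar cs (heckeTn cs (cs.simple i)) =
      heckeTn cs (cs.simple i) - (T 1 - T (-1) : ℤ[T;T⁻¹]) • 1 := by
  have h : heckeTn cs (cs.simple i) *
      (heckeTn cs (cs.simple i) - (T 1 - T (-1) : ℤ[T;T⁻¹]) • 1) = 1 := by
    rw [mul_sub, heckeTn_simple_sq, mul_smul_comm, mul_one, add_sub_cancel_left]
  have h1 : heckeT cs (cs.simple i) * heckeBar cs (heckeT cs (cs.simple i)) = 1 := by
    rw [heckeBar_heckeT, cs.inv_simple, Ring.mul_inverse_cancel _ (isUnit_heckeT cs _)]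
  have h2 : heckeTn cs (cs.simple i) * heckeBar cs (heckeTn cs (cs.simple i)) = 1 := by
    rw [heckeTn, heckeBar_smul, smul_mul_smul_comm, h1, invert_T, ← T_add, neg_neg,
      neg_add_cancel, T_zero, one_smul]
  exact (isUnit_heckeTn _).mul_left_cancel (h2.trans h.symm)

theorem heckeBar_klSimple (i : B) : heckeBar cs (klSimple cs i) = klSimple cs i := by
  rw [klSimple, map_add, heckeBar_heckeTn_simple, heckeBar_smul, map_one, invert_T, neg_neg,
    sub_smul]
  abel

variable (cs) in
/-- The span of the `T_v` with `ℓ(v) < n`. -/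
noncomputable def heckeLower (n : ℕ) : Submodule ℤ[T;T⁻¹] (HeckeAlgebra cs) :=
  Submodule.span ℤ[T;T⁻¹] (heckeTn cs '' {v | cs.length v < n})

theorem heckeTn_mem_heckeLower {n : ℕ} {w : W} (h : cs.length w < n) :
    heckeTn cs w ∈ heckeLower cs n := Submodule.subset_span ⟨w, h, rfl⟩

theorem heckeLower_mono {m n : ℕ} (h : m ≤ n) : heckeLower cs m ≤ heckeLower cs n :=
  Submodule.span_mono (Set.image_mono fun _ hv => lt_of_lt_of_le hv h)

theorem heckeTn_simple_mul_mem (i : B) {n : ℕ} {x : HeckeAlgebra cs} (hx : x ∈ heckeLower cs n) :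
    heckeTn cs (cs.simple i) * x ∈ heckeLower cs (n + 1) := by
  induction hx using Submodule.span_induction with
  | mem x hx =>
    obtain ⟨v, hv, rfl⟩ := hx
    have hv' : cs.length v < n := hv
    have := cs.length_simple_mul v i
    by_cases h : cs.IsLeftDescent v i
    · rw [heckeTn_simple_mul_of_isLeftDescent h]
      exact Submodule.add_mem _ (heckeTn_mem_heckeLower (by omega))
        (Submodule.smul_mem _ _ (heckeTn_mem_heckeLower (by omega)))
    · rw [heckeTn_simple_mul_of_not h]
      exact heckeTn_mem_heckeLower (by omega)
  | zero => rw [mul_zero]; exact Submodule.zero_mem _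
  | add x y _ _ hx hy => rw [mul_add]; exact Submodule.add_mem _ hx hy
  | smul c x _ hx => rw [mul_smul_comm]; exact Submodule.smul_mem _ _ hx

/-- The bar involution is unitriangular for the length: split off a left descent s and use that T̃_s
is sent to T̃_s − ξ. -/
theorem heckeBar_heckeTn_sub_mem (w : W) :
    heckeBar cs (heckeTn cs w) - heckeTn cs w ∈ heckeLower cs (cs.length w) := by
  induction hn : cs.length w generalizing w with
  | zero =>
    rw [cs.length_eq_zero_iff.mp hn, heckeTn_one, map_one, sub_self]
    exact Submodule.zero_mem _
  | succ n ih =>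
    have hw : w ≠ 1 := by rintro rfl; simp at hn
    obtain ⟨i, hi⟩ := cs.exists_leftDescent_of_ne_one hw
    have hi' := heckeTn_simple_mul_of_not (cs.isLeftDescent_iff_not_isLeftDescent_mul.mp hi)
    rw [cs.simple_mul_simple_cancel_left] at hi'
    rw [cs.isLeftDescent_iff] at hi
    have h1 := ih (cs.simple i * w) (by omega)
    rw [← hi', map_mul, heckeBar_heckeTn_simple]
    have e : (heckeTn cs (cs.simple i) - (T 1 - T (-1) : ℤ[T;T⁻¹]) • 1) *
        heckeBar cs (heckeTn cs (cs.simple i * w)) -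
          heckeTn cs (cs.simple i) * heckeTn cs (cs.simple i * w) =
        heckeTn cs (cs.simple i) *
          (heckeBar cs (heckeTn cs (cs.simple i * w)) - heckeTn cs (cs.simple i * w)) -
        (T 1 - T (-1) : ℤ[T;T⁻¹]) •
          (heckeBar cs (heckeTn cs (cs.simple i * w)) - heckeTn cs (cs.simple i * w)) -
        (T 1 - T (-1) : ℤ[T;T⁻¹]) • heckeTn cs (cs.simple i * w) := by
      rw [sub_mul, smul_mul_assoc, one_mul, mul_sub, smul_sub]
      abel
    rw [e]
    refine Submodule.sub_mem _ (Submodule.sub_mem _ (heckeTn_simple_mul_mem i h1) ?_) ?_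
    · exact Submodule.smul_mem _ _ (heckeLower_mono (by omega) h1)
    · exact Submodule.smul_mem _ _ (heckeTn_mem_heckeLower (by omega))

theorem repr_of_mem_heckeLower (hE : cs.StrongExchange) {n : ℕ} {x : HeckeAlgebra cs}
    (hx : x ∈ heckeLower cs n) {w : W} (hw : n ≤ cs.length w) :
    (heckeBasisN hE).repr x w = 0 := by
  classical
  induction hx using Submodule.span_induction with
  | mem x hx =>
    obtain ⟨v, hv, rfl⟩ := hx
    rw [repr_heckeTn, if_neg]
    rintro rfl
    exact absurd hw (not_le.mpr hv)
  | zero => simp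
  | add x y _ _ hx hy => rw [map_add, Finsupp.add_apply, hx, hy, add_zero]
  | smul c x _ hx => rw [map_smul, Finsupp.smul_apply, hx, smul_zero]

/-- At an element of maximal length in the support, the bar involution merely inverts v in the
coordinate. Invariance would equate a polynomial in negative powers of v with one in positive
powers. -/
theorem eq_zero_of_heckeBar_eq (hE : cs.StrongExchange) {x : HeckeAlgebra cs}
    (hb : heckeBar cs x = x) (hd : ∀ u, DegLE (-1) ((heckeBasisN hE).repr x u)) : x = 0 := by
  classical
  by_contra hx
  have hne : ((heckeBasisN hE).repr x).support.Nonempty := by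
    rw [Finsupp.support_nonempty_iff]
    simpa using hx
  obtain ⟨w, hw, hmax⟩ := Finset.exists_max_image _ cs.length hne
  have hsum : x = ∑ u ∈ ((heckeBasisN hE).repr x).support,
      (heckeBasisN hE).repr x u • heckeTn cs u := by
    conv_lhs => rw [← (heckeBasisN hE).linearCombination_repr x, Finsupp.linearCombination_apply]
    simp only [Finsupp.sum, heckeBasisN_apply]
  have key : (heckeBasisN hE).repr (heckeBar cs x) w = invert ((heckeBasisN hE).repr x w) := by
    conv_lhs => rw [hsum]
    rw [map_sum, map_sum, Finsupp.finsetSum_apply, Finset.sum_eq_single_of_mem w hw]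
    · have := repr_of_mem_heckeLower hE (heckeBar_heckeTn_sub_mem w) le_rfl
      rw [map_sub, Finsupp.sub_apply, sub_eq_zero, repr_heckeTn, if_pos rfl] at this
      rw [heckeBar_smul, map_smul, Finsupp.smul_apply, this, smul_eq_mul, mul_one]
    · intro u hu huw
      have := repr_of_mem_heckeLower hE (heckeBar_heckeTn_sub_mem u) (hmax u hu)
      rw [map_sub, Finsupp.sub_apply, sub_eq_zero, repr_heckeTn, if_neg huw] at this
      rw [heckeBar_smul, map_smul, Finsupp.smul_apply, this, smul_zero]
  rw [hb] at key
  refine Finsupp.mem_support_iff.mp hw (LaurentPolynomial.ext fun m => ?_)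
  rcases lt_or_ge (-1) m with h | h
  · exact hd w m h
  · rw [key, invert_apply]
    exact hd w (-m) (by omega)

end

end CoxeterSystem

namespace CoxeterSystem

open LaurentPolynomial

section

variable {B W : Type*} [Group W] {M : CoxeterMatrix B} {cs : CoxeterSystem M W}

/-! ### Existence and uniqueness of the Kazhdan–Lusztig basis -/

variable (cs) in
/-- The defining property of the Kazhdan–Lusztig element `C_w`. -/
def IsKLElement (w : W) (c : HeckeAlgebra cs) : Prop :=
  heckeBar cs c = c ∧
    ∃ P : W →₀ Polynomial ℤ,
      (∀ u ∈ P.support, cs.BruhatLE u w) ∧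
      P w = 1 ∧
      (∀ u ∈ P.support, u ≠ w → 2 * (P u).natDegree + 1 + cs.length u ≤ cs.length w) ∧
      c = (T (-(cs.length w : ℤ)) : ℤ[T;T⁻¹]) •
        P.sum fun u p => Polynomial.aeval (T 2 : ℤ[T;T⁻¹]) p • heckeT cs u

theorem degLE_aeval {p : Polynomial ℤ} {n : ℤ} (h : 2 * (p.natDegree : ℤ) ≤ n) :
    DegLE n (Polynomial.aeval (T 2 : ℤ[T;T⁻¹]) p) := by
  intro m hm
  by_contra hc
  obtain ⟨k, rfl⟩ := exists_of_coeff_aeval_T_two_ne_zero hc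
  rw [coeff_aeval_T_two_mul] at hc
  have := Polynomial.le_natDegree_of_ne_zero hc
  omega

theorem IsKLElement.exists_repr (hE : cs.StrongExchange) {w : W} {c : HeckeAlgebra cs}
    (h : IsKLElement cs w c) (u : W) :
    ∃ p : Polynomial ℤ, (heckeBasisN hE).repr c u =
      T ((cs.length u : ℤ) - cs.length w) * Polynomial.aeval (T 2 : ℤ[T;T⁻¹]) p ∧
      (p ≠ 0 → cs.BruhatLE u w) ∧ (u = w → p = 1) ∧
      (p ≠ 0 → u ≠ w → 2 * p.natDegree + 1 + cs.length u ≤ cs.length w) := by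
  classical
  obtain ⟨_, P, h1, h2, h3, h4⟩ := h
  refine ⟨P u, ?_, fun hp => h1 u (Finsupp.mem_support_iff.mpr hp), ?_,
    fun hp => h3 u (Finsupp.mem_support_iff.mpr hp)⟩
  · rw [h4, map_smul, Finsupp.smul_apply, Finsupp.sum, map_sum, Finsupp.finsetSum_apply]
    have e : ∀ x, (heckeBasisN hE).repr (Polynomial.aeval (T 2 : ℤ[T;T⁻¹]) (P x) • heckeT cs x) u =
        if x = u then Polynomial.aeval (T 2 : ℤ[T;T⁻¹]) (P u) * T (cs.length u : ℤ) else 0 := by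
      intro x
      rw [heckeT_eq_smul_heckeTn, smul_smul, map_smul, Finsupp.smul_apply, repr_heckeTn]
      split_ifs with hx
      · rw [hx, smul_eq_mul, mul_one]
      · rw [smul_zero]
    simp only [e]
    rw [Finset.sum_ite_eq']
    split_ifs with hu
    · rw [smul_eq_mul, mul_comm (Polynomial.aeval _ _), ← mul_assoc, ← T_add]
      congr 2
      ring
    · rw [Finsupp.notMem_support_iff.mp hu, map_zero, mul_zero, smul_zero]
  · rintro rfl
    exact h2

theorem IsKLElement.repr_self (hE : cs.StrongExchange) {w : W} {c : HeckeAlgebra cs}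
    (h : IsKLElement cs w c) : (heckeBasisN hE).repr c w = 1 := by
  obtain ⟨p, hp, _, h1, _⟩ := h.exists_repr hE w
  rw [hp, h1 rfl, map_one, mul_one, sub_self, T_zero]

theorem IsKLElement.degLE (hE : cs.StrongExchange) {w : W} {c : HeckeAlgebra cs}
    (h : IsKLElement cs w c) {u : W} (hu : u ≠ w) :
    DegLE (-1) ((heckeBasisN hE).repr c u) := by
  obtain ⟨p, hp, _, _, h3⟩ := h.exists_repr hE u
  rw [hp, degLE_T_mul_iff]
  by_cases h0 : p = 0
  · rw [h0, map_zero]; exact degLE_zero _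
  · have := h3 h0 hu
    exact degLE_aeval (by omega)

theorem IsKLElement.degLE_zero (hE : cs.StrongExchange) {w : W} {c : HeckeAlgebra cs}
    (h : IsKLElement cs w c) (u : W) : DegLE 0 ((heckeBasisN hE).repr c u) := by
  by_cases hu : u = w
  · rw [hu, h.repr_self hE]; exact degLE_one
  · exact (h.degLE hE hu).mono (by omega)

theorem IsKLElement.bruhatLE (hE : cs.StrongExchange) {w : W} {c : HeckeAlgebra cs}
    (h : IsKLElement cs w c) {u : W} (hu : (heckeBasisN hE).repr c u ≠ 0) : cs.BruhatLE u w := by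
  obtain ⟨p, hp, h1, _⟩ := h.exists_repr hE u
  refine h1 ?_
  rintro rfl
  rw [hp, map_zero, mul_zero] at hu
  exact hu rfl

/-- A bar-invariant element that is congruent to `q^{-ℓ(w)/2} T_w` is the Kazhdan–Lusztig element. -/
theorem IsKLElement.eq_of_heckeBar_eq (hE : cs.StrongExchange) {w : W} {c x : HeckeAlgebra cs}
    (h : IsKLElement cs w c) (hb : heckeBar cs x = x) (hw : (heckeBasisN hE).repr x w = 1)
    (hd : ∀ u, u ≠ w → DegLE (-1) ((heckeBasisN hE).repr x u)) : x = c := by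
  rw [← sub_eq_zero]
  refine eq_zero_of_heckeBar_eq hE (by rw [map_sub, hb, h.1]) fun u => ?_
  rw [map_sub, Finsupp.sub_apply]
  by_cases hu : u = w
  · rw [hu, hw, h.repr_self hE, sub_self]; exact LaurentPolynomial.degLE_zero _
  · exact (hd u hu).sub (h.degLE hE hu)

theorem IsKLElement.unique (hE : cs.StrongExchange) {w : W} {c c' : HeckeAlgebra cs}
    (h : IsKLElement cs w c) (h' : IsKLElement cs w c') : c' = c :=
  h.eq_of_heckeBar_eq hE h'.1 (h'.repr_self hE) fun _ hu => h'.degLE hE hu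

/-- In normalised coordinates the degree bound on P_{u,w} says exactly that only negative powers of
v occur off the diagonal. The parity condition on exponents must be supplied separately. -/
theorem isKLElement_of_repr (hE : cs.StrongExchange) {w : W} {c : HeckeAlgebra cs}
    (hb : heckeBar cs c = c) (hw : (heckeBasisN hE).repr c w = 1)
    (hd : ∀ u, u ≠ w → DegLE (-1) ((heckeBasisN hE).repr c u))
    (hp : ∀ u, ∃ p : Polynomial ℤ, (heckeBasisN hE).repr c u =
      T ((cs.length u : ℤ) - cs.length w) * Polynomial.aeval (T 2 : ℤ[T;T⁻¹]) p)
    (hs : ∀ u, (heckeBasisN hE).repr c u ≠ 0 → cs.BruhatLE u w) : IsKLElement cs w c := by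
  classical
  choose p hp using hp
  have h0 : ∀ u, p u = 0 ↔ (heckeBasisN hE).repr c u = 0 := by
    intro u
    constructor
    · intro h
      rw [hp, h, map_zero, mul_zero]
    · intro h
      ext k
      rw [Polynomial.coeff_zero, ← coeff_aeval_T_two_mul]
      have := hp u
      rw [h] at this
      have := congrArg (fun a => T (-((cs.length u : ℤ) - cs.length w)) * a) this
      rw [mul_zero, ← mul_assoc, ← T_add, neg_add_cancel, T_zero, one_mul] at this
      rw [← this]
      rfl
  have hp' : ∀ u k, (p u).coeff k =
      ((heckeBasisN hE).repr c u).coeff (2 * (k : ℤ) + ((cs.length u : ℤ) - cs.length w)) := by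
    intro u k
    rw [hp, coeff_T_mul, add_sub_cancel_right, coeff_aeval_T_two_mul]
  refine ⟨hb, Finsupp.onFinset ((heckeBasisN hE).repr c).support p fun u hu => ?_, ?_, ?_, ?_, ?_⟩
  · rw [Finsupp.mem_support_iff]
    exact fun h => hu ((h0 u).mpr h)
  · intro u hu
    rw [Finsupp.mem_support_iff, Finsupp.onFinset_apply] at hu
    exact hs u fun h => hu ((h0 u).mpr h)
  · rw [Finsupp.onFinset_apply]
    ext k
    rw [hp', hw, sub_self, add_zero, Polynomial.coeff_one, ← T_zero, T_apply]
    by_cases hk : k = 0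
    · rw [if_pos hk, if_pos (by omega)]
    · rw [if_neg hk, if_neg (by omega)]
  · intro u hu huw
    rw [Finsupp.mem_support_iff, Finsupp.onFinset_apply] at hu
    rw [Finsupp.onFinset_apply]
    by_contra hc
    have h1 := hd u huw (2 * ((p u).natDegree : ℤ) + ((cs.length u : ℤ) - cs.length w)) (by omega)
    rw [← hp', Polynomial.coeff_natDegree] at h1
    exact hu (Polynomial.leadingCoeff_eq_zero.mp h1)
  · rw [Finsupp.onFinset_sum _ (by simp), Finset.smul_sum]
    conv_lhs => rw [← (heckeBasisN hE).linearCombination_repr c, Finsupp.linearCombination_apply]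
    refine Finset.sum_congr rfl fun u _ => ?_
    change (heckeBasisN hE).repr c u • heckeBasisN hE u = _
    rw [heckeBasisN_apply, heckeTn, smul_smul, smul_smul]
    congr 1
    conv_lhs => rw [hp, mul_comm, ← mul_assoc, ← T_add]
    congr 2
    ring

-- With w' = ws, the product C_{w'} C_s is bar-invariant. Its unwanted constant terms occur only at
-- u with us < u, where they equal the coefficient μ(u) of v⁻¹ in C_{w'}; subtracting μ(u) C_u
-- removes them. The identity C_s T̃_s = v C_s passes to the result because every subtracted C_u has
-- s as a right descent.
open Classical in
theorem exists_isKLElement_of_isRightDescent (hE : cs.StrongExchange) {w : W} {i : B}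
    (hi : cs.IsRightDescent w i) (K : W → HeckeAlgebra cs)
    (hK : ∀ u, cs.length u < cs.length w → IsKLElement cs u (K u))
    (hKT : ∀ u, cs.length u < cs.length w → cs.IsRightDescent u i →
      K u * heckeTn cs (cs.simple i) = (T 1 : ℤ[T;T⁻¹]) • K u) :
    ∃ c, IsKLElement cs w c ∧
      c * heckeTn cs (cs.simple i) = (T 1 : ℤ[T;T⁻¹]) • c := by
  set β := heckeBasisN hE with hβ
  set w' := w * cs.simple i with hw'
  have hww : w' * cs.simple i = w := cs.simple_mul_simple_cancel_right i
  have hnd : ¬ cs.IsRightDescent w' i := cs.isRightDescent_iff_not_isRightDescent_mul.mp hi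
  have hl : cs.length w' + 1 = cs.length w := cs.isRightDescent_iff.mp hi
  have hne : ∀ x, x * cs.simple i = w' → x = w := fun x hx => by
    rw [← hww, ← hx, cs.simple_mul_simple_cancel_right]
  have hw'K := hK w' (by omega)
  set c' := K w' with hc'
  set μ : W → ℤ := fun u => (β.repr c' u).coeff (-1) with hμ
  set Z := (β.repr c').support.filter fun u => cs.IsRightDescent u i with hZ
  have hlt : ∀ u, β.repr c' u ≠ 0 → u ≠ w' → cs.length u < cs.length w' := fun u hu huw =>
    (hw'K.bruhatLE hE hu).eq_or_length_lt.resolve_left huw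
  have hZmem : ∀ u ∈ Z, β.repr c' u ≠ 0 ∧ cs.IsRightDescent u i ∧ u ≠ w' ∧
      cs.length u < cs.length w' := by
    intro u hu
    rw [hZ, Finset.mem_filter, Finsupp.mem_support_iff] at hu
    have : u ≠ w' := by rintro rfl; exact hnd hu.2
    exact ⟨hu.1, hu.2, this, hlt u hu.1 this⟩
  have hrepr : ∀ x, β.repr (c' * klSimple cs i - ∑ u ∈ Z, (C (μ u) : ℤ[T;T⁻¹]) • K u) x =
      β.repr c' (x * cs.simple i) +
        (if cs.IsRightDescent x i then T 1 else T (-1)) * β.repr c' x -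
        ∑ u ∈ Z, C (μ u) * β.repr (K u) x := by
    intro x
    rw [map_sub, Finsupp.sub_apply, repr_mul_klSimple, map_sum, Finsupp.finsetSum_apply]
    simp only [map_smul, Finsupp.smul_apply, smul_eq_mul, hβ]
  have hsum : ∀ x, DegLE (-1) (∑ u ∈ Z, C (μ u) * β.repr (K u) x -
      if x ∈ Z then (C (μ x) : ℤ[T;T⁻¹]) else 0) := by
    intro x
    rw [← Finset.sum_ite_eq Z x fun u => (C (μ u) : ℤ[T;T⁻¹]), ← Finset.sum_sub_distrib]
    refine DegLE.sum fun u hu => ?_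
    have hu' := hK u (by have := (hZmem u hu).2.2.2; omega)
    split_ifs with hx
    · rw [hx, hu'.repr_self hE, mul_one, sub_self]; exact LaurentPolynomial.degLE_zero _
    · rw [sub_zero]; exact (hu'.degLE hE hx).C_mul _
  refine ⟨c' * klSimple cs i - ∑ u ∈ Z, (C (μ u) : ℤ[T;T⁻¹]) • K u,
    isKLElement_of_repr hE ?_ ?_ ?_ ?_ ?_, ?_⟩
  · rw [map_sub, map_mul, hw'K.1, heckeBar_klSimple, map_sum]
    congr 1
    refine Finset.sum_congr rfl fun u hu => ?_
    rw [heckeBar_smul, (hK u (by have := (hZmem u hu).2.2.2; omega)).1, invert_C]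
  · have h0 : β.repr c' w = 0 := by
      by_contra h
      have := hlt w h (by intro h; rw [← h] at hl; omega)
      omega
    rw [hrepr, ← hw', hw'K.repr_self hE, h0, mul_zero, add_zero, Finset.sum_eq_zero, sub_zero]
    intro u hu
    have hu' := hK u (by have := (hZmem u hu).2.2.2; omega)
    by_contra hc
    have := (hu'.bruhatLE hE (right_ne_zero_of_mul hc)).eq_or_length_lt
    have h3 := (hZmem u hu).2.2.2
    rcases this with rfl | h <;> omega
  · intro x hxw
    rw [hrepr]
    have h1 : DegLE (-1) (β.repr c' (x * cs.simple i)) :=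
      hw'K.degLE hE fun h => hxw (hne x h)
    by_cases hx : cs.IsRightDescent x i
    · rw [if_pos hx]
      have hx' : x ≠ w' := by rintro rfl; exact hnd hx
      -- Multiplying by v moves the v⁻¹ coefficient into degree 0, where it cancels against μ(x).
      have h2 : DegLE (-1) (T 1 * β.repr c' x - C (μ x)) := by
        intro m hm
        rw [AddMonoidAlgebra.coeff_sub, Finsupp.sub_apply, coeff_T_mul, C_apply]
        split_ifs with h
        · rw [h, hμ, zero_sub, sub_self]
        · rw [hw'K.degLE hE hx' _ (by omega), sub_zero]
      have h3 : (if x ∈ Z then (C (μ x) : ℤ[T;T⁻¹]) else 0) = C (μ x) := by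
        split_ifs with h
        · rfl
        · have : β.repr c' x = 0 := by
            by_contra h0
            exact h (Finset.mem_filter.mpr ⟨Finsupp.mem_support_iff.mpr h0, hx⟩)
          simp [hμ, this]
      have h4 := hsum x
      rw [h3] at h4
      have := (h1.add h2).sub h4
      convert this using 1
      abel
    · have h3 : x ∉ Z := fun h => hx (hZmem x h).2.1
      have h4 := hsum x
      rw [if_neg h3, sub_zero] at h4
      rw [if_neg hx]
      refine (h1.add ?_).sub h4
      rw [degLE_T_mul_iff]
      exact hw'K.degLE_zero hE x
  · intro x
    have hadd : ∀ {a b : ℤ[T;T⁻¹]} {n : ℤ},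
        (∃ p : Polynomial ℤ, a = T n * Polynomial.aeval (T 2 : ℤ[T;T⁻¹]) p) →
        (∃ p : Polynomial ℤ, b = T n * Polynomial.aeval (T 2 : ℤ[T;T⁻¹]) p) →
        ∃ p : Polynomial ℤ, a + b = T n * Polynomial.aeval (T 2 : ℤ[T;T⁻¹]) p := by
      rintro _ _ n ⟨p, rfl⟩ ⟨p', rfl⟩
      exact ⟨p + p', by rw [map_add, mul_add]⟩
    have hshift : ∀ (p : Polynomial ℤ) (m n : ℤ) (k : ℕ), m = n + 2 * (k : ℤ) →
        ∃ p' : Polynomial ℤ, T m * Polynomial.aeval (T 2 : ℤ[T;T⁻¹]) p =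
          T n * Polynomial.aeval (T 2 : ℤ[T;T⁻¹]) p' := by
      rintro p m n k rfl
      refine ⟨Polynomial.X ^ k * p, ?_⟩
      rw [map_mul, map_pow, Polynomial.aeval_X, T_pow, ← mul_assoc, ← T_add]
      congr 3
      ring
    rw [hrepr, sub_eq_add_neg, ← Finset.sum_neg_distrib]
    obtain ⟨p1, hp1, _⟩ := hw'K.exists_repr hE x
    obtain ⟨p2, hp2, _⟩ := hw'K.exists_repr hE (x * cs.simple i)
    refine hadd (hadd ?_ ?_) ?_
    · rw [hp2]
      by_cases hx : cs.IsRightDescent x i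
      · have := cs.isRightDescent_iff.mp hx
        exact hshift _ _ _ 0 (by omega)
      · have := cs.not_isRightDescent_iff.mp hx
        exact hshift _ _ _ 1 (by omega)
    · rw [hp1, ← mul_assoc]
      split_ifs with hx
      · rw [← T_add]; exact hshift _ _ _ 1 (by omega)
      · rw [← T_add]; exact hshift _ _ _ 0 (by omega)
    · refine Finset.sum_induction _ (fun a => ∃ p : Polynomial ℤ,
        a = T ((cs.length x : ℤ) - cs.length w) * Polynomial.aeval (T 2 : ℤ[T;T⁻¹]) p)
        (fun a b ha hb => hadd ha hb) ⟨0, by rw [map_zero, mul_zero]⟩ fun u hu => ?_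
      have hu' := hK u (by have := (hZmem u hu).2.2.2; omega)
      by_cases h0 : μ u = 0
      · exact ⟨0, by rw [h0, map_zero, zero_mul, neg_zero, map_zero, mul_zero]⟩
      obtain ⟨p, hp, _⟩ := hu'.exists_repr hE x
      obtain ⟨p', hp', _⟩ := hw'K.exists_repr hE u
      have h1 : (β.repr c' u).coeff (-1) ≠ 0 := h0
      rw [hp', coeff_T_mul] at h1
      obtain ⟨k, hk⟩ := exists_of_coeff_aeval_T_two_ne_zero h1
      have hlu := (hZmem u hu).2.2.2
      -- A nonzero μ(u) forces ℓ(w') − ℓ(u) to be odd, so ℓ(w) − ℓ(u) is even and C_u has the right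
      -- parity of exponents.
      obtain ⟨p'', hp''⟩ := hshift (Polynomial.C (-μ u) * p) ((cs.length x : ℤ) - cs.length u)
        ((cs.length x : ℤ) - cs.length w) ((cs.length w - cs.length u) / 2) (by omega)
      refine ⟨p'', ?_⟩
      rw [← hp'', hp, map_mul, Polynomial.aeval_C, LaurentPolynomial.algebraMap_apply, map_neg]
      simp only [eq_intCast, Int.cast_id, Int.cast_neg]
      ring
  · intro x hx
    rw [hrepr] at hx
    have hw'w : cs.BruhatLE w' w := by rw [← hww]; exact bruhatLE_mul_simple hnd
    by_contra hc
    apply hx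
    have h1 : β.repr c' (x * cs.simple i) = 0 := by
      by_contra h
      have := (hw'K.bruhatLE hE h).mul_simple hE hnd
      rw [cs.simple_mul_simple_cancel_right, hww] at this
      exact hc this
    have h2 : β.repr c' x = 0 := by
      by_contra h
      exact hc ((hw'K.bruhatLE hE h).trans hw'w)
    rw [h1, h2, mul_zero, add_zero, Finset.sum_eq_zero, sub_zero]
    intro u hu
    have hu' := hK u (by have := (hZmem u hu).2.2.2; omega)
    by_contra h
    have h3 := hu'.bruhatLE hE (right_ne_zero_of_mul h)
    exact hc (h3.trans ((hw'K.bruhatLE hE (hZmem u hu).1).trans hw'w))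
  · rw [sub_mul, mul_assoc, klSimple_mul_heckeTn_simple, mul_smul_comm, smul_sub, Finset.sum_mul,
      Finset.smul_sum]
    congr 1
    refine Finset.sum_congr rfl fun u hu => ?_
    rw [smul_mul_assoc, hKT u (by have := (hZmem u hu).2.2.2; omega) (hZmem u hu).2.1, smul_comm]

theorem isKLElement_one (hE : cs.StrongExchange) : IsKLElement cs 1 (1 : HeckeAlgebra cs) := by
  classical
  have h : ∀ u, (heckeBasisN hE).repr (1 : HeckeAlgebra cs) u = if (1 : W) = u then 1 else 0 := by
    intro u
    rw [← heckeTn_one, repr_heckeTn]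
  refine isKLElement_of_repr hE (map_one _) ?_ ?_ ?_ ?_
  · rw [h, if_pos rfl]
  · intro u hu
    rw [h, if_neg hu.symm]; exact LaurentPolynomial.degLE_zero _
  · intro u
    rw [h]
    split_ifs with hu
    · subst hu
      exact ⟨1, by rw [map_one, mul_one, sub_self, T_zero]⟩
    · exact ⟨0, by rw [map_zero, mul_zero]⟩
  · intro u hu
    rw [h] at hu
    split_ifs at hu with h1
    · rw [h1]; exact BruhatLE.refl _
    · exact absurd rfl hu

/-- Existence of the Kazhdan–Lusztig element `C_w`, and its behaviour at the right descents. -/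
theorem exists_isKLElement (hE : cs.StrongExchange) (w : W) :
    ∃ c, IsKLElement cs w c ∧ ∀ i, cs.IsRightDescent w i →
      c * heckeTn cs (cs.simple i) = (T 1 : ℤ[T;T⁻¹]) • c := by
  induction hn : cs.length w using Nat.strong_induction_on generalizing w with
  | _ n ih =>
    subst hn
    have ih' : ∀ u : W, ∃ c, cs.length u < cs.length w → IsKLElement cs u c ∧
        ∀ i, cs.IsRightDescent u i →
          c * heckeTn cs (cs.simple i) = (T 1 : ℤ[T;T⁻¹]) • c := by
      intro u
      by_cases h : cs.length u < cs.length w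
      · obtain ⟨c, hc⟩ := ih _ h u rfl
        exact ⟨c, fun _ => hc⟩
      · exact ⟨0, fun h' => absurd h' h⟩
    choose K hK using ih'
    have key : ∀ i, cs.IsRightDescent w i → ∃ c, IsKLElement cs w c ∧
        c * heckeTn cs (cs.simple i) = (T 1 : ℤ[T;T⁻¹]) • c := fun i hi =>
      exists_isKLElement_of_isRightDescent hE hi K (fun u hu => (hK u hu).1)
        fun u hu hui => (hK u hu).2 i hui
    by_cases hw : w = 1
    · subst hw
      exact ⟨1, isKLElement_one hE, fun i hi => absurd hi (cs.not_isRightDescent_one i)⟩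
    · obtain ⟨i, hi⟩ := cs.exists_rightDescent_of_ne_one hw
      obtain ⟨c, hc, _⟩ := key i hi
      refine ⟨c, hc, fun j hj => ?_⟩
      -- The recursion depends on the descent chosen; uniqueness identifies the results, so one
      -- element has the eigenvalue property at all descents.
      obtain ⟨c', hc', h⟩ := key j hj
      rwa [hc.unique hE hc'] at h

theorem IsKLElement.mul_heckeTn_simple (hE : cs.StrongExchange) {w : W} {c : HeckeAlgebra cs}
    (h : IsKLElement cs w c) {i : B} (hi : cs.IsRightDescent w i) :
    c * heckeTn cs (cs.simple i) = (T 1 : ℤ[T;T⁻¹]) • c := by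
  obtain ⟨c', hc', h'⟩ := exists_isKLElement hE w
  rw [hc'.unique hE h]
  exact h' i hi

/-- The transition matrix from the T̃_w is unitriangular for the length, which gives independence at
an element of maximal length and spanning by induction. -/
theorem exists_isKLBasis (hE : cs.StrongExchange) :
    ∃ C : Module.Basis W ℤ[T;T⁻¹] (HeckeAlgebra cs), cs.IsKLBasis C := by
  classical
  choose K hK using fun w => (exists_isKLElement hE w).imp fun _ h => h.1
  have hlt : ∀ w u, (heckeBasisN hE).repr (K w) u ≠ 0 → u = w ∨ cs.length u < cs.length w :=
    fun w u h => ((hK w).bruhatLE hE h).eq_or_length_lt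
  have hli : LinearIndependent ℤ[T;T⁻¹] K := by
    rw [linearIndependent_iff]
    intro l hl
    by_contra hne
    obtain ⟨w, hw, hmax⟩ := Finset.exists_max_image _ cs.length (Finsupp.support_nonempty_iff.mpr hne)
    have h1 := congrArg (fun x => (heckeBasisN hE).repr x w) hl
    rw [Finsupp.linearCombination_apply, Finsupp.sum, map_sum, Finsupp.finsetSum_apply,
      Finset.sum_eq_single_of_mem w hw, map_smul, Finsupp.smul_apply, (hK w).repr_self hE, map_zero,
      smul_eq_mul, mul_one] at h1
    · exact Finsupp.mem_support_iff.mp hw h1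
    · intro u hu huw
      rw [map_smul, Finsupp.smul_apply]
      by_contra hc
      rcases hlt u w (right_ne_zero_of_smul hc) with h | h
      · exact huw h.symm
      · exact absurd (hmax u hu) (not_le.mpr h)
  have hspan : ⊤ ≤ Submodule.span ℤ[T;T⁻¹] (Set.range K) := by
    rw [← (heckeBasisN hE).span_eq, Submodule.span_le]
    rintro _ ⟨w, rfl⟩
    induction hn : cs.length w using Nat.strong_induction_on generalizing w with
    | _ n ih =>
      have e : heckeBasisN hE w =
          K w - ∑ u ∈ ((heckeBasisN hE).repr (K w)).support.erase w,
            (heckeBasisN hE).repr (K w) u • heckeBasisN hE u := by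
        rw [eq_sub_iff_add_eq]
        conv_rhs => rw [← (heckeBasisN hE).linearCombination_repr (K w),
          Finsupp.linearCombination_apply, Finsupp.sum]
        rw [← Finset.add_sum_erase _ _ (Finsupp.mem_support_iff.mpr (by
          rw [(hK w).repr_self hE]; exact one_ne_zero)), (hK w).repr_self hE, one_smul]
      rw [e]
      refine Submodule.sub_mem _ (Submodule.subset_span ⟨w, rfl⟩)
        (Submodule.sum_mem _ fun u hu => Submodule.smul_mem _ _ ?_)
      rw [Finset.mem_erase, Finsupp.mem_support_iff] at hu
      exact ih _ (hn ▸ (hlt w u hu.2).resolve_left hu.1) u rfl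
  refine ⟨Module.Basis.mk hli hspan, fun w => ?_⟩
  rw [Module.Basis.mk_apply]
  exact hK w

theorem existsUnique_isKLBasis (hE : cs.StrongExchange) :
    ∃! C : Module.Basis W ℤ[T;T⁻¹] (HeckeAlgebra cs), cs.IsKLBasis C := by
  obtain ⟨C, hC⟩ := exists_isKLBasis hE
  exact ⟨C, hC, fun C' hC' => Module.Basis.eq_of_apply_eq fun w =>
    IsKLElement.unique hE (hC w) (hC' w)⟩

end

end CoxeterSystem

/-! ## Polynomials in `q^{1/2} - q^{-1/2}` with natural coefficients -/

namespace LaurentPolynomial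
open Polynomial (aeval)

theorem coeff_xi_pow (k : ℕ) :
    DegLE k ((T 1 - T (-1) : ℤ[T;T⁻¹]) ^ k) ∧ ((T 1 - T (-1) : ℤ[T;T⁻¹]) ^ k).coeff k = 1 := by
  induction k with
  | zero =>
    refine ⟨by simpa using degLE_one, ?_⟩
    rw [pow_zero, ← T_zero, T_apply, if_pos (by simp)]
  | succ k ih =>
    have h : (T 1 - T (-1) : ℤ[T;T⁻¹]) ^ (k + 1) =
        T 1 * (T 1 - T (-1)) ^ k - T (-1) * (T 1 - T (-1)) ^ k := by ring
    rw [h]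
    refine ⟨?_, ?_⟩
    · refine DegLE.sub (degLE_T_mul_iff.mpr (ih.1.mono ?_)) (degLE_T_mul_iff.mpr (ih.1.mono ?_)) <;>
        push_cast <;> omega
    · have h1 := ih.1 ((k : ℤ) + 2) (by omega)
      have e : ∀ a b : ℤ[T;T⁻¹], ∀ n, (a - b).coeff n = a.coeff n - b.coeff n := fun _ _ _ => rfl
      rw [e, coeff_T_mul, coeff_T_mul]
      have e1 : ((k + 1 : ℕ) : ℤ) - 1 = k := by push_cast; ring
      have e2 : ((k + 1 : ℕ) : ℤ) - -1 = k + 2 := by push_cast; ring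
      rw [e1, e2, h1, ih.2, sub_zero]

/-- The leading term of ξ is v, so the degree in ξ is the degree in v, with the same leading
coefficient. -/
theorem coeff_aeval_xi {p : Polynomial ℕ} {n : ℕ} (h : p.natDegree ≤ n) :
    DegLE n (aeval (T 1 - T (-1) : ℤ[T;T⁻¹]) p) ∧
      (aeval (T 1 - T (-1) : ℤ[T;T⁻¹]) p).coeff n = p.coeff n := by
  have hs : ∀ (c : ℕ) (a : ℤ[T;T⁻¹]) (m : ℤ), (c • a).coeff m = c * a.coeff m := fun c a m => by
    rw [AddMonoidAlgebra.coeff_smul_apply, nsmul_eq_mul]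
  have hd : ∀ k : ℕ, DegLE k (p.coeff k • (T 1 - T (-1) : ℤ[T;T⁻¹]) ^ k) := fun k m hm => by
    rw [hs, (coeff_xi_pow k).1 m hm, mul_zero]
  rw [Polynomial.aeval_eq_sum_range' (n := n + 1) (by omega)]
  refine ⟨DegLE.sum fun k hk => (hd k).mono ?_, ?_⟩
  · have := Finset.mem_range.mp hk
    omega
  · rw [Finset.sum_range_succ]
    have h1 : DegLE ((n : ℤ) - 1)
        (∑ k ∈ Finset.range n, p.coeff k • (T 1 - T (-1) : ℤ[T;T⁻¹]) ^ k) :=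
      DegLE.sum fun k hk => (hd k).mono (by have := Finset.mem_range.mp hk; omega)
    have e : ∀ a b : ℤ[T;T⁻¹], ∀ n, (a + b).coeff n = a.coeff n + b.coeff n := fun _ _ _ => rfl
    rw [e, h1 n (by omega), hs, (coeff_xi_pow n).2, mul_one, zero_add]

end LaurentPolynomial

namespace Polynomial

/-- No cancellation occurs over ℕ; this is what makes positivity of structure constants useful. -/
theorem natDegree_le_add_left_nat (p q : ℕ[X]) : p.natDegree ≤ (p + q).natDegree := by
  by_cases hp : p = 0
  · simp [hp]
  refine le_natDegree_of_ne_zero ?_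
  rw [coeff_add]
  have : p.coeff p.natDegree ≠ 0 := by rwa [coeff_natDegree, leadingCoeff_ne_zero]
  omega

theorem natDegree_le_sum_nat {ι : Type*} {s : Finset ι} (f : ι → ℕ[X]) {i : ι} (hi : i ∈ s) :
    (f i).natDegree ≤ (∑ j ∈ s, f j).natDegree := by
  classical
  rw [← Finset.add_sum_erase s f hi]
  exact natDegree_le_add_left_nat _ _

end Polynomial

/-! ### Positivity of the structure constants of the standard basis -/

namespace CoxeterSystem
open LaurentPolynomial

section

variable {B W : Type*} [Group W] {M : CoxeterMatrix B} {cs : CoxeterSystem M W}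

/-- The coordinates of `x` with respect to the normalized standard basis are polynomials in
`q^{1/2} - q^{-1/2}` with natural coefficients whose degree satisfies `P`. -/
def IsPositive (hE : cs.StrongExchange) (P : ℕ → Prop) (x : HeckeAlgebra cs) : Prop :=
  ∀ w, ∃ p : Polynomial ℕ, P p.natDegree ∧
    (heckeBasisN hE).repr x w = Polynomial.aeval (T 1 - T (-1) : ℤ[T;T⁻¹]) p

theorem isPositive_heckeTn (hE : cs.StrongExchange) (n : ℕ) (w : W) :
    IsPositive hE (· ≤ n) (heckeTn cs w) := by
  classical
  intro u
  refine ⟨if w = u then 1 else 0, ?_, ?_⟩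
  · split_ifs <;> simp
  · rw [repr_heckeTn]
    split_ifs <;> simp

theorem IsPositive.mono {hE : cs.StrongExchange} {P Q : ℕ → Prop} {x : HeckeAlgebra cs}
    (h : IsPositive hE P x) (hPQ : ∀ n, P n → Q n) : IsPositive hE Q x := fun w =>
  let ⟨p, hp, e⟩ := h w
  ⟨p, hPQ _ hp, e⟩

theorem IsPositive.add {hE : cs.StrongExchange} {n : ℕ} {x y : HeckeAlgebra cs}
    (hx : IsPositive hE (· ≤ n) x) (hy : IsPositive hE (· ≤ n) y) :
    IsPositive hE (· ≤ n) (x + y) := fun w => by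
  obtain ⟨p, hp, e⟩ := hx w
  obtain ⟨p', hp', e'⟩ := hy w
  exact ⟨p + p', Polynomial.natDegree_add_le_of_degree_le hp hp', by
    rw [map_add, Finsupp.add_apply, e, e', map_add]⟩

theorem IsPositive.smul {hE : cs.StrongExchange} {n : ℕ} {x : HeckeAlgebra cs}
    (hx : IsPositive hE (· ≤ n) x) :
    IsPositive hE (· ≤ n + 1) ((T 1 - T (-1) : ℤ[T;T⁻¹]) • x) := fun w => by
  obtain ⟨p, hp, e⟩ := hx w
  refine ⟨Polynomial.X * p, ?_, ?_⟩
  · refine (Polynomial.natDegree_mul_le).trans ?_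
    rw [Polynomial.natDegree_X]
    omega
  · rw [map_smul, Finsupp.smul_apply, e, map_mul, Polynomial.aeval_X, smul_eq_mul]

/-- The product of the `T_i` (normalized) along a word. -/
noncomputable def heckeWord (cs : CoxeterSystem M W) (ω : List B) : HeckeAlgebra cs :=
  (ω.map fun i => heckeTn cs (cs.simple i)).prod

theorem heckeWord_nil : heckeWord cs [] = 1 := rfl

theorem heckeWord_cons (i : B) (ω : List B) :
    heckeWord cs (i :: ω) = heckeTn cs (cs.simple i) * heckeWord cs ω := List.prod_cons

theorem not_isLeftDescent_of_isReduced {i : B} {ω : List B} (h : cs.IsReduced (i :: ω)) :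
    ¬ cs.IsLeftDescent (cs.wordProd ω) i := by
  have h1 := h.eq
  have h2 := cs.length_wordProd_le ω
  rw [cs.wordProd_cons, List.length_cons] at h1
  rw [cs.not_isLeftDescent_iff]
  have := cs.length_simple_mul (cs.wordProd ω) i
  omega

theorem heckeTn_wordProd {ω : List B} (h : cs.IsReduced ω) :
    heckeTn cs (cs.wordProd ω) = heckeWord cs ω := by
  induction ω with
  | nil => rw [cs.wordProd_nil, heckeTn_one, heckeWord_nil]
  | cons i ω ih =>
    rw [heckeWord_cons, ← ih (h.drop 1), heckeTn_simple_mul_of_not, cs.wordProd_cons]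
    exact not_isLeftDescent_of_isReduced h

theorem exists_isPositive_mul_heckeWord (hE : cs.StrongExchange) (w : W) (ω : List B) :
    ∃ n, IsPositive hE (· ≤ n) (heckeTn cs w * heckeWord cs ω) := by
  induction ω generalizing w with
  | nil => exact ⟨0, by rw [heckeWord_nil, mul_one]; exact isPositive_heckeTn hE 0 w⟩
  | cons i ω ih =>
    rw [heckeWord_cons, ← mul_assoc]
    obtain ⟨n, hn⟩ := ih (w * cs.simple i)
    by_cases h : cs.IsRightDescent w i
    · obtain ⟨m, hm⟩ := ih w
      rw [heckeTn_mul_simple_of_isRightDescent h, add_mul, smul_mul_assoc]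
      exact ⟨max n (m + 1), (hn.mono fun k hk => by omega).add
        (hm.smul.mono fun k hk => by omega)⟩
    · rw [heckeTn_mul_simple_of_not h]
      exact ⟨n, hn⟩

theorem exists_isPositive_heckeTn_mul (hE : cs.StrongExchange) (w u : W) :
    ∃ n, IsPositive hE (· ≤ n) (heckeTn cs w * heckeTn cs u) := by
  obtain ⟨ω, hω, rfl⟩ := cs.exists_isReduced u
  rw [heckeTn_wordProd hω]
  exact exists_isPositive_mul_heckeWord hE w ω

/-- Left multiplication by a standard element does not lower the degree of a positive element. -/
theorem degLE_of_isPositive_mul (hE : cs.StrongExchange) {n m : ℕ} {g : W} {x : HeckeAlgebra cs}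
    (hx : IsPositive hE (· ≤ m) x) (hg : IsPositive hE (· ≤ n) (heckeTn cs g * x)) (z : W) :
    DegLE n ((heckeBasisN hE).repr x z) := by
  classical
  set β := heckeBasisN hE with hβ
  choose p _ hp using hx
  have hq := fun u => (exists_isPositive_heckeTn_mul hE g u).choose_spec
  choose q _ hq' using hq
  rw [hp]
  refine (coeff_aeval_xi le_rfl).1.mono ?_
  by_cases hz : p z = 0
  · rw [hz]; simp
  -- Since T̃_g is invertible, T̃_g T̃_z has some nonzero coordinate w. The coordinate of T̃_g x at
  -- w is a sum over ℕ containing p_z times that polynomial, so its degree is at least that of p_z.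
  have hne : heckeTn cs g * heckeTn cs z ≠ 0 := by
    intro h0
    rw [(isUnit_heckeTn g).mul_right_eq_zero] at h0
    have := (heckeBasisN hE).ne_zero z
    rw [heckeBasisN_apply] at this
    exact this h0
  obtain ⟨w, hw⟩ : ∃ w, β.repr (heckeTn cs g * heckeTn cs z) w ≠ 0 := by
    by_contra! h
    exact hne (β.repr.map_eq_zero_iff.mp (Finsupp.ext h))
  have hqz : q z w ≠ 0 := by
    intro h0
    rw [hq', h0, map_zero] at hw
    exact hw rfl
  have hzs : z ∈ (β.repr x).support := by
    rw [Finsupp.mem_support_iff, hp]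
    intro h0
    have h1 := (coeff_aeval_xi (p := p z) le_rfl).2
    rw [h0] at h1
    have h2 : (p z).coeff (p z).natDegree ≠ 0 := by
      rwa [Polynomial.coeff_natDegree, Polynomial.leadingCoeff_ne_zero]
    have h3 : (0 : ℤ[T;T⁻¹]).coeff ((p z).natDegree : ℤ) = 0 := rfl
    rw [h3] at h1
    exact h2 (by exact_mod_cast h1.symm)
  have hsum : β.repr (heckeTn cs g * x) w = Polynomial.aeval (T 1 - T (-1) : ℤ[T;T⁻¹])
      (∑ u ∈ (β.repr x).support, p u * q u w) := by
    conv_lhs => rw [← β.linearCombination_repr x, Finsupp.linearCombination_apply, Finsupp.sum,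
      Finset.mul_sum, map_sum, Finsupp.finsetSum_apply]
    rw [map_sum]
    refine Finset.sum_congr rfl fun u _ => ?_
    rw [hβ, heckeBasisN_apply, mul_smul_comm, map_smul, Finsupp.smul_apply, smul_eq_mul,
      ← hβ, hp, hq', map_mul]
  obtain ⟨r, hr, hr'⟩ := hg w
  rw [← hβ, hsum] at hr'
  have h1 : (p z).natDegree ≤ (∑ u ∈ (β.repr x).support, p u * q u w).natDegree := by
    refine le_trans ?_ (Polynomial.natDegree_le_sum_nat (fun u => p u * q u w) hzs)
    rw [Polynomial.natDegree_mul hz hqz]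
    omega
  by_contra hlt
  have h2 := (coeff_aeval_xi (p := ∑ u ∈ (β.repr x).support, p u * q u w) le_rfl).2
  rw [hr', (coeff_aeval_xi hr).1 _ (by push_cast at hlt; omega)] at h2
  have h3 : (∑ u ∈ (β.repr x).support, p u * q u w).coeff
      (∑ u ∈ (β.repr x).support, p u * q u w).natDegree = 0 := by exact_mod_cast h2.symm
  rw [Polynomial.coeff_natDegree, Polynomial.leadingCoeff_eq_zero] at h3
  rw [h3, Polynomial.natDegree_zero] at h1
  omega

end

end CoxeterSystem

/-! ## The degrees of the structure constants in type `G̃₂` -/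

namespace AffineG2
open CoxeterSystem LaurentPolynomial

/-- The coefficient of `simpleRoot i` in `simpleEnd i f - f`. -/
def reflCoeff : Fin 3 → ℤ × ℤ × ℤ → ℤ
  | 0, f => f.1
  | 1, f => f.2.1 - 2 * f.1
  | 2, f => 3 * f.1 - 2 * f.2.1

theorem simpleEnd_eq_add (i : Fin 3) (f : ℤ × ℤ × ℤ) :
    simpleEnd i f = f + reflCoeff i f • simpleRoot i := by
  obtain ⟨a, b, k⟩ := f
  fin_cases i <;> simp [simpleEnd_zero, simpleEnd_one, simpleEnd_two, reflCoeff, simpleRoot] <;>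
    (try constructor) <;> ring

theorem act_const (w : W) (k : ℤ) : act w (0, 0, k) = (0, 0, k) := by
  induction w using cs.simple_induction_left with
  | one => simp
  | mul_simple_left w i ih =>
    rw [act_mul_apply, ih, act_simple]
    fin_cases i <;> simp [simpleEnd_zero, simpleEnd_one, simpleEnd_two]

/-- The linear functionals on affine functionals which vanish on constants. -/
def KillsConst (φ : ℤ × ℤ × ℤ →ₗ[ℤ] ℤ) : Prop := φ (0, 0, 1) = 0

theorem KillsConst.apply {φ : ℤ × ℤ × ℤ →ₗ[ℤ] ℤ} (h : KillsConst φ) (a b k : ℤ) :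
    φ (a, b, k) = φ (a, b, 0) := by
  have : ((a, b, k) : ℤ × ℤ × ℤ) = (a, b, 0) + k • (0, 0, 1) := by simp
  rw [this, map_add, map_smul, h, smul_zero, add_zero]

theorem KillsConst.comp_act {φ : ℤ × ℤ × ℤ →ₗ[ℤ] ℤ} (h : KillsConst φ) (w : W) :
    KillsConst (φ ∘ₗ act w) := by
  unfold KillsConst
  rw [LinearMap.comp_apply, act_const, h]

theorem KillsConst.comp_simpleEnd {φ : ℤ × ℤ × ℤ →ₗ[ℤ] ℤ} (h : KillsConst φ) (i : Fin 3) :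
    KillsConst (φ ∘ₗ simpleEnd i) := by
  rw [← act_simple]
  exact h.comp_act _

/-- The linear part of a simple reflection, acting on coroots. -/
def reflCoroot (i : Fin 3) (p : ℤ × ℤ) : ℤ × ℤ :=
  ((simpleEnd i (p.1, p.2, 0)).1, (simpleEnd i (p.1, p.2, 0)).2.1)

theorem reflCoroot_mem {i : Fin 3} {p : ℤ × ℤ} (h : p ∈ coroots) : reflCoroot i p ∈ coroots :=
  IsRoot.simpleEnd (f := (p.1, p.2, 0)) h i

theorem reflCoroot_reflCoroot (i : Fin 3) (p : ℤ × ℤ) : reflCoroot i (reflCoroot i p) = p := by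
  fin_cases i <;> simp [reflCoroot, simpleEnd_zero, simpleEnd_one, simpleEnd_two]

theorem KillsConst.simpleEnd_apply {φ : ℤ × ℤ × ℤ →ₗ[ℤ] ℤ} (h : KillsConst φ) (i : Fin 3)
    (p : ℤ × ℤ) : φ (simpleEnd i (p.1, p.2, 0)) =
      φ ((reflCoroot i p).1, (reflCoroot i p).2, 0) :=
  h.apply _ _ _

/-! ### Counting coroots by sign -/

/-- The number of coroots which are negative for `φ` and positive for `χ`. -/
def signCount (φ χ : ℤ × ℤ × ℤ →ₗ[ℤ] ℤ) : ℕ :=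
  (coroots.filter fun p => φ (p.1, p.2, 0) < 0 ∧ 0 < χ (p.1, p.2, 0)).card

theorem map_neg_coroot (φ : ℤ × ℤ × ℤ →ₗ[ℤ] ℤ) (p : ℤ × ℤ) :
    φ ((-p).1, (-p).2, 0) = -φ (p.1, p.2, 0) := by
  rw [← map_neg]
  congr 1

theorem neg_mem_coroots {p : ℤ × ℤ} (h : p ∈ coroots) : -p ∈ coroots :=
  (by decide : ∀ p ∈ coroots, -p ∈ coroots) p h

/-- Negation injects the φ-negative coroots into the others, so they are at most half of the twelve.
This 6 is the final degree bound. -/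
theorem signCount_le (φ χ : ℤ × ℤ × ℤ →ₗ[ℤ] ℤ) : signCount φ χ ≤ 6 := by
  have h1 : signCount φ χ ≤ (coroots.filter fun p => φ (p.1, p.2, 0) < 0).card :=
    Finset.card_le_card fun p => by simp +contextual
  have h2 : (coroots.filter fun p => φ (p.1, p.2, 0) < 0).card ≤
      (coroots.filter fun p => ¬ φ (p.1, p.2, 0) < 0).card := by
    refine Finset.card_le_card_of_injOn (fun p => -p) ?_ (neg_injective.injOn)
    intro p hp
    have hp := Finset.mem_filter.mp (Finset.mem_coe.mp hp)
    refine Finset.mem_coe.mpr (Finset.mem_filter.mpr ⟨neg_mem_coroots hp.1, ?_⟩)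
    rw [map_neg_coroot]
    omega
  have h3 := Finset.card_filter_add_card_filter_not (s := coroots) (fun p => φ (p.1, p.2, 0) < 0)
  have h4 : coroots.card = 12 := by decide
  omega

theorem signCount_comp_simpleEnd {φ χ : ℤ × ℤ × ℤ →ₗ[ℤ] ℤ} (hφ : KillsConst φ)
    (hχ : KillsConst χ) (i : Fin 3) :
    signCount (φ ∘ₗ simpleEnd i) (χ ∘ₗ simpleEnd i) = signCount φ χ := by
  refine Finset.card_nbij' (reflCoroot i) (reflCoroot i) ?_ ?_ ?_ ?_
  · intro p hp
    simp only [Finset.coe_filter, Set.mem_ofPred_eq, LinearMap.comp_apply, hφ.simpleEnd_apply,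
      hχ.simpleEnd_apply] at hp ⊢
    exact ⟨reflCoroot_mem hp.1, hp.2⟩
  · intro p hp
    simp only [Finset.coe_filter, Set.mem_ofPred_eq, LinearMap.comp_apply, hφ.simpleEnd_apply,
      hχ.simpleEnd_apply, reflCoroot_reflCoroot] at hp ⊢
    exact ⟨reflCoroot_mem hp.1, hp.2⟩
  · exact fun p _ => reflCoroot_reflCoroot i p
  · exact fun p _ => reflCoroot_reflCoroot i p

/-- Send a counted coroot to itself if it is already φ-negative and to its reflection otherwise.
This is injective into the coroots counted for φ and χ, and it misses the coroot of the simple root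
itself. -/
theorem signCount_comp_simpleEnd_lt {φ χ : ℤ × ℤ × ℤ →ₗ[ℤ] ℤ} (hφ : KillsConst φ)
    (hχ : KillsConst χ) {i : Fin 3} (h1 : φ (simpleRoot i) < 0) (h2 : 0 < χ (simpleRoot i)) :
    signCount (φ ∘ₗ simpleEnd i) χ < signCount φ χ := by
  have key : ∀ (θ : ℤ × ℤ × ℤ →ₗ[ℤ] ℤ), KillsConst θ → ∀ p : ℤ × ℤ,
      θ ((reflCoroot i p).1, (reflCoroot i p).2, 0) =
        θ (p.1, p.2, 0) + reflCoeff i (p.1, p.2, 0) * θ (simpleRoot i) := by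
    intro θ hθ p
    rw [← hθ.simpleEnd_apply, simpleEnd_eq_add, map_add, map_smul, smul_eq_mul]
  set γ : ℤ × ℤ := ((simpleRoot i).1, (simpleRoot i).2.1) with hγ
  have hγφ : φ (γ.1, γ.2, 0) < 0 := by rw [← hφ.apply _ _ (simpleRoot i).2.2]; exact h1
  have hγχ : 0 < χ (γ.1, γ.2, 0) := by rw [← hχ.apply _ _ (simpleRoot i).2.2]; exact h2
  have hγm : γ ∈ coroots := isRoot_simpleRoot i
  have hγr : reflCoroot i γ = -γ := by
    rw [hγ]
    fin_cases i <;> rfl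
  have hmem : γ ∈ coroots.filter fun p => φ (p.1, p.2, 0) < 0 ∧ 0 < χ (p.1, p.2, 0) :=
    Finset.mem_filter.mpr ⟨hγm, hγφ, hγχ⟩
  unfold signCount
  rw [← Finset.card_erase_add_one hmem, Nat.lt_add_one_iff]
  refine Finset.card_le_card_of_injOn
    (fun p => if φ (p.1, p.2, 0) < 0 then p else reflCoroot i p) ?_ ?_
  · intro p hp
    simp only [Finset.coe_filter, Set.mem_ofPred_eq, LinearMap.comp_apply,
      hφ.simpleEnd_apply] at hp
    obtain ⟨hm, hp1, hp2⟩ := hp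
    simp only [Finset.coe_erase, Finset.coe_filter, Set.mem_sdiff, Set.mem_ofPred_eq,
      Set.mem_singleton_iff]
    split_ifs with h
    · refine ⟨⟨hm, h, hp2⟩, ?_⟩
      rintro rfl
      rw [hγr, map_neg_coroot] at hp1
      omega
    · refine ⟨⟨reflCoroot_mem hm, hp1, ?_⟩, ?_⟩
      · rw [key φ hφ] at hp1
        rw [key χ hχ]
        -- Passing from φ(p) ≥ 0 to a negative value by adding a multiple of φ(γ) < 0 needs a
        -- positive multiple, and the same multiple only increases χ.
        have hn : 0 < reflCoeff i (p.1, p.2, 0) := by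
          by_contra hc
          nlinarith
        nlinarith
      · intro he
        have : p = -γ := by rw [← hγr, ← he, reflCoroot_reflCoroot]
        rw [this, map_neg_coroot] at hp2
        omega
  · intro p hp p' hp' he
    simp only [Finset.coe_filter, Set.mem_ofPred_eq, LinearMap.comp_apply,
      hφ.simpleEnd_apply] at hp hp'
    dsimp only at he
    split_ifs at he with h h' h'
    · exact he
    · rw [he, reflCoroot_reflCoroot] at hp
      omega
    · rw [← he, reflCoroot_reflCoroot] at hp'
      omega
    · rw [← reflCoroot_reflCoroot i p, he, reflCoroot_reflCoroot]

/-! ### Elements deep inside a chamber -/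

/-- The element `w` lies far in the interior of a chamber with respect to `ψ`. -/
def IsDeep (ψ : ℤ × ℤ × ℤ →ₗ[ℤ] ℤ) (w : W) (D : ℤ) : Prop :=
  ∀ p ∈ coroots, 0 < ψ (act w (p.1, p.2, 0)) → (act w (p.1, p.2, 0)).2.2 ≤ -D

/-- The functional `ψ` does not vanish on the coroots. -/
def IsRegular (ψ : ℤ × ℤ × ℤ →ₗ[ℤ] ℤ) : Prop := ∀ p ∈ coroots, ψ (p.1, p.2, 0) ≠ 0

theorem IsRegular.apply_ne_zero {ψ : ℤ × ℤ × ℤ →ₗ[ℤ] ℤ} (h : IsRegular ψ) (hψ : KillsConst ψ)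
    {f : ℤ × ℤ × ℤ} (hf : IsRoot f) : ψ f ≠ 0 := by
  have := h _ hf
  rwa [← hψ.apply _ _ f.2.2] at this

theorem act_third_add (w : W) (a b k : ℤ) :
    (act w (a, b, k)).2.2 = (act w (a, b, 0)).2.2 + k := by
  have : ((a, b, k) : ℤ × ℤ × ℤ) = (a, b, 0) + (0, 0, k) := by simp
  rw [this, map_add, act_const]
  rfl

theorem IsDeep.mul_simple {ψ : ℤ × ℤ × ℤ →ₗ[ℤ] ℤ} (hψ : KillsConst ψ) {w : W} {D : ℤ}
    (h : IsDeep ψ w D) (i : Fin 3) : IsDeep ψ (w * cs.simple i) (D - 2) := by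
  intro p hp hpos
  rw [act_mul_apply, act_simple] at hpos ⊢
  have h1 := h _ (reflCoroot_mem (i := i) hp)
  have h2 : ψ (act w (simpleEnd i (p.1, p.2, 0))) =
      ψ (act w ((reflCoroot i p).1, (reflCoroot i p).2, 0)) :=
    (hψ.comp_act w).simpleEnd_apply i p
  rw [h2] at hpos
  have h3 := h1 hpos
  -- Only the affine reflection changes the constant: it adds the first coordinate of the coroot,
  -- which is at most 2.
  have h4 : (simpleEnd i (p.1, p.2, 0)).2.2 ≤ 2 := by
    have : ∀ p ∈ coroots, ∀ i : Fin 3, (simpleEnd i (p.1, p.2, 0)).2.2 ≤ 2 := by decide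
    exact this p hp i
  have h5 := act_third_add w (reflCoroot i p).1 (reflCoroot i p).2 (simpleEnd i (p.1, p.2, 0)).2.2
  have h6 : (((reflCoroot i p).1, (reflCoroot i p).2, (simpleEnd i (p.1, p.2, 0)).2.2) :
    ℤ × ℤ × ℤ) = simpleEnd i (p.1, p.2, 0) := rfl
  rw [h6] at h5
  omega

theorem IsRoot.abs_le {f : ℤ × ℤ × ℤ} (hf : IsRoot f) : -5 ≤ f.1 + f.2.1 ∧ f.1 + f.2.1 ≤ 5 :=
  (by decide : ∀ p ∈ coroots, -5 ≤ p.1 + p.2 ∧ p.1 + p.2 ≤ 5) _ hf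

theorem simpleRoot_third (i : Fin 3) : (simpleRoot i).2.2 = 0 ∨ (simpleRoot i).2.2 = 1 := by
  fin_cases i <;> simp [simpleRoot]

/-- Depth 2 suffices: a simple root has constant at most 1, so the constant of its image is at most
−1, and six times this outweighs a linear part of height at most 5. -/
theorem IsDeep.isRightDescent {ψ : ℤ × ℤ × ℤ →ₗ[ℤ] ℤ} (hψ : KillsConst ψ) {w : W} {D : ℤ}
    (h : IsDeep ψ w D) (hD : 2 ≤ D) {i : Fin 3} (hi : 0 < ψ (act w (simpleRoot i))) :
    cs.IsRightDescent w i := by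
  rw [isRightDescent_iff]
  have h1 := h _ (isRoot_simpleRoot i)
  rw [← LinearMap.comp_apply, ← (hψ.comp_act w).apply _ _ (simpleRoot i).2.2] at h1
  have h2 := act_third_add w (simpleRoot i).1 (simpleRoot i).2.1 (simpleRoot i).2.2
  have h3 : (act w ((simpleRoot i).1, (simpleRoot i).2.1, 0)).2.2 ≤ -D := h1 hi
  have h4 := ((isRoot_simpleRoot i).act w).abs_le
  have h5 := simpleRoot_third i
  rw [height_apply]
  change (act w (simpleRoot i)).2.2 = _ at h2
  omega

theorem IsDeep.not_isRightDescent {ψ : ℤ × ℤ × ℤ →ₗ[ℤ] ℤ} (hψ : KillsConst ψ) {w : W} {D : ℤ}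
    (h : IsDeep ψ w D) (hD : 2 ≤ D) {i : Fin 3} (hi : ψ (act w (simpleRoot i)) < 0) :
    ¬ cs.IsRightDescent w i := by
  rw [not_isRightDescent_iff]
  have h1 := h _ (neg_mem_coroots (isRoot_simpleRoot i))
  have hn : (((-((simpleRoot i).1, (simpleRoot i).2.1) : ℤ × ℤ)).1,
      ((-((simpleRoot i).1, (simpleRoot i).2.1) : ℤ × ℤ)).2, (0 : ℤ)) =
      -((simpleRoot i).1, (simpleRoot i).2.1, (0 : ℤ)) := by simp
  rw [hn, map_neg, map_neg, ← LinearMap.comp_apply,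
    ← (hψ.comp_act w).apply _ _ (simpleRoot i).2.2] at h1
  have h2 := act_third_add w (simpleRoot i).1 (simpleRoot i).2.1 (simpleRoot i).2.2
  have h3 := h1 (by rw [LinearMap.comp_apply]; change 0 < -ψ (act w (simpleRoot i)); omega)
  have h4 := ((isRoot_simpleRoot i).act w).abs_le
  have h5 := simpleRoot_third i
  rw [height_apply]
  change (act w (simpleRoot i)).2.2 = _ at h2
  change -(act w ((simpleRoot i).1, (simpleRoot i).2.1, 0)).2.2 ≤ -D at h3
  omega

/-- The functional `φ` is negative on the inversions of the word. -/
def InvNeg : List (Fin 3) → (ℤ × ℤ × ℤ →ₗ[ℤ] ℤ) → Prop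
  | [], _ => True
  | i :: ω, φ => φ (simpleRoot i) < 0 ∧ InvNeg ω (φ ∘ₗ simpleEnd i)

/-- Each letter s turns T̃_w into T̃_{ws}, with an extra ξ T̃_w if s is a descent. In the term
T̃_{ws} both functionals are reflected and the count is unchanged; in ξ T̃_w only φ is reflected and
the count drops, which pays for ξ. Each letter also costs depth 2, hence the factor 2 in the depth
required. -/
theorem isPositive_mul_heckeWord {ψ : ℤ × ℤ × ℤ →ₗ[ℤ] ℤ} (hψ : KillsConst ψ)
    (hr : IsRegular ψ) (ω : List (Fin 3)) {φ : ℤ × ℤ × ℤ →ₗ[ℤ] ℤ} (hφ : KillsConst φ)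
    (hω : InvNeg ω φ) {w : W} (hw : IsDeep ψ w (2 * ω.length)) :
    IsPositive strongExchange (· ≤ signCount φ (ψ ∘ₗ act w)) (heckeTn cs w * heckeWord cs ω) := by
  induction ω generalizing φ w with
  | nil => rw [heckeWord_nil, mul_one]; exact isPositive_heckeTn _ _ _
  | cons i ω ih =>
    obtain ⟨h1, h2⟩ := hω
    rw [List.length_cons] at hw
    have hne := hr.apply_ne_zero hψ ((isRoot_simpleRoot i).act w)
    have hs : ψ ∘ₗ act (w * cs.simple i) = (ψ ∘ₗ act w) ∘ₗ simpleEnd i := by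
      rw [map_mul, act_simple]
      rfl
    have ih1 := ih (hφ.comp_simpleEnd i) h2 (w := w * cs.simple i)
      (by have := hw.mul_simple hψ i; convert this using 1; push_cast; ring)
    rw [hs, signCount_comp_simpleEnd hφ (hψ.comp_act w)] at ih1
    rw [heckeWord_cons, ← mul_assoc]
    rcases hne.lt_or_gt with hlt | hgt
    · rw [heckeTn_mul_simple_of_not (hw.not_isRightDescent hψ (by push_cast; omega) hlt)]
      exact ih1
    · have ih2 := ih (hφ.comp_simpleEnd i) h2 (w := w)
        (fun p hp h => (hw p hp h).trans (by push_cast; omega))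
      have hlt := signCount_comp_simpleEnd_lt hφ (hψ.comp_act w) h1 hgt
      rw [heckeTn_mul_simple_of_isRightDescent
        (hw.isRightDescent hψ (by push_cast; omega) hgt), add_mul, smul_mul_assoc]
      exact ih1.add (ih2.smul.mono fun n hn => by omega)

/-- The inversions of a reduced word. -/
theorem height_of_isReduced {ω₁ ω₂ : List (Fin 3)} {i : Fin 3}
    (h : cs.IsReduced (ω₁ ++ i :: ω₂)) :
    0 < height (act (cs.wordProd ω₁) (simpleRoot i)) ∧
      height (act (cs.wordProd (ω₁ ++ i :: ω₂))⁻¹ (act (cs.wordProd ω₁) (simpleRoot i))) < 0 := by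
  refine ⟨?_, ?_⟩
  · rw [← not_isRightDescent_iff]
    have h1 : cs.IsReduced (ω₁ ++ [i]) := by
      have := h.take (ω₁.length + 1)
      rwa [List.take_append, List.take_of_length_le (by omega), Nat.add_sub_cancel_left,
        List.take_succ_cons, List.take_zero] at this
    have h2 := h1.eq
    have h3 := cs.length_wordProd_le ω₁
    rw [cs.wordProd_append, cs.wordProd_singleton, List.length_append, List.length_singleton] at h2
    rw [cs.not_isRightDescent_iff]
    have := cs.length_mul_simple (cs.wordProd ω₁) i
    omega
  · rw [cs.wordProd_append, cs.wordProd_cons, mul_inv_rev, mul_inv_rev, act_mul_apply,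
      act_inv_apply, cs.inv_simple, act_mul_apply, act_simple, simpleEnd_simpleRoot, map_neg,
      map_neg, neg_lt_zero, ← not_isRightDescent_iff, cs.isRightDescent_inv_iff]
    have h1 : cs.IsReduced (i :: ω₂) := by
      have := h.drop ω₁.length
      rwa [List.drop_left] at this
    exact not_isLeftDescent_of_isReduced h1

/-! ### Functionals adapted to inversion sets, and the degree bound -/

/-- A functional which is negative on the inversions of `y`. -/
def invFunctional (y : W) : ℤ × ℤ × ℤ →ₗ[ℤ] ℤ := height ∘ₗ act y⁻¹ - height

theorem killsConst_invFunctional (y : W) : KillsConst (invFunctional y) := by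
  unfold KillsConst invFunctional
  rw [LinearMap.sub_apply, LinearMap.comp_apply, act_const, sub_self]

/-- An inversion has positive height and its image under y⁻¹ has negative height; the functional is
the second minus the first. -/
theorem invNeg_invFunctional {ω : List (Fin 3)} (h : cs.IsReduced ω) :
    InvNeg ω (invFunctional (cs.wordProd ω)) := by
  suffices H : ∀ ω₂ ω₁, ω₁ ++ ω₂ = ω →
      InvNeg ω₂ (invFunctional (cs.wordProd ω) ∘ₗ act (cs.wordProd ω₁)) by
    have := H ω [] rfl
    rwa [cs.wordProd_nil, map_one] at this
  intro ω₂
  induction ω₂ with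
  | nil => exact fun _ _ => trivial
  | cons i ω₂ ih =>
    intro ω₁ he
    subst he
    obtain ⟨h1, h2⟩ := height_of_isReduced h
    refine ⟨?_, ?_⟩
    · rw [LinearMap.comp_apply, invFunctional, LinearMap.sub_apply, LinearMap.comp_apply]
      omega
    · have := ih (ω₁ ++ [i]) (by simp)
      rwa [cs.wordProd_append ω₁ [i], cs.wordProd_singleton, map_mul, act_simple] at this

/-- A functional which is negative on the inversions of `x` and does not vanish on coroots. -/
def regFunctional (x : W) : ℤ × ℤ × ℤ →ₗ[ℤ] ℤ :=
  7 • (height ∘ₗ act x⁻¹) - 6 • (height + LinearMap.snd ℤ ℤ ℤ ∘ₗ LinearMap.snd ℤ ℤ (ℤ × ℤ))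

theorem regFunctional_apply (x : W) (f : ℤ × ℤ × ℤ) :
    regFunctional x f = 7 * height (act x⁻¹ f) - 6 * (f.1 + f.2.1 + 7 * f.2.2) := by
  simp [regFunctional, height_apply]
  ring

theorem killsConst_regFunctional (x : W) : KillsConst (regFunctional x) := by
  unfold KillsConst
  rw [regFunctional_apply, act_const, height_apply]
  norm_num

/-- Modulo 7 the value at a coroot is the sum of its coordinates, which is nonzero of absolute value
at most 5. The weights 7 · 6 and 6 · 7 of the constant cancel. -/
theorem isRegular_regFunctional (x : W) : IsRegular (regFunctional x) := by
  intro p hp h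
  rw [regFunctional_apply] at h
  have h1 := (by decide : ∀ p ∈ coroots, p.1 + p.2 ≠ 0 ∧ -5 ≤ p.1 + p.2 ∧ p.1 + p.2 ≤ 5) p hp
  dsimp only at h
  omega

theorem regFunctional_neg {x : W} {f : ℤ × ℤ × ℤ} (hf : IsRoot f) (h1 : 0 < height f)
    (h2 : height (act x⁻¹ f) < 0) : regFunctional x f < 0 := by
  rw [regFunctional_apply]
  rw [height_apply] at h1
  have := hf.abs_le
  omega

theorem length_mul_of_height {g : W} {ω : List (Fin 3)}
    (h : ∀ ω₁ i ω₂, ω = ω₁ ++ i :: ω₂ →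
      0 < height (act (g * cs.wordProd ω₁) (simpleRoot i))) :
    cs.length (g * cs.wordProd ω) = cs.length g + ω.length := by
  induction ω using List.reverseRecOn with
  | nil => simp
  | append_singleton ω i ih =>
    have h1 := h ω i [] rfl
    rw [← not_isRightDescent_iff, cs.not_isRightDescent_iff] at h1
    rw [cs.wordProd_append, cs.wordProd_singleton, ← mul_assoc, h1,
      ih (fun ω₁ j ω₂ he => h ω₁ j (ω₂ ++ [i]) (by rw [he]; simp)), List.length_append,
      List.length_singleton, add_assoc]

theorem exists_isDeep (x : W) (D : ℕ) : ∃ g : W,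
    cs.length (g * x) = cs.length g + cs.length x ∧ IsDeep (regFunctional x) (g * x) D := by
  obtain ⟨ω, hω, rfl⟩ := cs.exists_isReduced x
  set x := cs.wordProd ω with hx
  obtain ⟨m, hm⟩ : ∃ m : ℕ, ∀ p ∈ coroots, (act x (p.1, p.2, 0)).2.2 ≤ m := by
    refine ⟨(coroots.sup fun p => (act x (p.1, p.2, 0)).2.2.toNat), fun p hp => ?_⟩
    have := Finset.le_sup (f := fun p : ℤ × ℤ => (act x (p.1, p.2, 0)).2.2.toNat) hp
    omega
  set ψ := regFunctional x with hψ
  set N : ℤ := m + D with hN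
  -- This translation changes the constant of f by −Nψ(f). That is nonnegative on the inversions of
  -- x, so lengths add, and at most −N where ψ is positive, which outweighs the bound m on the
  -- constants and leaves at most −D.
  set ν : ℤ × ℤ := (-N * ψ (1, 0, 0), -N * ψ (0, 1, 0)) with hν
  have hg := isTrans_zpow_mul_zpow ν.1 ν.2
  set g := xα ^ ν.1 * xβ ^ ν.2
  have hν' : ∀ f : ℤ × ℤ × ℤ, (ν.1, ν.2).1 * f.1 + (ν.1, ν.2).2 * f.2.1 = -N * ψ f := by
    intro f
    have : f = f.1 • (1, 0, 0) + f.2.1 • (0, 1, 0) + f.2.2 • (0, 0, 1) := by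
      ext <;> simp
    conv_rhs => rw [this, map_add, map_add, map_smul, map_smul, map_smul,
      killsConst_regFunctional x, smul_zero, add_zero]
    simp only [hν, smul_eq_mul]
    ring
  refine ⟨g, ?_, ?_⟩
  · rw [hω.eq]
    refine length_mul_of_height fun ω₁ i ω₂ he => ?_
    have h0 := hω
    rw [he] at h0
    obtain ⟨h1, h2⟩ := height_of_isReduced h0
    rw [← he] at h2
    rw [act_mul_apply, hg, hν', height_apply]
    have h3 := regFunctional_neg ((isRoot_simpleRoot i).act (cs.wordProd ω₁)) h1 h2
    rw [height_apply] at h1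
    have h4 : 0 ≤ -N * ψ (act (cs.wordProd ω₁) (simpleRoot i)) := by
      rw [neg_mul, ← mul_neg]
      exact mul_nonneg (by omega) (by rw [hψ, hx]; omega)
    dsimp only
    omega
  · intro p hp hpos
    rw [act_mul_apply, hg, (killsConst_regFunctional x).apply,
      ← (killsConst_regFunctional x).apply _ _ (act x (p.1, p.2, 0)).2.2] at hpos
    rw [act_mul_apply, hg, hν']
    have h1 := hm p hp
    have h2 : N ≤ N * ψ (act x (p.1, p.2, 0)) := by
      have : (1 : ℤ) ≤ ψ (act x (p.1, p.2, 0)) := hpos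
      exact le_mul_of_one_le_right (by omega) this
    dsimp only
    rw [neg_mul]
    omega

/-- The structure constants of the standard basis have degree at most `6` in `q^{1/2}`. -/
theorem degLE_repr_heckeTn_mul (x y z : W) :
    DegLE 6 ((heckeBasisN strongExchange).repr (heckeTn cs x * heckeTn cs y) z) := by
  obtain ⟨ω, hω, rfl⟩ := cs.exists_isReduced y
  obtain ⟨g, hg, hd⟩ := exists_isDeep x (2 * ω.length)
  obtain ⟨m, hm⟩ := exists_isPositive_heckeTn_mul strongExchange x (cs.wordProd ω)
  -- It suffices to bound the degree of T̃_{gx} T̃_y, where gx is deep enough for the whole reduced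
  -- word of y.
  refine degLE_of_isPositive_mul (n := 6) (g := g) strongExchange hm ?_ z
  rw [← mul_assoc, heckeTn_mul hg, heckeTn_wordProd hω]
  refine (isPositive_mul_heckeWord (killsConst_regFunctional x) (isRegular_regFunctional x) ω
    (killsConst_invFunctional _) (invNeg_invFunctional hω) (w := g * x)
    (by exact_mod_cast hd)).mono fun n hn => hn.trans (signCount_le _ _)

theorem degLE_repr_mul {a b : HeckeAlgebra cs} {m n : ℤ}
    (ha : ∀ w, DegLE m ((heckeBasisN strongExchange).repr a w))
    (hb : ∀ w, DegLE n ((heckeBasisN strongExchange).repr b w)) (z : W) :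
    DegLE (m + n + 6) ((heckeBasisN strongExchange).repr (a * b) z) := by
  set β := heckeBasisN strongExchange with hβ
  conv => enter [2]; rw [← β.linearCombination_repr a, ← β.linearCombination_repr b,
    Finsupp.linearCombination_apply, Finsupp.linearCombination_apply, Finsupp.sum, Finsupp.sum,
    Finset.sum_mul_sum, map_sum, Finsupp.finsetSum_apply]
  refine DegLE.sum fun u _ => ?_
  rw [map_sum, Finsupp.finsetSum_apply]
  refine DegLE.sum fun w _ => ?_
  rw [smul_mul_smul_comm, map_smul, Finsupp.smul_apply, smul_eq_mul, hβ, heckeBasisN_apply,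
    heckeBasisN_apply]
  exact ((ha u).mul (hb w)).mul (degLE_repr_heckeTn_mul u w z)

end AffineG2

/-! ## The anti-involution `T_w ↦ T_{w⁻¹}` and structure constants -/

namespace CoxeterSystem
open LaurentPolynomial

section

variable {B W : Type*} [Group W] {M : CoxeterMatrix B} {cs : CoxeterSystem M W}

theorem heckeFlip_rel ⦃x y : FreeAlgebra ℤ[T;T⁻¹] W⦄ (h : HeckeRel cs x y) :
    FreeAlgebra.lift ℤ[T;T⁻¹] (fun w => MulOpposite.op (heckeT cs w⁻¹)) x =
      FreeAlgebra.lift ℤ[T;T⁻¹] (fun w => MulOpposite.op (heckeT cs w⁻¹)) y := by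
  induction h with
  | one => rw [FreeAlgebra.lift_ι_apply, map_one, inv_one, heckeT_one, MulOpposite.op_one]
  | quadratic i =>
    rw [map_mul, map_sub, map_add, map_one, map_zero, AlgHom.commutes, FreeAlgebra.lift_ι_apply,
      cs.inv_simple, MulOpposite.algebraMap_apply, ← MulOpposite.op_sub, ← MulOpposite.op_one,
      ← MulOpposite.op_add, ← MulOpposite.op_mul, ← MulOpposite.op_zero]
    congr 1
    have h := heckeT_quadratic cs i
    have c := Algebra.commutes (LaurentPolynomial.T 2 : ℤ[T;T⁻¹]) (heckeT cs (cs.simple i))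
    rw [← h, mul_sub, sub_mul, add_mul, mul_add, mul_add, add_mul, ← c, one_mul, mul_one, one_mul,
      mul_one]
  | mul w u hl =>
    rw [map_mul, FreeAlgebra.lift_ι_apply, FreeAlgebra.lift_ι_apply, FreeAlgebra.lift_ι_apply,
      ← MulOpposite.op_mul, heckeT_mul, mul_inv_rev]
    rw [← mul_inv_rev, cs.length_inv, cs.length_inv, cs.length_inv, hl, add_comm]

variable (cs) in
/-- The anti-involution `T_w ↦ T_{w⁻¹}` of the Hecke algebra, as a map to the opposite algebra. -/
noncomputable def heckeFlipHom :
    HeckeAlgebra cs →ₐ[ℤ[T;T⁻¹]] (HeckeAlgebra cs)ᵐᵒᵖ :=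
  (RingQuot.liftAlgHom ℤ[T;T⁻¹] ⟨FreeAlgebra.lift ℤ[T;T⁻¹]
    (fun w => MulOpposite.op (heckeT cs w⁻¹)), heckeFlip_rel⟩ :
      RingQuot (HeckeRel cs) →ₐ[ℤ[T;T⁻¹]] (HeckeAlgebra cs)ᵐᵒᵖ)

variable (cs) in
/-- The anti-involution `T_w ↦ T_{w⁻¹}` of the Hecke algebra. -/
noncomputable def heckeFlip : HeckeAlgebra cs →ₗ[ℤ[T;T⁻¹]] HeckeAlgebra cs :=
  (MulOpposite.opLinearEquiv ℤ[T;T⁻¹]).symm.toLinearMap ∘ₗ (heckeFlipHom cs).toLinearMap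

theorem heckeFlip_heckeT (w : W) : heckeFlip cs (heckeT cs w) = heckeT cs w⁻¹ :=
  congrArg MulOpposite.unop
    ((RingQuot.liftAlgHom_mkAlgHom_apply ℤ[T;T⁻¹] (FreeAlgebra.lift ℤ[T;T⁻¹]
      (fun w => MulOpposite.op (heckeT cs w⁻¹))) heckeFlip_rel _).trans
        (FreeAlgebra.lift_ι_apply _ _))

theorem heckeFlip_mul (x y : HeckeAlgebra cs) :
    heckeFlip cs (x * y) = heckeFlip cs y * heckeFlip cs x :=
  congrArg MulOpposite.unop (map_mul (heckeFlipHom cs) x y)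

theorem heckeFlip_one : heckeFlip cs 1 = 1 :=
  congrArg MulOpposite.unop (map_one (heckeFlipHom cs))

theorem heckeFlip_heckeTn (w : W) : heckeFlip cs (heckeTn cs w) = heckeTn cs w⁻¹ := by
  rw [heckeTn, heckeTn, map_smul, heckeFlip_heckeT, cs.length_inv]

theorem heckeFlip_klSimple (i : B) : heckeFlip cs (klSimple cs i) = klSimple cs i := by
  rw [klSimple, map_add, map_smul, heckeFlip_heckeTn, heckeFlip_one, cs.inv_simple]

theorem heckeBar_heckeFlip (x : HeckeAlgebra cs) :
    heckeBar cs (heckeFlip cs x) = heckeFlip cs (heckeBar cs x) := by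
  have hx : x ∈ Submodule.span ℤ[T;T⁻¹] (Set.range (heckeT cs)) := by
    rw [span_heckeT]; trivial
  induction hx using Submodule.span_induction with
  | mem x hx =>
    obtain ⟨w, rfl⟩ := hx
    rw [heckeFlip_heckeT, heckeBar_heckeT, heckeBar_heckeT, inv_inv]
    obtain ⟨a, ha⟩ := isUnit_heckeT cs w
    obtain ⟨b, hb⟩ := isUnit_heckeT cs w⁻¹
    rw [← ha, ← hb, Ring.inverse_unit, Ring.inverse_unit]
    have h1 : heckeFlip cs ↑b⁻¹ * (a : HeckeAlgebra cs) = 1 ∧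
        (a : HeckeAlgebra cs) * heckeFlip cs ↑b⁻¹ = 1 := by
      have hab : (a : HeckeAlgebra cs) = heckeFlip cs b := by
        rw [ha, hb, heckeFlip_heckeT, inv_inv]
      rw [hab, ← heckeFlip_mul, ← heckeFlip_mul, b.mul_inv, b.inv_mul, heckeFlip_one]
      exact ⟨rfl, rfl⟩
    exact (a.inv_eq_of_mul_eq_one_right h1.2)
  | zero => simp
  | add x y _ _ hx hy => rw [map_add, map_add, map_add, map_add, hx, hy]
  | smul c x _ hx => rw [map_smul, heckeBar_smul, heckeBar_smul, map_smul, hx]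

theorem repr_heckeFlip (hE : cs.StrongExchange) (x : HeckeAlgebra cs) (w : W) :
    (heckeBasisN hE).repr (heckeFlip cs x) w = (heckeBasisN hE).repr x w⁻¹ := by
  classical
  have h : Finsupp.lapply w ∘ₗ (heckeBasisN hE).repr.toLinearMap ∘ₗ heckeFlip cs =
      Finsupp.lapply w⁻¹ ∘ₗ (heckeBasisN hE).repr.toLinearMap := by
    refine (heckeBasisN hE).ext fun u => ?_
    simp only [LinearMap.comp_apply, heckeBasisN_apply, heckeFlip_heckeTn, Finsupp.lapply_apply,
      LinearEquiv.coe_coe, repr_heckeTn]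
    simp only [inv_eq_iff_eq_inv]
  exact LinearMap.congr_fun h x

end

/-! ### Comparing coordinates in the two bases -/

section KLBasis

variable {B W : Type*} [Group W] {M : CoxeterMatrix B} {cs : CoxeterSystem M W}
  {C : Module.Basis W ℤ[T;T⁻¹] (HeckeAlgebra cs)}

theorem IsKLBasis.isKLElement (h : cs.IsKLBasis C) (w : W) : IsKLElement cs w (C w) := h w

/-- The anti-involution commutes with the bar involution and permutes the T̃_w, so uniqueness
applies. -/
theorem IsKLBasis.heckeFlip_apply (h : cs.IsKLBasis C) (hE : cs.StrongExchange) (w : W) :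
    heckeFlip cs (C w) = C w⁻¹ := by
  refine (h.isKLElement w⁻¹).eq_of_heckeBar_eq hE ?_ ?_ fun u hu => ?_
  · rw [heckeBar_heckeFlip, (h w).1]
  · rw [repr_heckeFlip, inv_inv, (h.isKLElement w).repr_self hE]
  · rw [repr_heckeFlip]
    exact (h.isKLElement w).degLE hE fun h' => hu (by rw [← h', inv_inv])

theorem repr_eq_sum (hE : cs.StrongExchange) (x : HeckeAlgebra cs) (w : W) :
    (heckeBasisN hE).repr x w =
      ∑ z ∈ (C.repr x).support, C.repr x z * (heckeBasisN hE).repr (C z) w := by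
  conv_lhs => rw [← C.linearCombination_repr x, Finsupp.linearCombination_apply, Finsupp.sum,
    map_sum, Finsupp.finsetSum_apply]
  refine Finset.sum_congr rfl fun z _ => ?_
  rw [map_smul, Finsupp.smul_apply, smul_eq_mul]

/-- Off-diagonal coordinates of the C_z have degree at most −1, so they cannot reach the top degree
n. -/
theorem IsKLBasis.coeff_repr (h : cs.IsKLBasis C) (hE : cs.StrongExchange) {x : HeckeAlgebra cs}
    {n : ℤ} (hx : ∀ z, DegLE n (C.repr x z)) (w : W) :
    ((heckeBasisN hE).repr x w).coeff n = (C.repr x w).coeff n := by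
  classical
  rw [repr_eq_sum (C := C) hE, AddMonoidAlgebra.coeff_sum, Finsupp.finsetSum_apply]
  rw [Finset.sum_eq_single w]
  · rw [(h.isKLElement w).repr_self hE, mul_one]
  · intro z _ hz
    exact (hx z).mul ((h.isKLElement z).degLE hE hz.symm) _ (by omega)
  · intro hw
    rw [Finsupp.notMem_support_iff.mp hw, zero_mul]
    rfl

/-- Start from any uniform bound n + N and lower it by one at a time: while it exceeds n, the top
coefficients agree with those in the standard basis, which vanish. -/
theorem IsKLBasis.degLE_repr (h : cs.IsKLBasis C) (hE : cs.StrongExchange) {x : HeckeAlgebra cs}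
    {n : ℤ} (hx : ∀ w, DegLE n ((heckeBasisN hE).repr x w)) (z : W) : DegLE n (C.repr x z) := by
  classical
  obtain ⟨N, hN⟩ : ∃ N : ℕ, ∀ z, DegLE (n + N) (C.repr x z) := by
    have h1 : ∀ a : ℤ[T;T⁻¹], ∃ N : ℕ, DegLE (n + N) a := by
      intro a
      refine ⟨a.coeff.support.sup fun m => (m - n).toNat, fun m hm => ?_⟩
      by_contra hc
      have := Finset.le_sup (f := fun m : ℤ => (m - n).toNat) (Finsupp.mem_support_iff.mpr hc)
      omega
    choose N hN using fun z => h1 (C.repr x z)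
    refine ⟨(C.repr x).support.sup N, fun z => ?_⟩
    by_cases hz : z ∈ (C.repr x).support
    · exact (hN z).mono (by have := Finset.le_sup (f := N) hz; omega)
    · rw [Finsupp.notMem_support_iff.mp hz]
      exact degLE_zero _
  induction N generalizing z with
  | zero => simpa using hN z
  | succ N ih =>
    refine ih z fun w m hm => ?_
    by_cases hm' : m = n + (N + 1 : ℕ)
    · rw [hm', ← h.coeff_repr hE hN]
      exact hx w _ (by omega)
    · exact hN w m (by push_cast at hm' ⊢; omega)

/-- In degree n − 1 another z interferes only if its coefficient reaches degree n and T̃_w occurs in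
C_z; the hypothesis rules out both happening together. -/
theorem IsKLBasis.coeff_repr_sub_one (h : cs.IsKLBasis C) (hE : cs.StrongExchange)
    {x : HeckeAlgebra cs} {n : ℤ} (hx : ∀ z, DegLE n (C.repr x z)) {w : W}
    (hw : ∀ z, z ≠ w → (C.repr x z).coeff n = 0 ∨ (heckeBasisN hE).repr (C z) w = 0) :
    ((heckeBasisN hE).repr x w).coeff (n - 1) = (C.repr x w).coeff (n - 1) := by
  classical
  rw [repr_eq_sum (C := C) hE, AddMonoidAlgebra.coeff_sum, Finsupp.finsetSum_apply]
  rw [Finset.sum_eq_single w]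
  · rw [(h.isKLElement w).repr_self hE, mul_one]
  · intro z _ hz
    rcases hw z hz with h0 | h0
    · have h1 : DegLE (n - 1) (C.repr x z) := fun m hm => by
        by_cases hmn : m = n
        · rw [hmn, h0]
        · exact hx z m (by omega)
      exact h1.mul ((h.isKLElement z).degLE hE hz.symm) _ (by omega)
    · rw [h0, mul_zero]
      rfl
  · intro hw
    rw [Finsupp.notMem_support_iff.mp hw, zero_mul]
    rfl

end KLBasis

end CoxeterSystem

/-! ## Cosets of the finite Weyl group -/

namespace AffineG2
open CoxeterSystem LaurentPolynomial

/-- `w` is of minimal length in its coset `w W₀`. -/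
def IsMinimal (w : W) : Prop := ¬ cs.IsRightDescent w 1 ∧ ¬ cs.IsRightDescent w 2

theorem isMinimal_one : IsMinimal 1 := by
  refine ⟨?_, ?_⟩ <;> rw [not_isRightDescent_iff] <;> simp [height_apply, simpleRoot]

theorem IsMinimal.height_pos {w : W} (h : IsMinimal w) {f : ℤ × ℤ × ℤ}
    (hf : f.2.2 = 0 ∧ 0 ≤ f.1 ∧ 0 ≤ f.2.1 ∧ 0 < f.1 + f.2.1) :
    f.1 + f.2.1 ≤ height (act w f) := by
  obtain ⟨a, b, k⟩ := f
  obtain ⟨rfl, ha, hb, -⟩ : k = 0 ∧ 0 ≤ a ∧ 0 ≤ b ∧ 0 < a + b := hf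
  have h1 := (not_isRightDescent_iff w 1).mp h.1
  have h2 := (not_isRightDescent_iff w 2).mp h.2
  have : ((a, b, 0) : ℤ × ℤ × ℤ) = a • simpleRoot 1 + b • simpleRoot 2 := by simp [simpleRoot]
  rw [this, map_add, map_smul, map_smul, map_add, map_smul, map_smul, smul_eq_mul, smul_eq_mul]
  rw [← this]
  dsimp only
  nlinarith

theorem finitePositive_prefix : ∀ ω ∈ w₀Words, ∀ k < ω.length,
    ((ω.take k).foldr (fun i g => simpleEnd i g) (simpleRoot (ω.getD k 0))).2.2 = 0 ∧
    0 ≤ ((ω.take k).foldr (fun i g => simpleEnd i g) (simpleRoot (ω.getD k 0))).1 ∧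
    0 ≤ ((ω.take k).foldr (fun i g => simpleEnd i g) (simpleRoot (ω.getD k 0))).2.1 ∧
    0 < ((ω.take k).foldr (fun i g => simpleEnd i g) (simpleRoot (ω.getD k 0))).1 +
      ((ω.take k).foldr (fun i g => simpleEnd i g) (simpleRoot (ω.getD k 0))).2.1 := by
  decide

theorem IsMinimal.length_mul {w : W} (h : IsMinimal w) {ω : List (Fin 3)} (hω : ω ∈ w₀Words) :
    cs.length (w * cs.wordProd ω) = cs.length w + ω.length := by
  refine length_mul_of_height fun ω₁ i ω₂ he => ?_
  have h1 := finitePositive_prefix ω hω ω₁.length (by rw [he]; simp)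
  have h2 : ω.take ω₁.length = ω₁ := by rw [he, List.take_left]
  have h3 : ω.getD ω₁.length 0 = i := by rw [he]; simp
  rw [h2, h3] at h1
  rw [act_mul_apply, act_wordProd]
  have := h.height_pos h1
  omega

theorem length_wordProd {ω : List (Fin 3)} (hω : ω ∈ w₀Words) :
    cs.length (cs.wordProd ω) = ω.length := by
  have := isMinimal_one.length_mul hω
  rwa [one_mul, cs.length_one, zero_add] at this

theorem isReduced_of_mem {ω : List (Fin 3)} (hω : ω ∈ w₀Words) : cs.IsReduced ω :=
  length_wordProd hω

theorem simple_mem_W₀ {i : Fin 3} (hi : i ≠ 0) : cs.simple i ∈ W₀ := by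
  fin_cases i
  · exact absurd rfl hi
  · exact s_mem_W₀
  · exact t_mem_W₀

theorem wordProd_mem_W₀ {ω : List (Fin 3)} (hω : 0 ∉ ω) : cs.wordProd ω ∈ W₀ := by
  induction ω with
  | nil => rw [cs.wordProd_nil]; exact W₀.one_mem
  | cons i ω ih =>
    rw [List.mem_cons, not_or] at hω
    rw [cs.wordProd_cons]
    exact W₀.mul_mem (simple_mem_W₀ (Ne.symm hω.1)) (ih hω.2)

theorem zero_notMem_of_mem {ω : List (Fin 3)} (hω : ω ∈ w₀Words) : 0 ∉ ω :=
  (by decide : ∀ ω ∈ w₀Words, (0 : Fin 3) ∉ ω) ω hω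

/-- A nonempty reduced word of u would make its last letter a right descent of wu, since lengths add
in the coset of a minimal element. -/
theorem IsMinimal.eq_one {w u : W} (h : IsMinimal w) (hu : u ∈ W₀) (h' : IsMinimal (w * u)) :
    u = 1 := by
  obtain ⟨ω, hω, rfl⟩ := exists_w₀Words hu
  rcases List.eq_nil_or_concat ω with rfl | ⟨ω', i, he⟩
  · exact cs.wordProd_nil
  rw [List.concat_eq_append] at he
  subst he
  exfalso
  have hω' : ω' ∈ w₀Words := by
    have := (by decide : ∀ ω ∈ w₀Words, ω.dropLast ∈ w₀Words) _ hω
    simpa using this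
  have h1 := h.length_mul hω
  have h2 := h.length_mul hω'
  have h3 : w * cs.wordProd (ω' ++ [i]) * cs.simple i = w * cs.wordProd ω' := by
    rw [cs.wordProd_append, cs.wordProd_singleton, mul_assoc, mul_assoc,
      cs.simple_mul_simple_self, mul_one]
  have h4 : cs.IsRightDescent (w * cs.wordProd (ω' ++ [i])) i := by
    unfold CoxeterSystem.IsRightDescent
    rw [h3, h1, h2]
    simp
  have h0 : i ≠ 0 := by
    rintro rfl
    exact zero_notMem_of_mem hω (by simp)
  have hi : i = 1 ∨ i = 2 := by omega
  rcases hi with rfl | rfl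
  · exact h'.1 h4
  · exact h'.2 h4

theorem act_third_of_mem {u : W} (hu : u ∈ W₀) (f : ℤ × ℤ × ℤ) : (act u f).2.2 = f.2.2 := by
  obtain ⟨ω, hω, rfl⟩ := exists_w₀Words hu
  have h0 := zero_notMem_of_mem hω
  clear hω hu
  rw [act_wordProd]
  induction ω with
  | nil => rfl
  | cons i ω ih =>
    rw [List.mem_cons, not_or] at h0
    rw [List.foldr_cons]
    have hi : i = 1 ∨ i = 2 := by have := Ne.symm h0.1; omega
    rcases hi with rfl | rfl
    · exact ih h0.2
    · exact ih h0.2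

/-! ### Cosets of W₀ as lattice points -/

/-- The point of the weight lattice corresponding to the coset `w W₀`. -/
def pt (w : W) : ℤ × ℤ := ((act w⁻¹ (1, 0, 0)).2.2, (act w⁻¹ (0, 1, 0)).2.2)

theorem act_inv_third (w : W) (f : ℤ × ℤ × ℤ) :
    (act w⁻¹ f).2.2 = f.1 * (pt w).1 + f.2.1 * (pt w).2 + f.2.2 := by
  obtain ⟨a, b, k⟩ := f
  have : ((a, b, k) : ℤ × ℤ × ℤ) = a • (1, 0, 0) + b • (0, 1, 0) + (0, 0, k) := by simp
  rw [this, map_add, map_add, map_smul, map_smul, act_const]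
  simp [pt]

theorem pt_mul_of_mem (w : W) {u : W} (hu : u ∈ W₀) : pt (w * u) = pt w := by
  simp only [pt, mul_inv_rev, act_mul_apply, act_third_of_mem (W₀.inv_mem hu)]

/-- Because of this sign, dominant weights correspond to points with nonpositive coordinates. -/
theorem IsTrans.pt_eq {w : W} {ν : ℤ × ℤ} (h : IsTrans w ν) : pt w = -ν := by
  have h' := h.inv
  simp only [pt, h' _]
  ext <;> simp

theorem mem_W₀_of_pt_eq {w w' : W} (h : pt w = pt w') : w⁻¹ * w' ∈ W₀ := by
  obtain ⟨a, b, u, hu, rfl⟩ := exists_eq_translation_mul w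
  obtain ⟨a', b', u', hu', rfl⟩ := exists_eq_translation_mul w'
  rw [pt_mul_of_mem _ hu, pt_mul_of_mem _ hu', (isTrans_zpow_mul_zpow a b).pt_eq,
    (isTrans_zpow_mul_zpow a' b').pt_eq, neg_inj, Prod.mk.injEq] at h
  obtain ⟨rfl, rfl⟩ := h
  rw [mul_inv_rev, mul_assoc, inv_mul_cancel_left]
  exact W₀.mul_mem (W₀.inv_mem hu) hu'

theorem exists_isMinimal (p : ℤ × ℤ) : ∃ w, pt w = p ∧ IsMinimal w := by
  have hne : ∃ w, pt w = p :=
    ⟨xα ^ (-p.1) * xβ ^ (-p.2), by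
      rw [(isTrans_zpow_mul_zpow _ _).pt_eq]; ext <;> simp⟩
  obtain ⟨w, hw, hmin⟩ := (measure cs.length).wf.has_min {w | pt w = p} hne
  refine ⟨w, hw, fun h => ?_, fun h => ?_⟩
  · exact hmin _ ((pt_mul_of_mem w s_mem_W₀).trans hw) h
  · exact hmin _ ((pt_mul_of_mem w t_mem_W₀).trans hw) h

/-- The element of minimal length in the coset of `W₀` corresponding to `p`. -/
noncomputable def minRep (p : ℤ × ℤ) : W := (exists_isMinimal p).choose

theorem pt_minRep (p : ℤ × ℤ) : pt (minRep p) = p := (exists_isMinimal p).choose_spec.1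

theorem isMinimal_minRep (p : ℤ × ℤ) : IsMinimal (minRep p) := (exists_isMinimal p).choose_spec.2

theorem IsMinimal.eq_minRep {w : W} (h : IsMinimal w) : w = minRep (pt w) := by
  have h1 := mem_W₀_of_pt_eq (w := minRep (pt w)) (w' := w) (pt_minRep _)
  have h2 := (isMinimal_minRep (pt w)).eq_one h1 (by rwa [mul_inv_cancel_left])
  rwa [inv_mul_eq_one, eq_comm] at h2

theorem minRep_zero : minRep (0, 0) = 1 := by
  have := isMinimal_one.eq_minRep
  rw [show pt 1 = (0, 0) from IsTrans.one.pt_eq] at this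
  exact this.symm

/-- The action of the simple reflections on the weight lattice. -/
def reflPt (i : Fin 3) (p : ℤ × ℤ) : ℤ × ℤ :=
  match i with
  | 0 => (1 - p.1 - 3 * p.2, p.2)
  | 1 => (-p.1, p.1 + p.2)
  | 2 => (p.1 + 3 * p.2, -p.2)

/-- The value of the simple affine root at a point. -/
def valPt (i : Fin 3) (p : ℤ × ℤ) : ℤ :=
  match i with
  | 0 => 1 - 2 * p.1 - 3 * p.2
  | 1 => p.1
  | 2 => p.2

theorem pt_simple_mul (i : Fin 3) (w : W) : pt (cs.simple i * w) = reflPt i (pt w) := by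
  have h : ∀ f, act (cs.simple i * w)⁻¹ f = act w⁻¹ (simpleEnd i f) := fun f => by
    rw [mul_inv_rev, cs.inv_simple, act_mul_apply, act_simple]
  rw [pt, h, h, act_inv_third, act_inv_third]
  fin_cases i <;>
    refine Prod.ext ?_ ?_ <;>
    simp [simpleEnd_zero, simpleEnd_one, simpleEnd_two, reflPt] <;> ring

theorem act_inv_simpleRoot_third (w : W) (i : Fin 3) :
    (act w⁻¹ (simpleRoot i)).2.2 = valPt i (pt w) := by
  rw [act_inv_third]
  fin_cases i <;> simp [simpleRoot, valPt] <;> ring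

theorem isLeftDescent_of_valPt_neg {w : W} {i : Fin 3} (h : valPt i (pt w) < 0) :
    cs.IsLeftDescent w i := by
  rw [← cs.isRightDescent_inv_iff, isRightDescent_iff, height_apply]
  rw [← act_inv_simpleRoot_third] at h
  have := ((isRoot_simpleRoot i).act w⁻¹).abs_le
  omega

theorem not_isLeftDescent_of_valPt_pos {w : W} {i : Fin 3} (h : 0 < valPt i (pt w)) :
    ¬ cs.IsLeftDescent w i := by
  rw [← cs.isRightDescent_inv_iff, not_isRightDescent_iff, height_apply]
  rw [← act_inv_simpleRoot_third] at h
  have := ((isRoot_simpleRoot i).act w⁻¹).abs_le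
  omega

/-- If s_i created a finite right descent j, it would make the positive root w α_j negative, so w
α_j = α_i. Then w⁻¹ α_i is a finite root, and the point lies on the wall of i. -/
theorem IsMinimal.simple_mul {w : W} (h : IsMinimal w) {i : Fin 3} (hi : valPt i (pt w) ≠ 0) :
    IsMinimal (cs.simple i * w) := by
  have key : ∀ j : Fin 3, (simpleRoot j).2.2 = 0 → ¬ cs.IsRightDescent w j →
      ¬ cs.IsRightDescent (cs.simple i * w) j := by
    intro j hj0 hj hc
    rw [not_isRightDescent_iff] at hj
    rw [isRightDescent_iff, act_mul_apply, act_simple] at hc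
    have h1 := eq_simpleRoot ((isRoot_simpleRoot j).act w) hj hc
    apply hi
    rw [← act_inv_simpleRoot_third, ← h1, act_inv_apply, hj0]
  exact ⟨key 1 rfl h.1, key 2 rfl h.2⟩

theorem simple_mul_minRep {p : ℤ × ℤ} {i : Fin 3} (hi : valPt i p ≠ 0) :
    cs.simple i * minRep p = minRep (reflPt i p) := by
  have h := ((isMinimal_minRep p).simple_mul (i := i) (by rwa [pt_minRep])).eq_minRep
  rwa [pt_simple_mul, pt_minRep] at h

/-- The signs of the coordinates of the finite positive coroots. -/
theorem coroot_sign {a b : ℤ} (h : (a, b) ∈ coroots) :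
    (0 ≤ a ∧ 0 ≤ b ∧ 0 < a + b) ∨ (0 ≤ -a ∧ 0 ≤ -b ∧ 0 < -a + -b) :=
  (by decide : ∀ p ∈ coroots, (0 ≤ p.1 ∧ 0 ≤ p.2 ∧ 0 < p.1 + p.2) ∨
    (0 ≤ -p.1 ∧ 0 ≤ -p.2 ∧ 0 < -p.1 + -p.2)) _ h

theorem height_simpleRoot (i : Fin 3) : height (simpleRoot i) = 1 := by
  fin_cases i <;> simp [height_apply, simpleRoot]

/-- On the wall w⁻¹ α_i is a finite root. A minimal element does not lower the height of a finite
positive root and α_i has height 1, so w⁻¹ α_i is a simple root α_j, and s_i passes through w as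
s_j. -/
theorem IsMinimal.exists_simple_mul_eq {w : W} (h : IsMinimal w) {i : Fin 3}
    (hi : valPt i (pt w) = 0) :
    ∃ j : Fin 3, j ≠ 0 ∧ cs.simple i * w = w * cs.simple j ∧ ¬ cs.IsLeftDescent w i ∧
      ¬ cs.IsRightDescent w j := by
  have hr := (isRoot_simpleRoot i).act w⁻¹
  have h3 := act_inv_simpleRoot_third w i
  rw [hi] at h3
  have hf : act w (act w⁻¹ (simpleRoot i)) = simpleRoot i := act_apply_inv w _
  have hld : 0 < height (act w⁻¹ (simpleRoot i)) → ¬ cs.IsLeftDescent w i := by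
    rw [← cs.isRightDescent_inv_iff, not_isRightDescent_iff]
    exact id
  generalize act w⁻¹ (simpleRoot i) = f at hr h3 hf hld
  obtain ⟨a, b, k⟩ := f
  obtain rfl : k = 0 := h3
  have h1 := height_simpleRoot i
  rcases coroot_sign (a := a) (b := b) hr with hs | hs
  · have h2 := h.height_pos (f := (a, b, 0)) ⟨rfl, hs⟩
    rw [hf, h1] at h2
    have hab : (a = 1 ∧ b = 0) ∨ (a = 0 ∧ b = 1) := by dsimp only at h2; omega
    have hd := hld (by rw [height_apply]; dsimp only; omega)
    rcases hab with ⟨rfl, rfl⟩ | ⟨rfl, rfl⟩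
    · refine ⟨1, by decide, ?_, hd, h.1⟩
      rw [← conj_simple_eq (w := w) (i := 1) hf, inv_mul_cancel_right]
    · refine ⟨2, by decide, ?_, hd, h.2⟩
      rw [← conj_simple_eq (w := w) (i := 2) hf, inv_mul_cancel_right]
  · have h2 := h.height_pos (f := (-a, -b, 0)) ⟨rfl, hs⟩
    have : ((-a, -b, 0) : ℤ × ℤ × ℤ) = -(a, b, 0) := by simp
    rw [this, map_neg, hf, map_neg, h1] at h2
    have h4 : (-(a, b, 0) : ℤ × ℤ × ℤ).1 + (-(a, b, 0) : ℤ × ℤ × ℤ).2.1 = -a + -b := rfl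
    omega

/-! ### The Kazhdan–Lusztig element of the longest element of `W₀` -/

/-- A reduced word of `w₀`. -/
def w₀Word : List (Fin 3) := [1, 2, 1, 2, 1, 2]

theorem w₀Word_mem : w₀Word ∈ w₀Words := by decide

theorem wordProd_w₀Word : cs.wordProd w₀Word = w₀ := by
  simp [w₀Word, w₀, cs.wordProd_cons, s_eq, t_eq, mul_assoc]

theorem wordProd_w₀Word' : cs.wordProd [2, 1, 2, 1, 2, 1] = w₀ := by
  have := braid_st
  simp only [s_eq, t_eq] at this
  simp [w₀, cs.wordProd_cons, s_eq, t_eq, mul_assoc, this]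

theorem w₀_mem : w₀ ∈ W₀ := by
  rw [← wordProd_w₀Word]
  exact wordProd_mem_W₀ (zero_notMem_of_mem w₀Word_mem)

theorem length_w₀ : cs.length w₀ = 6 := by
  rw [← wordProd_w₀Word, length_wordProd w₀Word_mem]
  rfl

theorem wordProd_injOn : ∀ ω ∈ w₀Words, ∀ ω' ∈ w₀Words,
    cs.wordProd ω = cs.wordProd ω' → ω = ω' := by
  intro ω hω ω' hω' h
  -- The functional (3, 5, 0) has trivial stabiliser in W₀.
  have h1 := congrArg (fun w => act w (3, 5, 0)) h
  simp only [act_wordProd] at h1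
  exact (by decide : ∀ ω ∈ w₀Words, ∀ ω' ∈ w₀Words,
    ω.foldr (fun i g => simpleEnd i g) ((3, 5, 0) : ℤ × ℤ × ℤ) =
      ω'.foldr (fun i g => simpleEnd i g) (3, 5, 0) → ω = ω') ω hω ω' hω' h1

theorem eq_w₀Word {ω : List (Fin 3)} (hω : ω ∈ w₀Words) (h : 6 ≤ ω.length) : ω = w₀Word :=
  (by decide : ∀ ω ∈ w₀Words, 6 ≤ ω.length → ω = w₀Word) ω hω h

theorem mem_W₀_of_bruhatLE {u w : W} (h : cs.BruhatLE u w) (hw : w ∈ W₀) : u ∈ W₀ := by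
  induction h using Relation.ReflTransGen.head_induction_on with
  | refl => exact hw
  | head h' _ ih =>
    obtain ⟨t, ht, rfl, hlt⟩ := h'
    obtain ⟨ω, hω, h1⟩ := exists_w₀Words ih
    have h0 := zero_notMem_of_mem hω
    have hh := strongExchange ω t ht
    rw [← h1, mul_assoc, ht.mul_self, mul_one] at hh
    obtain ⟨j, _, hj⟩ := hh hlt
    rw [hj]
    exact wordProd_mem_W₀ fun h => h0 (List.mem_of_mem_eraseIdx h)

section

variable {C : Module.Basis W ℤ[T;T⁻¹] (HeckeAlgebra cs)}

theorem isRightDescent_mul_w₀ {w : W} (h : IsMinimal w) {i : Fin 3} (hi : i ≠ 0) :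
    cs.IsRightDescent (w * w₀) i := by
  have hi : i = 1 ∨ i = 2 := by omega
  have h0 := h.length_mul w₀Word_mem
  rw [wordProd_w₀Word] at h0
  rcases hi with rfl | rfl
  · have h1 := h.length_mul (ω := [2, 1, 2, 1, 2]) (by decide)
    have h2 : w * w₀ * cs.simple 1 = w * cs.wordProd [2, 1, 2, 1, 2] := by
      rw [← wordProd_w₀Word', show ([2, 1, 2, 1, 2, 1] : List (Fin 3)) = [2, 1, 2, 1, 2] ++ [1]
        from rfl, cs.wordProd_append, cs.wordProd_singleton, mul_assoc, mul_assoc,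
        cs.simple_mul_simple_self, mul_one]
    unfold CoxeterSystem.IsRightDescent
    rw [h2, h0, h1]
    simp [w₀Word]
  · have h1 := h.length_mul (ω := [1, 2, 1, 2, 1]) (by decide)
    have h2 : w * w₀ * cs.simple 2 = w * cs.wordProd [1, 2, 1, 2, 1] := by
      rw [← wordProd_w₀Word, show w₀Word = [1, 2, 1, 2, 1] ++ [2]
        from rfl, cs.wordProd_append, cs.wordProd_singleton, mul_assoc, mul_assoc,
        cs.simple_mul_simple_self, mul_one]
    unfold CoxeterSystem.IsRightDescent
    rw [h2, h0, h1]
    simp [w₀Word]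

theorem mul_klSimple_of_isRightDescent (hC : cs.IsKLBasis C) {w : W} {i : Fin 3}
    (hi : cs.IsRightDescent w i) : C w * klSimple cs i = (T 1 + T (-1) : ℤ[T;T⁻¹]) • C w := by
  rw [klSimple, mul_add, (hC.isKLElement w).mul_heckeTn_simple strongExchange hi, mul_smul_comm,
    mul_one, add_smul]

/-- For finite s, C_{w₀} C_s = (v + v⁻¹) C_{w₀}. Comparing coordinates at u < us shows that the
coordinate at u is v⁻¹ times the one at us, and one descends from w₀ along both of its reduced
words. -/
theorem repr_w₀ (hC : cs.IsKLBasis C) {ω : List (Fin 3)} (hω : ω ∈ w₀Words) :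
    (heckeBasisN strongExchange).repr (C w₀) (cs.wordProd ω) = T ((ω.length : ℤ) - 6) := by
  have step : ∀ (ω : List (Fin 3)) (i : Fin 3), i ≠ 0 →
      cs.length (cs.wordProd (ω ++ [i])) = ω.length + 1 → ω ∈ w₀Words →
      (heckeBasisN strongExchange).repr (C w₀) (cs.wordProd (ω ++ [i])) =
        T (((ω ++ [i]).length : ℤ) - 6) →
      (heckeBasisN strongExchange).repr (C w₀) (cs.wordProd ω) = T ((ω.length : ℤ) - 6) := by
    intro ω i hi h1 h2 h3
    have hd : cs.IsRightDescent w₀ i := by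
      have := isRightDescent_mul_w₀ isMinimal_one hi
      rwa [one_mul] at this
    have hnd : ¬ cs.IsRightDescent (cs.wordProd ω) i := by
      rw [cs.not_isRightDescent_iff, ← cs.wordProd_singleton, ← cs.wordProd_append,
        h1, length_wordProd h2]
    have h4 := repr_mul_klSimple strongExchange (C w₀) i (cs.wordProd ω)
    rw [mul_klSimple_of_isRightDescent hC hd, if_neg hnd, ← cs.wordProd_singleton,
      ← cs.wordProd_append, h3, map_smul, Finsupp.smul_apply, smul_eq_mul, add_mul,
      add_left_inj, List.length_append, List.length_singleton] at h4
    have h5 := congrArg (fun a : ℤ[T;T⁻¹] => T (-1) * a) h4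
    rw [← mul_assoc, ← T_add, ← T_add, neg_add_cancel, T_zero, one_mul] at h5
    rw [h5]
    congr 1
    push_cast
    ring
  have e6 : (heckeBasisN strongExchange).repr (C w₀) w₀ = T 0 := by
    rw [(hC.isKLElement w₀).repr_self strongExchange, T_zero]
  have a6 : (heckeBasisN strongExchange).repr (C w₀) (cs.wordProd [1, 2, 1, 2, 1, 2]) = T 0 := by
    rw [show ([1, 2, 1, 2, 1, 2] : List (Fin 3)) = w₀Word from rfl, wordProd_w₀Word, e6]
  have a5 := step [1, 2, 1, 2, 1] 2 (by decide) (length_wordProd (by decide)) (by decide) a6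
  have a4 := step [1, 2, 1, 2] 1 (by decide) (length_wordProd (by decide)) (by decide) a5
  have a3 := step [1, 2, 1] 2 (by decide) (length_wordProd (by decide)) (by decide) a4
  have a2 := step [1, 2] 1 (by decide) (length_wordProd (by decide)) (by decide) a3
  have a1 := step [1] 2 (by decide) (length_wordProd (by decide)) (by decide) a2
  have a0 := step [] 1 (by decide) (length_wordProd (by decide)) (by decide) a1
  have b6 : (heckeBasisN strongExchange).repr (C w₀) (cs.wordProd [2, 1, 2, 1, 2, 1]) = T 0 := by
    rw [wordProd_w₀Word', e6]
  have b5 := step [2, 1, 2, 1, 2] 1 (by decide)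
    (by rw [List.cons_append]; exact (congrArg cs.length wordProd_w₀Word').trans length_w₀)
    (by decide) b6
  have b4 := step [2, 1, 2, 1] 2 (by decide) (length_wordProd (by decide)) (by decide) b5
  have b3 := step [2, 1, 2] 1 (by decide) (length_wordProd (by decide)) (by decide) b4
  have b2 := step [2, 1] 2 (by decide) (length_wordProd (by decide)) (by decide) b3
  have b1 := step [2] 1 (by decide) (length_wordProd (by decide)) (by decide) b2
  simp only [w₀Words, List.mem_cons, List.not_mem_nil, or_false] at hω
  rcases hω with rfl | rfl | rfl | rfl | rfl | rfl | rfl | rfl | rfl | rfl | rfl | rfl <;>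
    assumption

theorem klBasis_w₀ (hC : cs.IsKLBasis C) : C w₀ =
    ∑ ω ∈ w₀Words.toFinset, (T ((ω.length : ℤ) - 6) : ℤ[T;T⁻¹]) • heckeTn cs (cs.wordProd ω) := by
  classical
  refine (heckeBasisN strongExchange).repr.injective (Finsupp.ext fun g => ?_)
  rw [map_sum, Finsupp.finsetSum_apply]
  simp only [map_smul, Finsupp.smul_apply, repr_heckeTn, smul_eq_mul, mul_ite, mul_one, mul_zero]
  by_cases hg : g ∈ W₀
  · obtain ⟨ω, hω, rfl⟩ := exists_w₀Words hg
    rw [repr_w₀ hC hω, Finset.sum_eq_single ω, if_pos rfl]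
    · intro ω' hω' hne
      rw [if_neg fun h => hne (wordProd_injOn _ (List.mem_toFinset.mp hω') _ hω h)]
    · exact fun h => absurd (List.mem_toFinset.mpr hω) h
  · rw [Finset.sum_eq_zero]
    · by_contra h
      exact hg (mem_W₀_of_bruhatLE ((hC.isKLElement w₀).bruhatLE strongExchange h) w₀_mem)
    · intro ω hω
      refine if_neg ?_
      rintro rfl
      exact hg (wordProd_mem_W₀ (zero_notMem_of_mem (List.mem_toFinset.mp hω)))

theorem w₀_inv : w₀⁻¹ = w₀ := by
  have := braid_st
  simp only [w₀, mul_inv_rev, s_inv, t_inv, mul_assoc]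
  exact this.symm

theorem heckeTn_simple_mul_w₀ (hC : cs.IsKLBasis C) {i : Fin 3} (hi : i ≠ 0) :
    heckeTn cs (cs.simple i) * C w₀ = (T 1 : ℤ[T;T⁻¹]) • C w₀ := by
  have hd : cs.IsRightDescent w₀ i := by
    have := isRightDescent_mul_w₀ isMinimal_one hi
    rwa [one_mul] at this
  have h := congrArg (heckeFlip cs) ((hC.isKLElement w₀).mul_heckeTn_simple strongExchange hd)
  rwa [heckeFlip_mul, map_smul, hC.heckeFlip_apply strongExchange, heckeFlip_heckeTn,
    cs.inv_simple, w₀_inv] at h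

/-! ### The left ideal of C_{w₀}, indexed by lattice points -/

/-- The standard basis of the left ideal generated by `C_{w₀}`. -/
noncomputable def stdElt (C : Module.Basis W ℤ[T;T⁻¹] (HeckeAlgebra cs)) (p : ℤ × ℤ) :
    HeckeAlgebra cs := heckeTn cs (minRep p) * C w₀

theorem stdElt_eq_sum (hC : cs.IsKLBasis C) (p : ℤ × ℤ) : stdElt C p =
    ∑ ω ∈ w₀Words.toFinset,
      (T ((ω.length : ℤ) - 6) : ℤ[T;T⁻¹]) • heckeTn cs (minRep p * cs.wordProd ω) := by
  rw [stdElt, klBasis_w₀ hC, Finset.mul_sum]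
  refine Finset.sum_congr rfl fun ω hω => ?_
  have hω' := List.mem_toFinset.mp hω
  rw [mul_smul_comm, heckeTn_mul]
  rw [(isMinimal_minRep p).length_mul hω', length_wordProd hω']

open Classical in
theorem repr_stdElt (hC : cs.IsKLBasis C) (p : ℤ × ℤ) (g : W) :
    (heckeBasisN strongExchange).repr (stdElt C p) g =
      ∑ ω ∈ w₀Words.toFinset,
        if minRep p * cs.wordProd ω = g then (T ((ω.length : ℤ) - 6) : ℤ[T;T⁻¹]) else 0 := by
  rw [stdElt_eq_sum hC, map_sum, Finsupp.finsetSum_apply]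
  simp only [map_smul, Finsupp.smul_apply, repr_heckeTn, smul_eq_mul, mul_ite, mul_one, mul_zero]

theorem repr_stdElt_of_ne (hC : cs.IsKLBasis C) {p : ℤ × ℤ} {g : W} (h : pt g ≠ p) :
    (heckeBasisN strongExchange).repr (stdElt C p) g = 0 := by
  classical
  rw [repr_stdElt hC, Finset.sum_eq_zero]
  intro ω hω
  refine if_neg ?_
  rintro rfl
  apply h
  rw [pt_mul_of_mem _ (wordProd_mem_W₀ (zero_notMem_of_mem (List.mem_toFinset.mp hω))), pt_minRep]

theorem repr_stdElt_self (hC : cs.IsKLBasis C) (p : ℤ × ℤ) :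
    (heckeBasisN strongExchange).repr (stdElt C p) (minRep p * w₀) = 1 := by
  classical
  rw [repr_stdElt hC, Finset.sum_eq_single w₀Word]
  · rw [if_pos (by rw [wordProd_w₀Word]), ← T_zero]
    rfl
  · intro ω hω hne
    refine if_neg fun h => hne ?_
    rw [← wordProd_w₀Word, mul_right_inj] at h
    exact wordProd_injOn _ (List.mem_toFinset.mp hω) _ w₀Word_mem h
  · exact fun h => absurd (List.mem_toFinset.mpr w₀Word_mem) h

/-- All terms of C_{w₀} other than the one at w₀ carry negative powers of v. With coordinate 1 at
m_p w₀, the standard elements are thus triangular in the same sense as the C_w. -/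
theorem degLE_repr_stdElt (hC : cs.IsKLBasis C) {p : ℤ × ℤ} {g : W} (h : g ≠ minRep p * w₀) :
    DegLE (-1) ((heckeBasisN strongExchange).repr (stdElt C p) g) := by
  classical
  rw [repr_stdElt hC]
  refine DegLE.sum fun ω hω => ?_
  split_ifs with hg
  · refine (degLE_T _).mono ?_
    by_contra hc
    refine h ?_
    rw [← hg, eq_w₀Word (List.mem_toFinset.mp hω) (by omega), wordProd_w₀Word]
  · exact degLE_zero _

theorem degLE_zero_repr_stdElt (hC : cs.IsKLBasis C) (p : ℤ × ℤ) (g : W) :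
    DegLE 0 ((heckeBasisN strongExchange).repr (stdElt C p) g) := by
  by_cases h : g = minRep p * w₀
  · rw [h, repr_stdElt_self hC]
    exact degLE_one
  · exact (degLE_repr_stdElt hC h).mono (by omega)

theorem heckeTn_simple_mul_stdElt_of_pos {p : ℤ × ℤ} {i : Fin 3} (hi : 0 < valPt i p) :
    heckeTn cs (cs.simple i) * stdElt C p = stdElt C (reflPt i p) := by
  rw [stdElt, ← mul_assoc, heckeTn_simple_mul_of_not, simple_mul_minRep hi.ne', stdElt]
  exact not_isLeftDescent_of_valPt_pos (by rwa [pt_minRep])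

theorem heckeTn_simple_mul_stdElt_of_neg {p : ℤ × ℤ} {i : Fin 3} (hi : valPt i p < 0) :
    heckeTn cs (cs.simple i) * stdElt C p =
      stdElt C (reflPt i p) + (T 1 - T (-1) : ℤ[T;T⁻¹]) • stdElt C p := by
  rw [stdElt, ← mul_assoc, heckeTn_simple_mul_of_isLeftDescent, simple_mul_minRep hi.ne, add_mul,
    smul_mul_assoc, stdElt]
  exact isLeftDescent_of_valPt_neg (by rwa [pt_minRep])

/-- On the wall s_i passes through the minimal representative and becomes a finite reflection, which
C_{w₀} absorbs with eigenvalue v. -/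
theorem heckeTn_simple_mul_stdElt_of_eq (hC : cs.IsKLBasis C) {p : ℤ × ℤ} {i : Fin 3}
    (hi : valPt i p = 0) :
    heckeTn cs (cs.simple i) * stdElt C p = (T 1 : ℤ[T;T⁻¹]) • stdElt C p := by
  obtain ⟨j, hj, h1, h2, h3⟩ := (isMinimal_minRep p).exists_simple_mul_eq (i := i)
    (by rwa [pt_minRep])
  rw [stdElt, ← mul_assoc, heckeTn_simple_mul_of_not h2, h1, ← heckeTn_mul_simple_of_not h3,
    mul_assoc, heckeTn_simple_mul_w₀ hC hj, mul_smul_comm]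

end

end AffineG2

/-! ## Computing in the left ideal generated by `C_{w₀}` -/

namespace AffineG2
open CoxeterSystem LaurentPolynomial

/-- The Laurent polynomial `∑ aᵢ q^{-i/2}`. -/
noncomputable def evalPoly : List ℤ → ℤ[T;T⁻¹]
  | [] => 0
  | a :: p => LaurentPolynomial.C a + T (-1) * evalPoly p

/-- Addition of polynomials. -/
def addPoly : List ℤ → List ℤ → List ℤ
  | [], q => q
  | a :: p, [] => a :: p
  | a :: p, b :: q => (a + b) :: addPoly p q

theorem evalPoly_addPoly (p q : List ℤ) : evalPoly (addPoly p q) = evalPoly p + evalPoly q := by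
  induction p generalizing q with
  | nil => rw [addPoly, evalPoly, zero_add]
  | cons a p ih =>
    cases q with
    | nil => rw [addPoly, evalPoly, evalPoly, add_zero]
    | cons b q =>
      rw [addPoly, evalPoly, evalPoly, evalPoly, ih, map_add]
      ring

theorem evalPoly_zero_cons (p : List ℤ) : evalPoly (0 :: p) = T (-1) * evalPoly p := by
  rw [evalPoly, map_zero, zero_add]

theorem evalPoly_map (c : ℤ) (p : List ℤ) :
    evalPoly (p.map (c * ·)) = LaurentPolynomial.C c * evalPoly p := by
  induction p with
  | nil => rw [List.map_nil, evalPoly, mul_zero]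
  | cons a p ih =>
    rw [List.map_cons, evalPoly, evalPoly, ih, map_mul]
    ring

theorem degLE_C (c : ℤ) : DegLE 0 (LaurentPolynomial.C c) := by
  rw [← mul_one (LaurentPolynomial.C c)]
  exact degLE_one.C_mul c

theorem degLE_evalPoly (p : List ℤ) : DegLE 0 (evalPoly p) := by
  induction p with
  | nil => exact degLE_zero 0
  | cons a p ih =>
    rw [evalPoly]
    exact (degLE_C a).add (degLE_T_mul_iff.mpr (ih.mono (by omega)))

theorem evalPoly_eq_zero {p : List ℤ} (h : ∀ a ∈ p, a = 0) : evalPoly p = 0 := by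
  induction p with
  | nil => rfl
  | cons a p ih =>
    rw [evalPoly, ih fun b hb => h b (List.mem_cons_of_mem _ hb), h a List.mem_cons_self, map_zero,
      mul_zero, add_zero]

theorem evalPoly_eq_take_add_drop (p : List ℤ) (k : ℕ) :
    evalPoly p = evalPoly (p.take k) + T (-(k : ℤ)) * evalPoly (p.drop k) := by
  induction k generalizing p with
  | zero => simp [evalPoly]
  | succ k ih =>
    cases p with
    | nil => simp [evalPoly]
    | cons a p =>
      rw [List.take_succ_cons, List.drop_succ_cons, evalPoly, evalPoly, ih, mul_add, ← mul_assoc,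
        ← T_add, add_assoc]
      congr 4
      push_cast
      ring

/-- The polynomial is divisible by `q^{-k/2}`. -/
def headZero (k : ℕ) (p : List ℤ) : Bool := (p.take k).all (· == 0)

theorem evalPoly_of_headZero {k : ℕ} {p : List ℤ} (h : headZero k p = true) :
    evalPoly p = T (-(k : ℤ)) * evalPoly (p.drop k) := by
  rw [evalPoly_eq_take_add_drop p k, evalPoly_eq_zero, zero_add]
  intro a ha
  simpa using List.all_eq_true.mp h a ha

theorem degLE_of_headZero {k : ℕ} {p : List ℤ} (h : headZero k p = true) :
    DegLE (-(k : ℤ)) (evalPoly p) := by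
  rw [evalPoly_of_headZero h]
  exact degLE_T_mul_iff.mpr ((degLE_evalPoly _).mono (by omega))

theorem coeff_evalPoly (p : List ℤ) (k : ℕ) : (evalPoly p).coeff (-(k : ℤ)) = p.getD k 0 := by
  have e : ∀ a b : ℤ[T;T⁻¹], ∀ n, (a + b).coeff n = a.coeff n + b.coeff n := fun _ _ _ => rfl
  induction p generalizing k with
  | nil => rfl
  | cons a p ih =>
    rw [evalPoly, e, coeff_T_mul, ← mul_one (LaurentPolynomial.C a), coeff_C_mul, ← T_zero, T_apply]
    cases k with
    | zero =>
      have h1 := degLE_evalPoly p (-((0 : ℕ) : ℤ) - -1) (by norm_num)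
      rw [h1]
      simp
    | succ k =>
      rw [show (-((k + 1 : ℕ) : ℤ) - -1) = -(k : ℤ) by push_cast; ring, ih, if_neg (by omega)]
      simp

/-- Finite combinations of the elements `stdElt`, as binary trees. -/
inductive Vec where
  | nil : Vec
  | node (l : Vec) (A B : ℤ) (p : List ℤ) (r : Vec) : Vec

namespace Vec

/-- Adds `p` to the coefficient at `(A, B)`. -/
def ins (A B : ℤ) (p : List ℤ) : Vec → Vec
  | nil => node nil A B p nil
  | node l A' B' p' r =>
    if A = A' then
      if B = B' then node l A' B' (addPoly p p') r
      else if B < B' then node (ins A B p l) A' B' p' r else node l A' B' p' (ins A B p r)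
    else if A < A' then node (ins A B p l) A' B' p' r else node l A' B' p' (ins A B p r)

/-- Folds `f` over the terms of a combination. -/
def fold (f : ℤ → ℤ → List ℤ → Vec → Vec) : Vec → Vec → Vec
  | nil, acc => acc
  | node l A B p r, acc => fold f l (f A B p (fold f r acc))

/-- All terms satisfy `f`. -/
def all (f : ℤ → ℤ → List ℤ → Bool) : Vec → Bool
  | nil => true
  | node l A B p r => f A B p && (all f l && all f r)

/-- The coefficient of `q^{-k/2}` at `(A, B)`. -/
def coeffAt (A B : ℤ) (k : ℕ) : Vec → ℤ
  | nil => 0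
  | node l A' B' p r =>
    (if A = A' ∧ B = B' then p.getD k 0 else 0) + (coeffAt A B k l + coeffAt A B k r)

end Vec

/-- The first coordinate of the image of a point under a simple reflection. -/
def reflA (i : Fin 3) (A B : ℤ) : ℤ :=
  match i with
  | 0 => 1 - A - 3 * B
  | 1 => -A
  | 2 => A + 3 * B

/-- The second coordinate of the image of a point under a simple reflection. -/
def reflB (i : Fin 3) (A B : ℤ) : ℤ :=
  match i with
  | 0 => B
  | 1 => A + B
  | 2 => -B

/-- The value of a simple root at a point. -/
def valAt (i : Fin 3) (A B : ℤ) : ℤ :=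
  match i with
  | 0 => 1 - 2 * A - 3 * B
  | 1 => A
  | 2 => B

theorem reflPt_mk (i : Fin 3) (A B : ℤ) : reflPt i (A, B) = (reflA i A B, reflB i A B) := by
  fin_cases i <;> rfl

theorem valPt_mk (i : Fin 3) (A B : ℤ) : valPt i (A, B) = valAt i A B := by
  fin_cases i <;> rfl

namespace Vec

/-- Multiplication by `q^{-1/2} C_i`. -/
def mulC (i : Fin 3) : Vec → Vec → Vec :=
  fold fun A B p acc =>
    if 0 < valAt i A B then ins (reflA i A B) (reflB i A B) (0 :: p) (ins A B (0 :: 0 :: p) acc)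
    else if valAt i A B = 0 then ins A B (addPoly p (0 :: 0 :: p)) acc
    else ins (reflA i A B) (reflB i A B) (0 :: p) (ins A B p acc)

/-- Multiplication by `q^{-1/2} T_i`. -/
def mulT (i : Fin 3) : Vec → Vec → Vec :=
  fold fun A B p acc =>
    if 0 < valAt i A B then ins (reflA i A B) (reflB i A B) (0 :: p) acc
    else if valAt i A B = 0 then ins A B p acc
    else ins (reflA i A B) (reflB i A B) (0 :: p)
      (ins A B (addPoly p (0 :: 0 :: p.map (-1 * ·))) acc)

/-- Multiplication by `c q^{-k/2}`. -/
def smul (c : ℤ) (k : ℕ) : Vec → Vec → Vec :=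
  fold fun A B p => ins A B (List.replicate k 0 ++ p.map (c * ·))

/-- Reflects the terms on the negative side of a wall, multiplying by `q^{-1/2}` the others. -/
def proj (i : Fin 3) : Vec → Vec → Vec :=
  fold fun A B p =>
    if valAt i A B < 0 then ins (reflA i A B) (reflB i A B) p else ins A B (0 :: p)

/-- Keeps `m` coefficients after the first `k` ones. -/
def window (k m : ℕ) : Vec → Vec → Vec :=
  fold fun A B p acc =>
    if ((p.drop k).take m).all (· == 0) then acc else ins A B ((p.drop k).take m) acc

end Vec

section

variable (C : Module.Basis W ℤ[T;T⁻¹] (HeckeAlgebra cs))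

/-- The element of the Hecke algebra given by a combination. -/
noncomputable def Vec.sem : Vec → HeckeAlgebra cs
  | nil => 0
  | node l A B p r => Vec.sem l + (evalPoly p • stdElt C (A, B) + Vec.sem r)

namespace Vec

/-- The value sums all nodes wherever they stand, so no ordering invariant of the tree is needed;
the ordering only serves speed. -/
theorem sem_ins (A B : ℤ) (p : List ℤ) (x : Vec) :
    sem C (ins A B p x) = evalPoly p • stdElt C (A, B) + sem C x := by
  induction x with
  | nil => simp [ins, sem]
  | node l A' B' p' r ihl ihr =>
    rw [ins]
    split_ifs with h1 h2
    · subst h1 h2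
      rw [sem, sem, evalPoly_addPoly, add_smul]
      abel
    all_goals
      rw [sem, sem]
      first
        | rw [ihl]; abel
        | rw [ihr]; abel

/-- The additive map S lets the same induction cover identities that hold only after left
multiplication by C_{w₀}. -/
theorem sem_fold (S L : HeckeAlgebra cs →+ HeckeAlgebra cs) {f : ℤ → ℤ → List ℤ → Vec → Vec}
    (h : ∀ A B p acc, S (sem C (f A B p acc)) =
      L (evalPoly p • stdElt C (A, B)) + S (sem C acc)) (x acc : Vec) :
    S (sem C (fold f x acc)) = L (sem C x) + S (sem C acc) := by
  induction x generalizing acc with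
  | nil => rw [fold, sem, map_zero, zero_add]
  | node l A B p r ihl ihr =>
    rw [fold, ihl, h, ihr, sem, map_add, map_add]
    abel

variable {C}

theorem sem_mulC (hC : cs.IsKLBasis C) (i : Fin 3) (x acc : Vec) :
    sem C (mulC i x acc) = (T (-1) : ℤ[T;T⁻¹]) • (klSimple cs i * sem C x) + sem C acc := by
  refine sem_fold C (AddMonoidHom.id _) ((DistribSMul.toAddMonoidHom (HeckeAlgebra cs)
    (T (-1) : ℤ[T;T⁻¹])).comp (AddMonoidHom.mulLeft (klSimple cs i))) ?_ x acc
  intro A B p acc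
  have h2 : (T (-1) : ℤ[T;T⁻¹]) * T 1 = 1 := by rw [← T_add]; exact T_zero
  simp only [AddMonoidHom.id_apply, AddMonoidHom.comp_apply, AddMonoidHom.coe_mulLeft,
    DistribSMul.toAddMonoidHom_apply, mul_smul_comm, klSimple, add_mul, smul_mul_assoc, one_mul]
  split_ifs with h h'
  · rw [heckeTn_simple_mul_stdElt_of_pos (by rwa [valPt_mk]), sem_ins, sem_ins, reflPt_mk,
      evalPoly_zero_cons, evalPoly_zero_cons, evalPoly_zero_cons]
    module
  · rw [heckeTn_simple_mul_stdElt_of_eq hC (by rwa [valPt_mk]), sem_ins, evalPoly_addPoly,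
      evalPoly_zero_cons, evalPoly_zero_cons]
    have h3 : evalPoly p = evalPoly p * (T (-1) * T 1) := by rw [h2, mul_one]
    nth_rewrite 1 [h3]
    module
  · rw [heckeTn_simple_mul_stdElt_of_neg (by rw [valPt_mk]; omega), sem_ins, sem_ins, reflPt_mk,
      evalPoly_zero_cons]
    have h3 : evalPoly p = evalPoly p * (T (-1) * T 1) := by rw [h2, mul_one]
    nth_rewrite 2 [h3]
    module

theorem sem_mulT (hC : cs.IsKLBasis C) (i : Fin 3) (x acc : Vec) :
    sem C (mulT i x acc) =
      (T (-1) : ℤ[T;T⁻¹]) • (heckeTn cs (cs.simple i) * sem C x) + sem C acc := by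
  refine sem_fold C (AddMonoidHom.id _) ((DistribSMul.toAddMonoidHom (HeckeAlgebra cs)
    (T (-1) : ℤ[T;T⁻¹])).comp (AddMonoidHom.mulLeft (heckeTn cs (cs.simple i)))) ?_ x acc
  intro A B p acc
  have h2 : (T (-1) : ℤ[T;T⁻¹]) * T 1 = 1 := by rw [← T_add]; exact T_zero
  have h3 : evalPoly p = evalPoly p * (T (-1) * T 1) := by rw [h2, mul_one]
  simp only [AddMonoidHom.id_apply, AddMonoidHom.comp_apply, AddMonoidHom.coe_mulLeft,
    DistribSMul.toAddMonoidHom_apply, mul_smul_comm]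
  split_ifs with h h'
  · rw [heckeTn_simple_mul_stdElt_of_pos (by rwa [valPt_mk]), sem_ins, reflPt_mk,
      evalPoly_zero_cons]
    module
  · rw [heckeTn_simple_mul_stdElt_of_eq hC (by rwa [valPt_mk]), sem_ins]
    nth_rewrite 1 [h3]
    module
  · rw [heckeTn_simple_mul_stdElt_of_neg (by rw [valPt_mk]; omega), sem_ins, sem_ins, reflPt_mk,
      evalPoly_zero_cons, evalPoly_addPoly, evalPoly_zero_cons, evalPoly_zero_cons, evalPoly_map,
      map_neg, map_one]
    nth_rewrite 2 [h3]
    module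

theorem evalPoly_replicate_append (k : ℕ) (p : List ℤ) :
    evalPoly (List.replicate k 0 ++ p) = T (-(k : ℤ)) * evalPoly p := by
  induction k with
  | zero => simp
  | succ k ih =>
    rw [List.replicate_succ, List.cons_append, evalPoly_zero_cons, ih, ← mul_assoc, ← T_add]
    congr 2
    push_cast
    ring

theorem sem_smul (c : ℤ) (k : ℕ) (x acc : Vec) :
    sem C (smul c k x acc) =
      (LaurentPolynomial.C c * T (-(k : ℤ)) : ℤ[T;T⁻¹]) • sem C x + sem C acc := by
  refine sem_fold C (AddMonoidHom.id _) (DistribSMul.toAddMonoidHom (HeckeAlgebra cs)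
    (LaurentPolynomial.C c * T (-(k : ℤ)) : ℤ[T;T⁻¹])) ?_ x acc
  intro A B p acc
  simp only [AddMonoidHom.id_apply, DistribSMul.toAddMonoidHom_apply]
  rw [sem_ins, evalPoly_replicate_append, evalPoly_map, smul_smul]
  congr 2
  ring

/-- On the negative side of the wall the standard element at p is T̃_i applied to the one at the
reflected point, and C_{w₀} T̃_i = v C_{w₀}. Reflecting therefore costs a factor v, which the
overall v⁻¹ cancels. -/
theorem mul_sem_proj (hC : cs.IsKLBasis C) {i : Fin 3} (hi : i ≠ 0) (x acc : Vec) :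
    C w₀ * sem C (proj i x acc) =
      (T (-1) : ℤ[T;T⁻¹]) • (C w₀ * sem C x) + C w₀ * sem C acc := by
  refine sem_fold C (AddMonoidHom.mulLeft (C w₀)) ((DistribSMul.toAddMonoidHom (HeckeAlgebra cs)
    (T (-1) : ℤ[T;T⁻¹])).comp (AddMonoidHom.mulLeft (C w₀))) ?_ x acc
  intro A B p acc
  simp only [AddMonoidHom.comp_apply, AddMonoidHom.coe_mulLeft,
    DistribSMul.toAddMonoidHom_apply, mul_smul_comm]
  split_ifs with h
  · have h1 : 0 < valPt i (reflPt i (A, B)) := by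
      rw [reflPt_mk, valPt_mk]
      fin_cases i <;> simp [valAt, reflA, reflB] at h hi ⊢ <;> omega
    have h2 : reflPt i (reflPt i (A, B)) = (A, B) := by
      fin_cases i <;> simp [reflPt] <;> ring
    have hd : cs.IsRightDescent w₀ i := by
      have := isRightDescent_mul_w₀ isMinimal_one hi
      rwa [one_mul] at this
    have h3 := (hC.isKLElement w₀).mul_heckeTn_simple strongExchange hd
    have h4 := heckeTn_simple_mul_stdElt_of_pos (C := C) h1
    rw [h2] at h4
    rw [sem_ins, ← reflPt_mk, ← h4, mul_add, mul_smul_comm, ← mul_assoc, h3, smul_mul_assoc,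
      smul_comm (T (-1) : ℤ[T;T⁻¹]), smul_smul (T (-1) : ℤ[T;T⁻¹]), ← T_add]
    simp
  · rw [sem_ins, mul_add, mul_smul_comm, evalPoly_zero_cons, smul_smul]

end Vec

end

end AffineG2

namespace AffineG2
open CoxeterSystem LaurentPolynomial

/-! ### Scaled combinations -/

/-- A combination multiplied by a power of `q^{1/2}`. -/
abbrev SVec : Type := ℤ × Vec

namespace SVec

/-- The sum of `c` times `x` and `y`. -/
def addMul (c : ℤ) (x y : SVec) : SVec :=
  if x.1 ≤ y.1 then (y.1, Vec.smul c (y.1 - x.1).toNat x.2 y.2)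
  else (x.1, Vec.smul 1 (x.1 - y.1).toNat y.2 (Vec.smul c 0 x.2 .nil))

/-- Multiplication by `C_i`. -/
def mulC (i : Fin 3) (x : SVec) : SVec := (x.1 + 1, Vec.mulC i x.2 .nil)

/-- Multiplication by `q^{1/2} T_i`. -/
def mulT (i : Fin 3) (x : SVec) : SVec := (x.1 + 2, Vec.mulT i x.2 .nil)

/-- The image of `x` under `1 + v T_{i₁} + v² T_{i₁} T_{i₂} + …`, where `v = q^{1/2}`. -/
def horner : List (Fin 3) → SVec → SVec
  | [], x => x
  | i :: ω, x => addMul 1 x (mulT i (horner ω x))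

/-- Multiplication by `C_{w₀}`. -/
def mulW₀ (x : SVec) : SVec :=
  let y := addMul 1 (horner w₀Word x) (mulT 2 (horner [1, 2, 1, 2] x))
  (y.1 - 6, y.2)

/-- Moves all terms into the dominant chamber, which does not change the product with `C_{w₀}`. -/
def proj (x : SVec) : SVec :=
  w₀Word.foldl (fun x i => (x.1 + 1, Vec.proj i x.2 .nil)) x

/-- Keeps `m` coefficients after the first `k` ones. -/
def window (k m : ℕ) (x : SVec) : SVec := (x.1 - k, Vec.window k m x.2 .nil)

end SVec

section

variable (C : Module.Basis W ℤ[T;T⁻¹] (HeckeAlgebra cs))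

/-- The element of the Hecke algebra given by a scaled combination. -/
noncomputable def SVec.sem (x : SVec) : HeckeAlgebra cs := (T x.1 : ℤ[T;T⁻¹]) • Vec.sem C x.2

variable {C}

namespace SVec

theorem sem_addMul (c : ℤ) (x y : SVec) :
    sem C (addMul c x y) = LaurentPolynomial.C c • sem C x + sem C y := by
  rw [addMul]
  split_ifs with h
  · rw [sem, sem, sem, Vec.sem_smul, smul_add, smul_smul, smul_smul, Int.toNat_of_nonneg (by omega),
      mul_left_comm, ← T_add]
    congr 4
    ring
  · rw [sem, sem, sem, Vec.sem_smul, Vec.sem_smul, Int.toNat_of_nonneg (by omega), Vec.sem,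
      add_zero, smul_add, smul_smul, smul_smul, smul_smul, map_one, one_mul, ← T_add, add_comm]
    simp only [Nat.cast_zero, neg_zero, T_zero, mul_one]
    congr 2
    · ring
    · congr 1
      ring

theorem sem_mulC (hC : cs.IsKLBasis C) (i : Fin 3) (x : SVec) :
    sem C (mulC i x) = klSimple cs i * sem C x := by
  rw [sem, mulC, Vec.sem_mulC hC, Vec.sem, add_zero, smul_smul, ← T_add, sem, mul_smul_comm]
  congr 2
  ring

theorem sem_mulT (hC : cs.IsKLBasis C) (i : Fin 3) (x : SVec) :
    sem C (mulT i x) = (T 1 : ℤ[T;T⁻¹]) • (heckeTn cs (cs.simple i) * sem C x) := by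
  rw [sem, mulT, Vec.sem_mulT hC, Vec.sem, add_zero, smul_smul, ← T_add, sem, mul_smul_comm,
    smul_smul, ← T_add]
  congr 2
  ring

theorem sem_horner_nil (x : SVec) : sem C (horner [] x) = sem C x := rfl

theorem sem_horner_cons (hC : cs.IsKLBasis C) (i : Fin 3) (ω : List (Fin 3)) (x : SVec) :
    sem C (horner (i :: ω) x) =
      sem C x + (T 1 : ℤ[T;T⁻¹]) • (heckeTn cs (cs.simple i) * sem C (horner ω x)) := by
  rw [horner, sem_addMul, sem_mulT hC, map_one, one_smul]

/-- The twelve elements of W₀ are the seven prefixes of ststst, the empty one included, and the five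
nonempty prefixes of tstst. The shift by 6 is the factor q⁻³ of C_{w₀}. -/
theorem sem_mulW₀ (hC : cs.IsKLBasis C) (x : SVec) : sem C (mulW₀ x) = C w₀ * sem C x := by
  have h1 : ∀ y : SVec, sem C (y.1 - 6, y.2) = (T (-6) : ℤ[T;T⁻¹]) • sem C y := by
    intro y
    rw [sem, sem, smul_smul, ← T_add]
    congr 2
    ring
  rw [mulW₀, h1, sem_addMul, sem_mulT hC, klBasis_w₀ hC, List.sum_toFinset _ (by decide)]
  have hw : ∀ ω ∈ w₀Words, heckeTn cs (cs.wordProd ω) = heckeWord cs ω := fun ω hω =>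
    heckeTn_wordProd (isReduced_of_mem hω)
  rw [List.map_congr_left (fun ω hω => by rw [hw ω hω])]
  simp only [w₀Word, sem_horner_cons hC, sem_horner_nil, w₀Words, List.map_cons, List.map_nil,
    List.sum_cons, List.sum_nil, heckeWord_cons, heckeWord_nil, mul_one, add_zero, map_one,
    one_smul, mul_add, add_mul, smul_add, mul_smul_comm, smul_mul_assoc, smul_smul, ← T_add,
    mul_assoc, one_mul, List.length_cons, List.length_nil]
  norm_num
  abel

/-- Any word in the finite reflections would give this identity; a reduced word of w₀ is one that
brings every point into the chamber. -/
theorem mul_sem_proj (hC : cs.IsKLBasis C) (x : SVec) :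
    C w₀ * sem C (proj x) = C w₀ * sem C x := by
  have h : ∀ ω : List (Fin 3), 0 ∉ ω → ∀ x : SVec, C w₀ * sem C
      (ω.foldl (fun x i => (x.1 + 1, Vec.proj i x.2 .nil)) x) = C w₀ * sem C x := by
    intro ω hω
    induction ω with
    | nil => exact fun x => rfl
    | cons i ω ih =>
      intro x
      rw [List.mem_cons, not_or] at hω
      rw [List.foldl_cons, ih hω.2, sem, sem, mul_smul_comm,
        Vec.mul_sem_proj hC (Ne.symm hω.1), Vec.sem, mul_zero, add_zero, smul_smul, ← T_add,
        mul_smul_comm]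
      congr 2
      ring
  exact h w₀Word (by decide) x

end SVec

/-! ### Truncation errors -/

/-- The element `h` contributes only terms of degree at most `d + 6` to products. -/
def IsSmall (d : ℤ) (h : HeckeAlgebra cs) : Prop :=
  ∀ w, DegLE d ((heckeBasisN strongExchange).repr h w)

theorem IsSmall.add {d : ℤ} {h h' : HeckeAlgebra cs} (hh : IsSmall d h) (hh' : IsSmall d h') :
    IsSmall d (h + h') := fun w => by
  rw [map_add, Finsupp.add_apply]
  exact (hh w).add (hh' w)

theorem IsSmall.smul {d n : ℤ} {h : HeckeAlgebra cs} (hh : IsSmall d h) {a : ℤ[T;T⁻¹]}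
    (ha : DegLE n a) : IsSmall (n + d) (a • h) := fun w => by
  rw [map_smul, Finsupp.smul_apply, smul_eq_mul]
  exact ha.mul (hh w)

theorem isSmall_zero (d : ℤ) : IsSmall d 0 := fun w => by
  rw [map_zero]
  exact degLE_zero d

theorem isSmall_klBasis (hC : cs.IsKLBasis C) (w : W) : IsSmall 0 (C w) := fun u =>
  (hC.isKLElement w).degLE_zero strongExchange u

theorem IsSmall.mul {m n : ℤ} {a b : HeckeAlgebra cs} (ha : IsSmall m a) (hb : IsSmall n b) :
    IsSmall (m + n + 6) (a * b) := degLE_repr_mul ha hb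

theorem isSmall_stdElt (hC : cs.IsKLBasis C) (p : ℤ × ℤ) : IsSmall 0 (stdElt C p) :=
  degLE_zero_repr_stdElt hC p

/-- The discarded tail of each coefficient is divisible by v^{-m} after rescaling, and the standard
elements have coordinates of degree at most 0. -/
theorem isSmall_vec_window (hC : cs.IsKLBasis C) (k m : ℕ) (x acc : Vec)
    (hx : x.all (fun _ _ p => headZero k p) = true) :
    IsSmall (-(m : ℤ)) (Vec.sem C acc + (T (k : ℤ) : ℤ[T;T⁻¹]) • Vec.sem C x -
      Vec.sem C (Vec.window k m x acc)) := by
  have hT : (T (k : ℤ) : ℤ[T;T⁻¹]) * T (-(k : ℤ)) = 1 := by rw [← T_add, add_neg_cancel, T_zero]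
  induction x generalizing acc with
  | nil =>
    rw [Vec.window, Vec.fold, Vec.sem, smul_zero, add_zero, sub_self]
    exact isSmall_zero _
  | node l A B p r ihl ihr =>
    simp only [Vec.all, Bool.and_eq_true] at hx
    obtain ⟨hp, hl, hr⟩ := hx
    have h1 := ihr acc hr
    set acc' := Vec.window k m r acc with hacc'
    set acc'' := if ((p.drop k).take m).all (· == 0) then acc' else
      Vec.ins A B ((p.drop k).take m) acc' with hacc''
    have h2 := ihl acc'' hl
    have h3 : Vec.sem C acc'' = evalPoly ((p.drop k).take m) • stdElt C (A, B) +
        Vec.sem C acc' := by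
      rw [hacc'']
      split_ifs with h
      · rw [evalPoly_eq_zero, zero_smul, zero_add]
        intro a ha
        simpa using List.all_eq_true.mp h a ha
      · rw [Vec.sem_ins]
    have h4 : Vec.window k m (.node l A B p r) acc = Vec.window k m l acc'' := rfl
    have h5 : (T (k : ℤ) : ℤ[T;T⁻¹]) * evalPoly p = evalPoly ((p.drop k).take m) +
        T (-(m : ℤ)) * evalPoly ((p.drop k).drop m) := by
      rw [evalPoly_of_headZero hp, ← mul_assoc, hT, one_mul, ← evalPoly_eq_take_add_drop]
    have h6 : IsSmall (-(m : ℤ))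
        ((T (-(m : ℤ)) * evalPoly ((p.drop k).drop m) : ℤ[T;T⁻¹]) • stdElt C (A, B)) := by
      have := (isSmall_stdElt hC (A, B)).smul ((degLE_T (-(m : ℤ))).mul
        (degLE_evalPoly ((p.drop k).drop m)))
      rwa [add_zero, add_zero] at this
    have h7 := (h1.add h2).add h6
    rw [h4, Vec.sem]
    convert h7 using 1
    rw [smul_add, smul_add, smul_smul (T (k : ℤ) : ℤ[T;T⁻¹]) (evalPoly p), h5, h3, add_smul]
    abel

/-- The first `k` coefficients of all terms vanish. -/
def SVec.headZero (k : ℕ) (x : SVec) : Bool := x.2.all fun _ _ p => AffineG2.headZero k p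

theorem isSmall_window (hC : cs.IsKLBasis C) (k m : ℕ) (x : SVec) (hx : x.headZero k = true) :
    IsSmall (x.1 - k - m) (SVec.sem C x - SVec.sem C (SVec.window k m x)) := by
  have h := (isSmall_vec_window hC k m x.2 .nil hx).smul (degLE_T (x.1 - k))
  rw [smul_sub, smul_add, Vec.sem, smul_zero, zero_add, smul_smul, ← T_add, sub_add_cancel] at h
  exact h

/-! ### Programs -/

/-- An instruction `(i, o, l)`: multiply the entry number `o` by `C_i` and subtract `c` times the
entry number `o'` for `(o', c)` in `l`. -/
abbrev Instr : Type := Fin 3 × ℕ × List (ℕ × ℤ)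

/-- The elements of the Hecke algebra produced by a program, the last one first. -/
noncomputable def runH : List Instr → List (HeckeAlgebra cs)
  | [] => [1]
  | (i, o, l) :: P => (klSimple cs i * (runH P).getD o 0 -
      (l.map fun e => LaurentPolynomial.C e.2 • (runH P).getD e.1 0).sum) :: runH P

/-- Subtracts multiples of the entries of a list. -/
def subAll (E : List SVec) : List (ℕ × ℤ) → SVec → SVec
  | [], x => x
  | e :: l, x => subAll E l (SVec.addMul (-e.2) (E.getD e.1 (0, .nil)) x)

/-- The elements produced by a program, multiplied by `C_{w₀}`. -/
def run : List Instr → List SVec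
  | [] => [(0, .node .nil 0 0 [1] .nil)]
  | (i, o, l) :: P => subAll (run P) l (SVec.mulC i ((run P).getD o (0, .nil))) :: run P

theorem sem_nil (n : ℤ) : SVec.sem C (n, .nil) = 0 := by
  rw [SVec.sem, Vec.sem, smul_zero]

theorem sem_getD {E : List SVec} {H : List (HeckeAlgebra cs)}
    (h : E.map (SVec.sem C) = H.map (· * C w₀)) (o : ℕ) :
    SVec.sem C (E.getD o (0, .nil)) = H.getD o 0 * C w₀ := by
  rw [← List.getD_map (f := SVec.sem C), h, sem_nil, ← List.getD_map (f := (· * C w₀)), zero_mul]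

theorem sem_subAll {E : List SVec} {H : List (HeckeAlgebra cs)}
    (h : E.map (SVec.sem C) = H.map (· * C w₀)) (l : List (ℕ × ℤ)) (x : SVec) :
    SVec.sem C (subAll E l x) = SVec.sem C x -
      (l.map fun e => LaurentPolynomial.C e.2 • H.getD e.1 0).sum * C w₀ := by
  induction l generalizing x with
  | nil => simp [subAll]
  | cons e l ih =>
    rw [subAll, ih, SVec.sem_addMul, sem_getD h, List.map_cons, List.sum_cons, add_mul, map_neg,
      neg_smul, smul_mul_assoc]
    abel

theorem minRep_zero_stdElt : stdElt C (0, 0) = C w₀ := by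
  rw [stdElt, minRep_zero, heckeTn_one, one_mul]

theorem map_sem_run (hC : cs.IsKLBasis C) (P : List Instr) :
    (run P).map (SVec.sem C) = (runH P).map (· * C w₀) := by
  induction P with
  | nil =>
    simp [run, runH, SVec.sem, Vec.sem, evalPoly, minRep_zero_stdElt]
  | cons a P ih =>
    obtain ⟨i, o, l⟩ := a
    rw [run, runH, List.map_cons, List.map_cons, ih, sem_subAll ih, SVec.sem_mulC hC, sem_getD ih,
      sub_mul, mul_assoc]

theorem heckeBar_C_smul (c : ℤ) (x : HeckeAlgebra cs) :
    heckeBar cs (LaurentPolynomial.C c • x) = LaurentPolynomial.C c • heckeBar cs x := by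
  rw [heckeBar_smul, invert_C]

/-- Programs use only the C_i and integer scalars, all bar-invariant; this supplies the
bar-invariance needed to identify the results as Kazhdan–Lusztig elements. -/
theorem heckeBar_runH (P : List Instr) (j : ℕ) :
    heckeBar cs ((runH P).getD j 0) = (runH P).getD j 0 := by
  induction P generalizing j with
  | nil => cases j <;> simp [runH]
  | cons a P ih =>
    obtain ⟨i, o, l⟩ := a
    cases j with
    | succ j => rw [runH, List.getD_cons_succ, ih]
    | zero =>
      rw [runH, List.getD_cons_zero, map_sub, map_mul, heckeBar_klSimple, ih, map_list_sum,
        List.map_map]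
      congr 3
      funext e
      rw [Function.comp_apply, heckeBar_C_smul, ih]

/-! ### Transposed evaluation of a program -/

/-- The images of the elements produced by a program under `heckeFlip`. -/
noncomputable def runFlip (P : List Instr) : List (HeckeAlgebra cs) := (runH P).map (heckeFlip cs)

theorem length_runFlip (P : List Instr) : (runFlip P).length = P.length + 1 := by
  rw [runFlip, List.length_map]
  induction P with
  | nil => rfl
  | cons a P ih => rw [runH, List.length_cons, ih, List.length_cons]

theorem runFlip_cons (i : Fin 3) (o : ℕ) (l : List (ℕ × ℤ)) (P : List Instr) :
    runFlip ((i, o, l) :: P) = ((runFlip P).getD o 0 * klSimple cs i -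
      (l.map fun e => LaurentPolynomial.C e.2 • (runFlip P).getD e.1 0).sum) :: runFlip P := by
  have h : ∀ o, (runFlip P).getD o 0 = heckeFlip cs ((runH P).getD o 0) := fun o => by
    rw [runFlip, ← map_zero (heckeFlip cs), List.getD_map, map_zero]
  rw [runFlip, runH, List.map_cons, map_sub, heckeFlip_mul, heckeFlip_klSimple, ← h, map_list_sum,
    List.map_map]
  congr 3
  refine List.map_congr_left fun e _ => ?_
  rw [Function.comp_apply, map_smul, h]

/-- Adds `c x` to the entry number `o` of a list. -/
def addAt (c : ℤ) (x : SVec) : ℕ → List SVec → List SVec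
  | _, [] => []
  | 0, a :: l => SVec.addMul c x a :: l
  | o + 1, a :: l => a :: addAt c x o l

/-- Subtracts multiples of `x` from entries of a list. -/
def subAt (x : SVec) : List (ℕ × ℤ) → List SVec → List SVec
  | [], as => as
  | e :: l, as => subAt x l (addAt (-e.2) x e.1 as)

/-- Applies the image under `heckeFlip` of the last element produced by a program to `a`, and adds
the images of the other elements applied to the entries of `as`. -/
def clenshaw : List Instr → SVec → List SVec → SVec
  | [], a, _ => a
  | (i, o, l) :: P, a, as =>
    match subAt a l (addAt 1 (SVec.mulC i a) o as) with
    | [] => a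
    | b :: bs => clenshaw P b bs

variable (C) in
/-- The sum of the products of the entries of two lists. -/
noncomputable def dot : List (HeckeAlgebra cs) → List SVec → HeckeAlgebra cs
  | y :: ys, a :: as => y * SVec.sem C a + dot ys as
  | _, _ => 0

theorem length_addAt (c : ℤ) (x : SVec) (o : ℕ) (as : List SVec) :
    (addAt c x o as).length = as.length := by
  induction as generalizing o with
  | nil => cases o <;> rfl
  | cons a as ih =>
    cases o with
    | zero => rfl
    | succ o => rw [addAt, List.length_cons, ih, List.length_cons]

theorem length_subAt (x : SVec) (l : List (ℕ × ℤ)) (as : List SVec) :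
    (subAt x l as).length = as.length := by
  induction l generalizing as with
  | nil => rfl
  | cons e l ih => rw [subAt, ih, length_addAt]

theorem dot_addAt (c : ℤ) (x : SVec) (o : ℕ) {ys : List (HeckeAlgebra cs)} {as : List SVec}
    (h : ys.length = as.length) : dot C ys (addAt c x o as) =
      dot C ys as + LaurentPolynomial.C c • (ys.getD o 0 * SVec.sem C x) := by
  induction as generalizing o ys with
  | nil =>
    obtain rfl := List.length_eq_zero_iff.mp h
    simp [addAt]
  | cons a as ih =>
    obtain ⟨y, ys, rfl⟩ := List.exists_cons_of_length_eq_add_one h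
    rw [List.length_cons, List.length_cons, Nat.add_right_cancel_iff] at h
    cases o with
    | zero =>
      rw [addAt, dot, dot, SVec.sem_addMul, List.getD_cons_zero, mul_add, mul_smul_comm]
      abel
    | succ o =>
      rw [addAt, dot, dot, ih o h, List.getD_cons_succ, add_assoc]

theorem dot_subAt (x : SVec) (l : List (ℕ × ℤ)) {ys : List (HeckeAlgebra cs)} {as : List SVec}
    (h : ys.length = as.length) : dot C ys (subAt x l as) = dot C ys as -
      (l.map fun e => LaurentPolynomial.C e.2 • ys.getD e.1 0).sum * SVec.sem C x := by
  induction l generalizing as with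
  | nil => simp [subAt]
  | cons e l ih =>
    rw [subAt, ih (by rw [h, length_addAt]), dot_addAt _ _ _ h, List.map_cons, List.sum_cons,
      add_mul, map_neg, neg_smul, smul_mul_assoc]
    abel

/-- The anti-involution reverses products, so an instruction reads y = y_o C_i − Σ c y_{o'} and y a
= y_o (C_i a) − Σ c y_{o'} a. The vector is thus pushed onto the accumulators of earlier elements,
and each instruction is visited once. -/
theorem sem_clenshaw (hC : cs.IsKLBasis C) (P : List Instr) (a : SVec) {as : List SVec}
    (h : as.length = P.length) :
    SVec.sem C (clenshaw P a as) = dot C (runFlip P) (a :: as) := by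
  induction P generalizing a as with
  | nil =>
    obtain rfl := List.length_eq_zero_iff.mp h
    simp [clenshaw, runFlip, runH, dot, heckeFlip_one]
  | cons ins P ih =>
    obtain ⟨i, o, l⟩ := ins
    have h1 : (subAt a l (addAt 1 (SVec.mulC i a) o as)).length = P.length + 1 := by
      rw [length_subAt, length_addAt, h, List.length_cons]
    obtain ⟨b, bs, hb⟩ := List.exists_cons_of_length_eq_add_one h1
    have h2 : (runFlip P).length = as.length := by rw [length_runFlip, h, List.length_cons]
    have h3 : clenshaw ((i, o, l) :: P) a as = clenshaw P b bs := by
      rw [clenshaw, hb]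
    rw [hb, List.length_cons, Nat.add_right_cancel_iff] at h1
    rw [h3, ih b h1, ← hb, dot_subAt _ _ (by rw [length_addAt, h2]), dot_addAt _ _ _ h2,
      runFlip_cons, dot, SVec.sem_mulC hC, map_one, one_smul, sub_mul, mul_assoc]
    abel

theorem dot_replicate (ys : List (HeckeAlgebra cs)) (n : ℕ) :
    dot C ys (List.replicate n (0, .nil)) = 0 := by
  induction ys generalizing n with
  | nil => rfl
  | cons y ys ih =>
    cases n with
    | zero => rfl
    | succ n => rw [List.replicate_succ, dot, ih, sem_nil, mul_zero, add_zero]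

/-- Applies the image under `heckeFlip` of the last element produced by a program. -/
def applyFlip (P : List Instr) (a : SVec) : SVec :=
  clenshaw P a (List.replicate P.length (0, .nil))

theorem sem_applyFlip (hC : cs.IsKLBasis C) (P : List Instr) (a : SVec) :
    SVec.sem C (applyFlip P a) = heckeFlip cs ((runH P).getD 0 0) * SVec.sem C a := by
  rw [applyFlip, sem_clenshaw hC P a List.length_replicate]
  have h : runFlip P = heckeFlip cs ((runH P).getD 0 0) :: (runFlip P).tail := by
    cases P with
    | nil => rfl
    | cons a P => obtain ⟨i, o, l⟩ := a; rfl
  rw [h, dot, dot_replicate, add_zero]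

end

end AffineG2

namespace AffineG2
open CoxeterSystem LaurentPolynomial

/-! ### Certificates -/

/-- A certificate that a combination is a Kazhdan–Lusztig element with leading term at `p`. -/
def checkKL (p : ℤ × ℤ) (x : SVec) : Bool :=
  decide (0 ≤ x.1) &&
    (x.2.all fun A B q => headZero x.1.toNat q &&
      if p.1 = A ∧ p.2 = B then (q.drop (x.1.toNat + 1)).all (· == 0)
      else decide (q.getD x.1.toNat 0 = 0)) &&
    decide (x.2.coeffAt p.1 p.2 x.1.toNat = 1)

theorem evalPoly_of_monomial {n : ℕ} {q : List ℤ} (h : headZero n q = true)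
    (h' : (q.drop (n + 1)).all (· == 0) = true) :
    T (n : ℤ) * evalPoly q = LaurentPolynomial.C (q.getD n 0) := by
  have h1 : evalPoly (q.drop n) = LaurentPolynomial.C (q.getD n 0) := by
    rw [evalPoly_eq_take_add_drop _ 1, List.drop_drop, evalPoly_eq_zero (p := q.drop (n + 1)),
      mul_zero, add_zero]
    · have h2 : (q.drop n).take 1 = [] ∨ ∃ a, (q.drop n).take 1 = [a] ∧ q.getD n 0 = a := by
        by_cases hn : n < q.length
        · right
          refine ⟨q[n], ?_, by simp [hn]⟩
          rw [List.drop_eq_getElem_cons hn, List.take_succ_cons, List.take_zero]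
        · left
          rw [List.drop_of_length_le (by omega), List.take_nil]
      rcases h2 with h2 | ⟨a, h2, ha⟩
      · have : q.length ≤ n := by
          by_contra hc
          rw [List.drop_eq_getElem_cons (by omega)] at h2
          simp at h2
          omega
        rw [h2, List.getD_eq_default _ _ this, map_zero]
        rfl
      · rw [h2, ha]
        simp [evalPoly]
    · intro a ha
      simpa using List.all_eq_true.mp h' a ha
  rw [evalPoly_of_headZero h, ← mul_assoc, ← T_add, add_neg_cancel, T_zero, one_mul, h1]

theorem degLE_neg_one_of_headZero {n : ℕ} {q : List ℤ} (h : headZero n q = true)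
    (h' : q.getD n 0 = 0) : DegLE (-1) (T (n : ℤ) * evalPoly q) := by
  intro m hm
  have h0 : DegLE 0 (T (n : ℤ) * evalPoly q) :=
    degLE_T_mul_iff.mpr ((degLE_of_headZero h).mono (by omega))
  by_cases hm0 : m = 0
  · rw [hm0, coeff_T_mul, zero_sub, coeff_evalPoly, h']
  · exact h0 m (by omega)

section

variable {C : Module.Basis W ℤ[T;T⁻¹] (HeckeAlgebra cs)}

theorem repr_node (l r : Vec) (A B : ℤ) (p : List ℤ) (g : W) (a : ℤ[T;T⁻¹]) :
    a * (heckeBasisN strongExchange).repr (Vec.sem C (.node l A B p r)) g =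
      a * (heckeBasisN strongExchange).repr (Vec.sem C l) g +
        (a * evalPoly p * (heckeBasisN strongExchange).repr (stdElt C (A, B)) g +
          a * (heckeBasisN strongExchange).repr (Vec.sem C r) g) := by
  rw [Vec.sem, map_add, map_add, map_smul, Finsupp.add_apply, Finsupp.add_apply,
    Finsupp.smul_apply, smul_eq_mul]
  ring

theorem pt_minRep_mul_w₀ (p : ℤ × ℤ) : pt (minRep p * w₀) = p := by
  rw [pt_mul_of_mem _ w₀_mem, pt_minRep]

theorem repr_of_checkKL (hC : cs.IsKLBasis C) {p : ℤ × ℤ} {n : ℕ} {x : Vec}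
    (h : (x.all fun A B q => headZero n q &&
      if p.1 = A ∧ p.2 = B then (q.drop (n + 1)).all (· == 0)
      else decide (q.getD n 0 = 0)) = true) :
    T (n : ℤ) * (heckeBasisN strongExchange).repr (Vec.sem C x) (minRep p * w₀) =
        LaurentPolynomial.C (x.coeffAt p.1 p.2 n) ∧
      ∀ g, g ≠ minRep p * w₀ →
        DegLE (-1) (T (n : ℤ) * (heckeBasisN strongExchange).repr (Vec.sem C x) g) := by
  induction x with
  | nil =>
    have h0 : ∀ g, T (n : ℤ) * (heckeBasisN strongExchange).repr (Vec.sem C .nil) g = 0 := by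
      intro g
      rw [Vec.sem, map_zero, Finsupp.zero_apply, mul_zero]
    refine ⟨by rw [h0, Vec.coeffAt, map_zero], fun g _ => ?_⟩
    rw [h0]
    exact degLE_zero _
  | node l A B q r ihl ihr =>
    simp only [Vec.all, Bool.and_eq_true] at h
    obtain ⟨⟨hq, hif⟩, hl, hr⟩ := h
    obtain ⟨l1, l2⟩ := ihl (by simpa only [Bool.and_eq_true] using hl)
    obtain ⟨r1, r2⟩ := ihr (by simpa only [Bool.and_eq_true] using hr)
    have hdeg : DegLE 0 (T (n : ℤ) * evalPoly q) :=
      degLE_T_mul_iff.mpr ((degLE_of_headZero hq).mono (by omega))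
    constructor
    · rw [repr_node, l1, r1, Vec.coeffAt, map_add, map_add]
      have : T (n : ℤ) * evalPoly q *
          (heckeBasisN strongExchange).repr (stdElt C (A, B)) (minRep p * w₀) =
          LaurentPolynomial.C (if p.1 = A ∧ p.2 = B then q.getD n 0 else 0) := by
        split_ifs at hif ⊢ with hp
        · rw [show (A, B) = p from Prod.ext hp.1.symm hp.2.symm, repr_stdElt_self hC, mul_one,
            evalPoly_of_monomial hq hif]
        · rw [repr_stdElt_of_ne hC, mul_zero, map_zero]
          rw [pt_minRep_mul_w₀]
          exact fun h => hp ⟨congrArg Prod.fst h, congrArg Prod.snd h⟩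
      rw [this]
      ring
    · intro g hg
      rw [repr_node]
      refine (l2 g hg).add (DegLE.add ?_ (r2 g hg))
      split_ifs at hif with hp
      · rw [show (A, B) = p from Prod.ext hp.1.symm hp.2.symm]
        exact (hdeg.mul (degLE_repr_stdElt hC hg)).mono (by omega)
      · exact ((degLE_neg_one_of_headZero hq (of_decide_eq_true hif)).mul
          (degLE_zero_repr_stdElt hC _ g)).mono (by omega)

/-- The certificate gives coordinate 1 at m_p w₀ and negative powers of v elsewhere, so with
bar-invariance the uniqueness criterion applies. Entry number n of a coefficient list is the
constant term after scaling by vⁿ. -/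
theorem eq_klBasis_of_checkKL (hC : cs.IsKLBasis C) {p : ℤ × ℤ} {x : SVec}
    (h : checkKL p x = true) (hb : heckeBar cs (SVec.sem C x) = SVec.sem C x) :
    SVec.sem C x = C (minRep p * w₀) := by
  obtain ⟨n, x⟩ := x
  simp only [checkKL, Bool.and_eq_true (a := _ && _), Bool.and_eq_true (a := decide (0 ≤ n)),
    decide_eq_true_eq (p := 0 ≤ n)] at h
  obtain ⟨⟨hn, h1⟩, h2⟩ := h
  obtain ⟨k, rfl⟩ := Int.eq_ofNat_of_zero_le hn
  rw [Int.toNat_natCast] at h1 h2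
  obtain ⟨h3, h4⟩ := repr_of_checkKL hC h1
  rw [of_decide_eq_true h2, map_one] at h3
  refine (hC.isKLElement _).eq_of_heckeBar_eq strongExchange hb ?_ fun u hu => ?_
  · rw [SVec.sem, map_smul, Finsupp.smul_apply, smul_eq_mul, h3]
  · rw [SVec.sem, map_smul, Finsupp.smul_apply, smul_eq_mul]
    exact h4 u hu

/-- The three points at which the coefficient of `q^{5/2}` may be non-zero. -/
def specialPts : List (ℤ × ℤ) := [(0, 0), (-1, 0), (0, -1)]

/-- A certificate for the coefficients of `q^3` and `q^{5/2}` in a combination. -/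
def checkTop (x : SVec) : Bool :=
  decide (6 ≤ x.1) &&
    (x.2.all fun A B q => headZero (x.1 - 6).toNat q &&
      (decide (A = 0 ∧ B = 0) || decide (q.getD (x.1 - 6).toNat 0 = 0)) &&
      (decide (0 < A) || decide (0 < B) || specialPts.contains (A, B) ||
        decide (q.getD ((x.1 - 6).toNat + 1) 0 = 0))) &&
    specialPts.all fun p => decide (x.2.coeffAt p.1 p.2 ((x.1 - 6).toNat + 1) = 0) ||
      decide (x.2.coeffAt p.1 p.2 ((x.1 - 6).toNat + 1) = 1)

theorem coeff_repr_vec (hC : cs.IsKLBasis C) (p : ℤ × ℤ) (k : ℕ) (x : Vec) :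
    ((heckeBasisN strongExchange).repr (Vec.sem C x) (minRep p * w₀)).coeff (-(k : ℤ)) =
      x.coeffAt p.1 p.2 k := by
  induction x with
  | nil =>
    rw [Vec.sem, map_zero]
    rfl
  | node l A B q r ihl ihr =>
    have e : ∀ a b : ℤ[T;T⁻¹], ∀ n, (a + b).coeff n = a.coeff n + b.coeff n := fun _ _ _ => rfl
    have h1 := repr_node (C := C) l r A B q (minRep p * w₀) 1
    rw [one_mul, one_mul, one_mul, one_mul] at h1
    rw [h1, e, e, ihl, ihr, Vec.coeffAt]
    split_ifs with hp
    · rw [show (A, B) = p from Prod.ext hp.1.symm hp.2.symm, repr_stdElt_self hC, mul_one,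
        coeff_evalPoly]
      ring
    · rw [repr_stdElt_of_ne hC, mul_zero]
      · rw [show (0 : ℤ[T;T⁻¹]).coeff (-(k : ℤ)) = 0 from rfl]
        ring
      · rw [pt_minRep_mul_w₀]
        exact fun h => hp ⟨congrArg Prod.fst h, congrArg Prod.snd h⟩

/-- Entry k is the top degree allowed by the check. A standard element reaches it only at its own
m_p w₀, and there the entry vanishes unless p is the origin, that is unless g = w₀. -/
theorem coeff_repr_vec_eq_zero (hC : cs.IsKLBasis C) {k : ℕ} {x : Vec} {g : W} (hg : g ≠ w₀)
    (h : (x.all fun A B q => headZero k q &&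
      (decide (A = 0 ∧ B = 0) || decide (q.getD k 0 = 0))) = true) :
    ((heckeBasisN strongExchange).repr (Vec.sem C x) g).coeff (-(k : ℤ)) = 0 := by
  induction x with
  | nil =>
    rw [Vec.sem, map_zero]
    rfl
  | node l A B q r ihl ihr =>
    have e : ∀ a b : ℤ[T;T⁻¹], ∀ n, (a + b).coeff n = a.coeff n + b.coeff n := fun _ _ _ => rfl
    have h1 := repr_node (C := C) l r A B q g 1
    rw [one_mul, one_mul, one_mul, one_mul] at h1
    rw [Vec.all] at h
    obtain ⟨hq, h'⟩ := Bool.and_eq_true_iff.mp h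
    obtain ⟨hl, hr⟩ := Bool.and_eq_true_iff.mp h'
    rw [h1, e, e, ihl hl, ihr hr, zero_add, add_zero]
    rw [Bool.and_eq_true, Bool.or_eq_true, decide_eq_true_eq, decide_eq_true_eq] at hq
    obtain ⟨hz, hq⟩ := hq
    have hd := degLE_of_headZero hz
    by_cases ht : g = minRep (A, B) * w₀
    · rcases hq with ⟨rfl, rfl⟩ | hq
      · rw [minRep_zero, one_mul] at ht
        exact absurd ht hg
      · rw [ht, repr_stdElt_self hC, mul_one, coeff_evalPoly, hq]
    · exact hd.mul (degLE_repr_stdElt hC ht) _ (by omega)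

theorem vec_all_mono {f f' : ℤ → ℤ → List ℤ → Bool} (h : ∀ A B q, f A B q = true → f' A B q = true)
    {x : Vec} (hx : x.all f = true) : x.all f' = true := by
  induction x with
  | nil => rfl
  | node l A B q r ihl ihr =>
    simp only [Vec.all, Bool.and_eq_true] at hx ⊢
    exact ⟨h _ _ _ hx.1, ihl hx.2.1, ihr hx.2.2⟩

theorem coeffAt_eq_zero {p : ℤ × ℤ} {k : ℕ} {x : Vec} (hp1 : p.1 ≤ 0) (hp2 : p.2 ≤ 0)
    (hp : p ∉ specialPts)
    (h : (x.all fun A B q => decide (0 < A) || decide (0 < B) || specialPts.contains (A, B) ||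
        decide (q.getD k 0 = 0)) = true) : x.coeffAt p.1 p.2 k = 0 := by
  induction x with
  | nil => rfl
  | node l A B q r ihl ihr =>
    rw [Vec.all] at h
    obtain ⟨hq, h'⟩ := Bool.and_eq_true_iff.mp h
    obtain ⟨hl, hr⟩ := Bool.and_eq_true_iff.mp h'
    rw [Vec.coeffAt, ihl hl, ihr hr, add_zero, add_zero]
    split_ifs with hAB
    · obtain ⟨rfl, rfl⟩ := hAB
      simp only [Bool.or_eq_true, decide_eq_true_eq, List.contains_iff_mem] at hq
      rcases hq with ((hq | hq) | hq) | hq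
      · omega
      · omega
      · exact absurd hq hp
      · exact hq
    · rfl

theorem coeff_six_of_checkTop (hC : cs.IsKLBasis C) {x : SVec} (h : checkTop x = true) {g : W}
    (hg : g ≠ w₀) : ((heckeBasisN strongExchange).repr (SVec.sem C x) g).coeff 6 = 0 := by
  obtain ⟨n, x⟩ := x
  rw [checkTop, Bool.and_eq_true, Bool.and_eq_true, decide_eq_true_eq] at h
  obtain ⟨⟨hn, h1⟩, -⟩ := h
  have h2 := coeff_repr_vec_eq_zero hC hg (vec_all_mono (fun A B q hq =>
    (Bool.and_eq_true _ _ ▸ hq : _ ∧ _).1) h1)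
  rw [SVec.sem, map_smul, Finsupp.smul_apply, smul_eq_mul, coeff_T_mul]
  dsimp only at hn h2 ⊢
  rw [Int.toNat_of_nonneg (by omega)] at h2
  rw [← h2]
  congr 1
  ring

/-- After scaling by vⁿ, entry n − 6 of the lists is the coefficient of v⁶ and the next one that of
v⁵. The certificate leaves v⁵ unrestricted at points with a positive coordinate, which no dominant
weight has. -/
theorem coeff_five_of_checkTop (hC : cs.IsKLBasis C) {x : SVec} (h : checkTop x = true)
    {p : ℤ × ℤ} (hp1 : p.1 ≤ 0) (hp2 : p.2 ≤ 0)
    (hne : ((heckeBasisN strongExchange).repr (SVec.sem C x) (minRep p * w₀)).coeff 5 ≠ 0) :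
    ((heckeBasisN strongExchange).repr (SVec.sem C x) (minRep p * w₀)).coeff 5 = 1 ∧
      p ∈ specialPts := by
  obtain ⟨n, x⟩ := x
  rw [checkTop, Bool.and_eq_true, Bool.and_eq_true, decide_eq_true_eq] at h
  obtain ⟨⟨hn, h1⟩, h2⟩ := h
  dsimp only at hn h1 h2
  have h3 : ((heckeBasisN strongExchange).repr (SVec.sem C (n, x)) (minRep p * w₀)).coeff 5 =
      x.coeffAt p.1 p.2 ((n - 6).toNat + 1) := by
    rw [SVec.sem, map_smul, Finsupp.smul_apply, smul_eq_mul, coeff_T_mul, ← coeff_repr_vec hC]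
    congr 1
    push_cast
    rw [Int.toNat_of_nonneg (by omega)]
    ring
  rw [h3] at hne ⊢
  have hmem : p ∈ specialPts := by
    by_contra hp
    exact hne (coeffAt_eq_zero hp1 hp2 hp (vec_all_mono (fun A B q hq =>
      (Bool.and_eq_true _ _ ▸ hq : _ ∧ _).2) h1))
  refine ⟨?_, hmem⟩
  have h4 := List.all_eq_true.mp h2 p hmem
  rw [Bool.or_eq_true, decide_eq_true_eq, decide_eq_true_eq] at h4
  exact h4.resolve_left hne

end

end AffineG2

namespace AffineG2
open CoxeterSystem LaurentPolynomial

/-! ### The twelve elements -/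

/-- A program whose results include the elements carrying `C_{w₀}` to the `C_{d_u w₀}`. -/
def program : List Instr :=
  [(0, 0, [(9, 1)]), (1, 0, [(1, 1)]), (2, 0, [(1, 1), (3, 1)]), (1, 0, [(1, 1)]), (2, 0, []),
    (0, 2, [(3, 1)]), (1, 0, [(1, 1)]), (2, 0, [(1, 1)]), (1, 0, [(1, 1)]), (2, 0, [(1, 1)]),
    (1, 0, [(1, 1)]), (0, 0, [])]

/-- The words of the elements `u` of `W₀`, the points corresponding to `d_u`, and the positions of
the corresponding results of the program. -/
def table : List (List (Fin 3) × (ℤ × ℤ) × ℕ) :=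
  [([1, 2, 1, 2, 1, 2], (1, 1), 0), ([2], (-3, 1), 1), ([1, 2], (3, -2), 2),
    ([2, 1, 2], (-3, 2), 3), ([1, 2, 1, 2], (3, -1), 4), ([2, 1, 2, 1, 2], (0, 1), 5),
    ([1], (1, -1), 7), ([2, 1], (-2, 1), 8), ([1, 2, 1], (2, -1), 9), ([2, 1, 2, 1], (-1, 1), 10),
    ([1, 2, 1, 2, 1], (1, 0), 11), ([], (0, 0), 12)]

/-- The element number `j` produced by the program, up to terms of degree at most `-2`. -/
def leading (j : ℕ) : SVec :=
  let e := (run program).getD j (0, .nil)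
  SVec.window e.1.toNat 2 e

/-- The product of the image of the element number `j` under `heckeFlip` and `leading j'`. -/
def partialProduct (j j' : ℕ) : SVec := applyFlip (program.drop j) (leading j')

/-- The product of two of the elements up to terms of degree at most `4`. -/
def product (x : SVec) : SVec :=
  SVec.mulW₀ (SVec.proj (SVec.window (x.1 - 6).toNat (x.1 - (x.1 - 6).toNat + 2).toNat x))

-- Kernel evaluation: the program yields the C_{d_u w₀} for all twelve u.
set_option maxRecDepth 100000 in
theorem checkKL_table :
    (table.all fun a => checkKL a.2.1 ((run program).getD a.2.2 (0, .nil))) = true := by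
  decide +kernel

-- Kernel evaluation over all 144 pairs. The first condition ensures that the next truncation
-- discards only zeros above degree 6.
set_option maxRecDepth 100000 in
theorem checkTop_table :
    (table.all fun a => table.all fun b =>
      SVec.headZero ((partialProduct a.2.2 b.2.2).1 - 6).toNat (partialProduct a.2.2 b.2.2) &&
        checkTop (product (partialProduct a.2.2 b.2.2))) = true := by
  decide +kernel

end AffineG2

/-! ### The elements `d_u` -/

namespace AffineG2
open CoxeterSystem LaurentPolynomial

theorem rootAction_wordProd (ω : List (Fin 3)) :
    rootAction (cs.wordProd ω) = (ω.map simpleAction).prod := by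
  rw [CoxeterSystem.wordProd, map_list_prod, List.map_map]
  congr 2
  funext i
  exact cs.lift_apply_simple simpleAction_isLiftable i

/-- The weight `∑ x_γ`, over the simple roots `γ` with `u(γ)` negative, for `u` with reduced word
`ω`. -/
def shift (ω : List (Fin 3)) : ℤ × ℤ :=
  (if ω = w₀Word ∨ ω.getLast? = some 1 then 1 else 0,
    if ω = w₀Word ∨ ω.getLast? = some 2 then 1 else 0)

/-- The root u(γ) is negative exactly when u s_γ is shorter than u. An element other than w₀ has a
single reduced word, whose last letter is the only such reflection; for w₀ both are. -/
theorem mulVec_mem_negRoots : ∀ a ∈ table,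
    ((a.1.map simpleAction).prod.mulVec α ∈ negRoots ↔ a.1 = w₀Word ∨ a.1.getLast? = some 1) ∧
    ((a.1.map simpleAction).prod.mulVec β ∈ negRoots ↔ a.1 = w₀Word ∨ a.1.getLast? = some 2) := by
  unfold negRoots
  simp only [Set.mem_insert_iff, Set.mem_singleton_iff]
  decide

theorem exists_d_eq {a : List (Fin 3) × (ℤ × ℤ) × ℕ} (ha : a ∈ table) :
    ∃ x, d (cs.wordProd a.1) = cs.wordProd a.1 * x ∧ IsTrans x (shift a.1) := by
  classical
  refine ⟨_, rfl, ?_⟩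
  have h := mulVec_mem_negRoots a ha
  rw [rootAction_wordProd, if_congr h.1 rfl rfl, if_congr h.2 rfl rfl]
  have e : shift a.1 = (if a.1 = w₀Word ∨ a.1.getLast? = some 1 then ((1, 0) : ℤ × ℤ) else 0) +
      (if a.1 = w₀Word ∨ a.1.getLast? = some 2 then ((0, 1) : ℤ × ℤ) else 0) := by
    rw [shift]
    split_ifs <;> simp
  rw [e]
  refine IsTrans.mul ?_ ?_
  · split_ifs
    exacts [isTrans_xα, IsTrans.one]
  · split_ifs
    exacts [isTrans_xβ, IsTrans.one]

theorem pt_wordProd_mul (ω : List (Fin 3)) (w : W) :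
    pt (cs.wordProd ω * w) = ω.foldr reflPt (pt w) := by
  induction ω with
  | nil => rw [cs.wordProd_nil, one_mul, List.foldr_nil]
  | cons i ω ih => rw [cs.wordProd_cons, mul_assoc, pt_simple_mul, ih, List.foldr_cons]

/-- The last two clauses say that d_u sends the two finite simple roots to positive roots, so d_u is
minimal in d_u W₀. -/
theorem table_spec : ∀ a ∈ table, a.1.foldr reflPt (-shift a.1) = a.2.1 ∧
    0 < (a.1.foldr (fun i g => simpleEnd i g) ((1, 0, (shift a.1).1) : ℤ × ℤ × ℤ)).1 +
      (a.1.foldr (fun i g => simpleEnd i g) ((1, 0, (shift a.1).1) : ℤ × ℤ × ℤ)).2.1 +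
      6 * (a.1.foldr (fun i g => simpleEnd i g) ((1, 0, (shift a.1).1) : ℤ × ℤ × ℤ)).2.2 ∧
    0 < (a.1.foldr (fun i g => simpleEnd i g) ((0, 1, (shift a.1).2) : ℤ × ℤ × ℤ)).1 +
      (a.1.foldr (fun i g => simpleEnd i g) ((0, 1, (shift a.1).2) : ℤ × ℤ × ℤ)).2.1 +
      6 * (a.1.foldr (fun i g => simpleEnd i g) ((0, 1, (shift a.1).2) : ℤ × ℤ × ℤ)).2.2 := by
  decide

theorem d_wordProd {a : List (Fin 3) × (ℤ × ℤ) × ℕ} (ha : a ∈ table) :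
    d (cs.wordProd a.1) = minRep a.2.1 := by
  obtain ⟨x, hd, hx⟩ := exists_d_eq ha
  obtain ⟨h0, h1, h2⟩ := table_spec a ha
  have hm : IsMinimal (cs.wordProd a.1 * x) := by
    constructor <;> rw [not_isRightDescent_iff, act_mul_apply, act_wordProd, height_apply, hx]
    · simpa [simpleRoot] using h1
    · simpa [simpleRoot] using h2
  rw [hd, hm.eq_minRep, pt_wordProd_mul, hx.pt_eq, h0]

theorem exists_table {u : W} (hu : u ∈ W₀) : ∃ a ∈ table, d u = minRep a.2.1 := by
  obtain ⟨ω, hω, rfl⟩ := exists_w₀Words hu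
  obtain ⟨a, ha, rfl⟩ := (by decide : ∀ ω ∈ w₀Words, ∃ a ∈ table, a.1 = ω) ω hω
  exact ⟨a, ha, d_wordProd ha⟩

/-! ### Products of the elements -/

theorem runH_drop (P : List Instr) {j : ℕ} (h : j ≤ P.length) :
    (runH (P.drop j)).getD 0 0 = (runH P).getD j 0 := by
  induction P generalizing j with
  | nil =>
    obtain rfl : j = 0 := by simpa using h
    rfl
  | cons a P ih =>
    cases j with
    | zero => rfl
    | succ j =>
      obtain ⟨i, o, l⟩ := a
      rw [List.drop_succ_cons, runH, List.getD_cons_succ]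
      exact ih (by simpa using h)

theorem IsSmall.mono {m n : ℤ} {h : HeckeAlgebra cs} (hh : IsSmall m h) (hmn : m ≤ n) :
    IsSmall n h := fun w => (hh w).mono hmn

section

variable {C : Module.Basis W ℤ[T;T⁻¹] (HeckeAlgebra cs)}

theorem sem_run (hC : cs.IsKLBasis C) {a : List (Fin 3) × (ℤ × ℤ) × ℕ} (ha : a ∈ table) :
    SVec.sem C ((run program).getD a.2.2 (0, .nil)) = C (minRep a.2.1 * w₀) := by
  refine eq_klBasis_of_checkKL hC (List.all_eq_true.mp checkKL_table a ha) ?_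
  rw [sem_getD (map_sem_run hC program), map_mul, heckeBar_runH, (hC w₀).1]

/-- Applying the anti-involution to h C_{w₀} = C_{m w₀} moves h to the right of C_{w₀}. -/
theorem klBasis_w₀_mul_heckeFlip (hC : cs.IsKLBasis C) {a : List (Fin 3) × (ℤ × ℤ) × ℕ}
    (ha : a ∈ table) : C w₀ * heckeFlip cs ((runH program).getD a.2.2 0) =
      C (w₀ * (minRep a.2.1)⁻¹) := by
  have h := congrArg (heckeFlip cs) (sem_run hC ha)
  rwa [sem_getD (map_sem_run hC program), heckeFlip_mul, hC.heckeFlip_apply strongExchange,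
    hC.heckeFlip_apply strongExchange, mul_inv_rev, w₀_inv] at h

theorem isSmall_sub_leading (hC : cs.IsKLBasis C) {a : List (Fin 3) × (ℤ × ℤ) × ℕ}
    (ha : a ∈ table) : IsSmall (-2) (C (minRep a.2.1 * w₀) - SVec.sem C (leading a.2.2)) := by
  have h := List.all_eq_true.mp checkKL_table a ha
  rw [checkKL, Bool.and_eq_true, Bool.and_eq_true, decide_eq_true_eq] at h
  obtain ⟨⟨h1, h2⟩, -⟩ := h
  have h3 : SVec.headZero ((run program).getD a.2.2 (0, .nil)).1.toNat
      ((run program).getD a.2.2 (0, .nil)) = true :=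
    vec_all_mono (fun A B q hq => (Bool.and_eq_true_iff.mp hq).1) h2
  rw [← sem_run hC ha]
  exact (isSmall_window hC _ 2 _ h3).mono (by push_cast; omega)

/-- Both truncations discard elements of degree at most −2. Multiplying by a Kazhdan–Lusztig
element, of degree at most 0, adds at most 6, so the error has degree at most 4 and does not reach
v⁵ or v⁶. -/
theorem isSmall_sub_product (hC : cs.IsKLBasis C) {a b : List (Fin 3) × (ℤ × ℤ) × ℕ}
    (ha : a ∈ table) (hb : b ∈ table) :
    IsSmall 4 (C (w₀ * (minRep a.2.1)⁻¹) * C (minRep b.2.1 * w₀) -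
      SVec.sem C (product (partialProduct a.2.2 b.2.2))) := by
  have h1 := ((isSmall_klBasis hC (w₀ * (minRep a.2.1)⁻¹)).mul
    (isSmall_sub_leading hC hb)).mono (n := 4) (by norm_num)
  have hlen : a.2.2 ≤ program.length :=
    (by decide : ∀ a ∈ table, a.2.2 ≤ program.length) a ha
  have h2 : C (w₀ * (minRep a.2.1)⁻¹) * SVec.sem C (leading b.2.2) =
      C w₀ * SVec.sem C (partialProduct a.2.2 b.2.2) := by
    rw [partialProduct, sem_applyFlip hC, runH_drop _ hlen, ← mul_assoc,
      klBasis_w₀_mul_heckeFlip hC ha]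
  have hz := List.all_eq_true.mp (List.all_eq_true.mp checkTop_table a ha) b hb
  have hz := (Bool.and_eq_true_iff.mp hz).1
  generalize partialProduct a.2.2 b.2.2 = p at *
  have h3 := ((isSmall_klBasis hC w₀).mul (isSmall_window hC (p.1 - 6).toNat
    (p.1 - (p.1 - 6).toNat + 2).toNat p hz)).mono (n := 4) (by omega)
  rw [mul_sub, h2] at h1
  rw [mul_sub] at h3
  rw [product, SVec.sem_mulW₀ hC, SVec.mul_sem_proj hC]
  convert h1.add h3 using 1
  abel

theorem coeff_repr_mul (hC : cs.IsKLBasis C) {a b : List (Fin 3) × (ℤ × ℤ) × ℕ}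
    (ha : a ∈ table) (hb : b ∈ table) (g : W) {n : ℤ} (hn : 4 < n) :
    ((heckeBasisN strongExchange).repr (C (w₀ * (minRep a.2.1)⁻¹) * C (minRep b.2.1 * w₀)) g).coeff
      n = ((heckeBasisN strongExchange).repr
        (SVec.sem C (product (partialProduct a.2.2 b.2.2))) g).coeff n := by
  have h := isSmall_sub_product hC ha hb g n hn
  rw [map_sub, Finsupp.sub_apply] at h
  exact sub_eq_zero.mp h

/-! ### Lusztig's function -/

theorem degLE_repr_klBasis_mul (hC : cs.IsKLBasis C) (x y z : W) :
    DegLE 6 (C.repr (C x * C y) z) :=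
  hC.degLE_repr strongExchange
    (((isSmall_klBasis hC x).mul (isSmall_klBasis hC y)).mono (by norm_num)) z

theorem six_mem_aBounds (hC : cs.IsKLBasis C) (z : W) : 6 ∈ aBounds C z := by
  intro x y n hn
  rw [coeff_T_mul]
  exact degLE_repr_klBasis_mul hC x y z _ (by push_cast; omega)

theorem IsMinimal.mul_heckeWord (hC : cs.IsKLBasis C) {w : W} (hw : IsMinimal w)
    {ω : List (Fin 3)} (hω : 0 ∉ ω) :
    C (w * w₀) * heckeWord cs ω = (T (ω.length : ℤ) : ℤ[T;T⁻¹]) • C (w * w₀) := by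
  induction ω with
  | nil => simp [heckeWord_nil]
  | cons i ω ih =>
    rw [List.mem_cons, not_or] at hω
    rw [heckeWord_cons, ← mul_assoc, (hC.isKLElement _).mul_heckeTn_simple strongExchange
      (isRightDescent_mul_w₀ hw (Ne.symm hω.1)), smul_mul_assoc, ih hω.2, smul_smul, ← T_add,
      List.length_cons]
    congr 2
    push_cast
    ring

theorem IsMinimal.mul_klBasis_w₀ (hC : cs.IsKLBasis C) {w : W} (hw : IsMinimal w) :
    C (w * w₀) * C w₀ =
      (w₀Words.map fun ω => (T (2 * (ω.length : ℤ) - 6) : ℤ[T;T⁻¹])).sum • C (w * w₀) := by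
  rw [klBasis_w₀ hC, List.sum_toFinset _ (by decide), List.sum_smul, ← List.sum_map_mul_left,
    List.map_map]
  congr 1
  refine List.map_congr_left fun ω hω => ?_
  rw [Function.comp_apply, heckeTn_wordProd (isReduced_of_mem hω),
    mul_smul_comm, hw.mul_heckeWord hC (zero_notMem_of_mem hω), smul_smul, ← T_add]
  congr 2
  ring

/-- The bound 6 holds for every element. It is attained because C_{w w₀} C_{w₀} is C_{w w₀} times Σ
v^{2ℓ(u) − 6} over W₀, whose top term v⁶ comes from u = w₀. -/
theorem aFunction_mul_w₀ (hC : cs.IsKLBasis C) {w : W} (hw : IsMinimal w) :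
    aFunction C (w * w₀) = 6 := by
  refine le_antisymm (Nat.sInf_le (six_mem_aBounds hC _))
    (le_csInf ⟨6, six_mem_aBounds hC _⟩ fun i hi => ?_)
  by_contra hc
  have h := hi (w * w₀) w₀ (6 - i) (by omega)
  rw [coeff_T_mul, klStructureConst, hw.mul_klBasis_w₀ hC, map_smul, C.repr_self,
    Finsupp.smul_apply, Finsupp.single_eq_same, smul_eq_mul, mul_one,
    show (6 - (i : ℤ) - -(i : ℤ)) = 6 by ring] at h
  have e : ∀ a b : ℤ[T;T⁻¹], ∀ n, (a + b).coeff n = a.coeff n + b.coeff n := fun _ _ _ => rfl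
  simp only [w₀Words, List.map_cons, List.map_nil, List.sum_cons, List.sum_nil, e, T_apply,
    List.length_cons, List.length_nil] at h
  norm_num at h

end

/-! ### Dominant weights -/

theorem exists_isTrans {z : W} (hz : z ∈ weightLattice) : ∃ ν, IsTrans z ν := by
  induction hz using Subgroup.closure_induction with
  | mem x hx =>
    rcases hx with rfl | rfl
    exacts [⟨_, isTrans_xα⟩, ⟨_, isTrans_xβ⟩]
  | one => exact ⟨_, IsTrans.one⟩
  | mul x y _ _ hx hy => exact ⟨_, hx.choose_spec.mul hy.choose_spec⟩
  | inv x _ hx => exact ⟨_, hx.choose_spec.inv⟩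

theorem IsTrans.eq {w w' : W} {ν : ℤ × ℤ} (h : IsTrans w ν) (h' : IsTrans w' ν) : w = w' :=
  act_injective (LinearMap.ext fun f => by rw [h, h'])

/-- If i were a finite right descent of z, writing w₀ = s_i y with y of length 5 would give ℓ(z w₀)
≤ ℓ(z) − 1 + 5. -/
theorem isMinimal_of_mem_dominantWeights {z : W} (hz : z ∈ dominantWeights) : IsMinimal z := by
  obtain ⟨-, hl⟩ := hz
  have key : ∀ (i : Fin 3) (ω : List (Fin 3)), cs.wordProd (i :: ω) = w₀ → ω.length = 5 →
      ¬ cs.IsRightDescent z i := by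
    intro i ω hω h5 hi
    have h1 : z * w₀ = z * cs.simple i * cs.wordProd ω := by
      rw [← hω, cs.wordProd_cons, mul_assoc]
    have h2 := cs.length_mul_le (z * cs.simple i) (cs.wordProd ω)
    have h3 := cs.length_wordProd_le ω
    have h4 : cs.length (z * cs.simple i) < cs.length z := hi
    rw [← h1, hl, length_w₀] at h2
    omega
  exact ⟨key 1 [2, 1, 2, 1, 2] wordProd_w₀Word rfl, key 2 [1, 2, 1, 2, 1] wordProd_w₀Word' rfl⟩

theorem nonneg_of_mem_dominantWeights {z : W} (hz : z ∈ dominantWeights) {ν : ℤ × ℤ}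
    (h : IsTrans z ν) : 0 ≤ ν.1 ∧ 0 ≤ ν.2 := by
  obtain ⟨h1, h2⟩ := isMinimal_of_mem_dominantWeights hz
  rw [not_isRightDescent_iff, h, height_apply] at h1 h2
  simp only [simpleRoot] at h1 h2
  omega

theorem repr_klBasis_w₀_mul_w₀ {C : Module.Basis W ℤ[T;T⁻¹] (HeckeAlgebra cs)}
    (hC : cs.IsKLBasis C) {w : W} (hw : IsMinimal w) (h1 : w ≠ 1) :
    (heckeBasisN strongExchange).repr (C w₀) (w * w₀) = 0 := by
  by_contra hc
  have h := mem_W₀_of_bruhatLE ((hC.isKLElement w₀).bruhatLE strongExchange hc) w₀_mem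
  refine h1 (isMinimal_one.eq_one ?_ (by rwa [one_mul]))
  simpa using W₀.mul_mem h (W₀.inv_mem w₀_mem)

theorem klDelta_eq_one {C : Module.Basis W ℤ[T;T⁻¹] (HeckeAlgebra cs)} (hC : cs.IsKLBasis C)
    {u u' z : W} (hu : u ∈ W₀) (hu' : u' ∈ W₀) (hz : z ∈ dominantWeights)
    (hne : klDelta C (w₀ * (d u)⁻¹) (d u' * w₀) (z * w₀) ≠ 0) :
    klDelta C (w₀ * (d u)⁻¹) (d u' * w₀) (z * w₀) = 1 ∧ (z = 1 ∨ z = xα ∨ z = xβ) := by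
  have hm := isMinimal_of_mem_dominantWeights hz
  obtain ⟨ν, hν⟩ := exists_isTrans hz.1
  obtain ⟨hν1, hν2⟩ := nonneg_of_mem_dominantWeights hz hν
  obtain ⟨a, ha, hda⟩ := exists_table hu
  obtain ⟨b, hb, hdb⟩ := exists_table hu'
  rw [hda, hdb] at hne ⊢
  have hz' : z * w₀ = minRep (-ν) * w₀ := by rw [← hν.pt_eq, ← hm.eq_minRep]
  have hcheck := (Bool.and_eq_true_iff.mp
    (List.all_eq_true.mp (List.all_eq_true.mp checkTop_table a ha) b hb)).2
  have hdeg := degLE_repr_klBasis_mul hC (w₀ * (minRep a.2.1)⁻¹) (minRep b.2.1 * w₀)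
  have key : klDelta C (w₀ * (minRep a.2.1)⁻¹) (minRep b.2.1 * w₀) (z * w₀) =
      ((heckeBasisN strongExchange).repr
        (SVec.sem C (product (partialProduct a.2.2 b.2.2))) (minRep (-ν) * w₀)).coeff 5 := by
    rw [klDelta, aFunction_mul_w₀ hC hm, klStructureConst, ← coeff_repr_mul hC ha hb _ (by norm_num),
      ← hz']
    refine (hC.coeff_repr_sub_one strongExchange hdeg fun g hg => ?_).symm
    -- Only g = w₀ can carry v⁶, and C_{w₀} has no term at z w₀ when z ≠ 1; every other g has no v⁶
    -- by the certificate.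
    by_cases hg0 : g = w₀
    · right
      rw [hg0]
      refine repr_klBasis_w₀_mul_w₀ hC hm ?_
      rintro rfl
      exact hg (by rw [hg0, one_mul])
    · left
      rw [← hC.coeff_repr strongExchange hdeg, coeff_repr_mul hC ha hb _ (by norm_num),
        coeff_six_of_checkTop hC hcheck hg0]
  rw [key] at hne ⊢
  obtain ⟨h1, h2⟩ := coeff_five_of_checkTop hC hcheck (p := -ν) (by simpa using hν1)
    (by simpa using hν2) hne
  refine ⟨h1, ?_⟩
  rw [specialPts, List.mem_cons, List.mem_cons, List.mem_singleton, neg_eq_iff_eq_neg,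
    neg_eq_iff_eq_neg, neg_eq_iff_eq_neg] at h2
  rcases h2 with rfl | rfl | rfl
  · exact Or.inl (hν.eq IsTrans.one)
  · exact Or.inr (Or.inl (hν.eq isTrans_xα))
  · exact Or.inr (Or.inr (hν.eq isTrans_xβ))

end AffineG2

theorem mainTheorem2 :
    (∃! C : Module.Basis AffineG2.W ℤ[T;T⁻¹] (AffineG2.cs.HeckeAlgebra), AffineG2.cs.IsKLBasis C) ∧
    ∀ C : Module.Basis AffineG2.W ℤ[T;T⁻¹] (AffineG2.cs.HeckeAlgebra), AffineG2.cs.IsKLBasis C →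
      (∀ z : AffineG2.W, (CoxeterSystem.aBounds C z).Nonempty) ∧
      ∀ u ∈ AffineG2.W₀, ∀ u' ∈ AffineG2.W₀, ∀ z₁ ∈ AffineG2.dominantWeights,
        CoxeterSystem.klDelta C (AffineG2.w₀ * (AffineG2.d u)⁻¹) (AffineG2.d u' * AffineG2.w₀)
            (z₁ * AffineG2.w₀) ≠ 0 →
          CoxeterSystem.klDelta C (AffineG2.w₀ * (AffineG2.d u)⁻¹) (AffineG2.d u' * AffineG2.w₀)
              (z₁ * AffineG2.w₀) = 1 ∧
            (z₁ = 1 ∨ z₁ = AffineG2.xα ∨ z₁ = AffineG2.xβ) :=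
  ⟨CoxeterSystem.existsUnique_isKLBasis AffineG2.strongExchange, fun _ hC =>
    ⟨fun z => ⟨6, AffineG2.six_mem_aBounds hC z⟩, fun _ hu _ hu' _ hz hne =>
      AffineG2.klDelta_eq_one hC hu hu' hz hne⟩⟩
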